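/- Let $N=\langle x,y\mid [[x,y],x]=[[x,y],y]=1\rangle$ with the generating set $\{x^{\pm1},y^{\pm1},t^{\pm1}\}$, where $t=xy$ and $[x,y]=xyx^{-1}y^{-1}$. Let $\ell$ and $d$ be the word length and word metric of $N$, and let $p:N\to\mathbb Z^2$ be the homomorphism with $p(x)=(1,0)$, $p(y)=(0,1)$. The Cayley graph of $\mathbb Z^2$ with respect to $p(x),p(y),p(t)$ is the $1$-skeleton of the tessellation of the plane by equilateral triangles; it carries its path metric, in which edges have length $1$, and $\ell_{\mathbb Z^2}$ is the corresponding word length. A word $w$ is identified with the unit-speed path it labels from $1$, constant after time $\ell(w)$; it is a geodesic if its length is the length of the element it represents. The axial directions are, in cyclic order, $x,t,y,x^{-1},t^{-1},y^{-1}$, and the axes are the three lines through the origin in the directions $x$, $y$, $t$. A path crosses an axis if it has vertices strictly on both sides of it. For $P=(a,b)\in\mathbb Z^2$ and $m\ge 0$ an element $x^ay^b[x,y]^s$ of length at most $m$ is an extremal of $B_P(m)$ if $s$ is the largest or the smallest integer for which this element has length at most $m$. An almost regular hexagon is a closed circuit in the tessellation with six successive sides in the six axial directions (in one of the two cyclic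 orders), no two of which differ in length by more than $2$. An extremal path of $B_P(m)$ is a geodesic for an extremal of $B_P(m)$ whose projection is, up to translation, a subpath of an almost regular hexagon going round at most once. A standard geodesic for $g\in N$ is a geodesic $w$ for $g$ of the following form. If $\ell(g)=\ell_{\mathbb Z^2}(p(g))$, then $w=u^{i}v^{j}u^{e}v^{k}u^{l}$ with $u,v$ cyclically neighbouring axial directions, $i,j,k,l\ge0$ and $e\in\{0,1\}$ (so that in projection it stays as long as possible along one side of the parallelogram with corners $0$ and $p(g)$). If $\ell(g)=m+1>\ell_{\mathbb Z^2}(p(g))$, then $w=w_1cw_2$ with $w_1$ an initial segment of an extremal path of $B_{p(g)}(m)$, $c$ a single letter, and $w_2$ a final segment of an extremal path of $B_{p(g)}(m+1)$. Say that $(g,h)$ has property $(\ast)$ if there are standard geodesics for $g$ and for $h$ whose projections to the Cayley graph of $\mathbb Z^2$ lie in the $25$-neighbourhoods of each other and $50$-fellow travel (i.e. are at distance at most $50$ at every time $\tau\ge0$). **Lemma.** Let $g,g'\in N$ with $\ell(g)=\ell(g')=n$, and let $r$ be a word of length at most $2$ in the generators such that $g'=g\bar r$, where $\bar r$ is the element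 represented by $r$. Then at least one of the following holds. 1. $\ell(g)<50$ and $\ell(g')<50$. 2. $(g,g')$ has property $(\ast)$. 3. The projection of the path from $g$ to $g'$ labelled $r$ crosses an axis; and if it crosses exactly one axis, then there is $g''\in N$ with $\ell(g'')=n$, $d(g,g'')\le2$, $d(g',g'')\le2$, such that $p(g'')$ lies on that axis and both $(g,g'')$ and $(g'',g')$ have property $(\ast)$. -/

import Mathlib

namespace NilHex

open scoped commutatorElement

/-! ### The group and its generating set -/

inductive Gen
  | x
  | y

/-- The relators `[[x,y],x]` and `[[x,y],y]`. -/
def rels : Set (FreeGroup Gen) :=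
  {⁅⁅FreeGroup.of Gen.x, FreeGroup.of Gen.y⁆, FreeGroup.of Gen.x⁆,
   ⁅⁅FreeGroup.of Gen.x, FreeGroup.of Gen.y⁆, FreeGroup.of Gen.y⁆}

/-- The group `N = ⟨x, y | [[x,y],x] = [[x,y],y] = 1⟩`. -/
abbrev N : Type := PresentedGroup rels

def x : N := PresentedGroup.of Gen.x

def y : N := PresentedGroup.of Gen.y

/-- `z = [x,y] = x y x⁻¹ y⁻¹`. -/
def z : N := ⁅x, y⁆

/-- The letters `x, y, t` and their formal inverses `xi, yi, ti`. -/
inductive Letter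
  | x
  | y
  | t
  | xi
  | yi
  | ti

/-- The element of `N` named by a letter, where `t = x y`. -/
def Letter.val : Letter → N
  | .x => NilHex.x
  | .y => NilHex.y
  | .t => NilHex.x * NilHex.y
  | .xi => (NilHex.x)⁻¹
  | .yi => (NilHex.y)⁻¹
  | .ti => (NilHex.x * NilHex.y)⁻¹

/-- The six axial directions in cyclic order are `x, t, y, x⁻¹, t⁻¹, y⁻¹`;
`next` is the rotation by 60 degrees. -/
def Letter.next : Letter → Letter
  | .x => .t
  | .t => .y
  | .y => .xi
  | .xi => .ti
  | .ti => .yi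
  | .yi => .x

/-- Rotation by 60 degrees in the other direction. -/
def Letter.prev : Letter → Letter
  | .x => .yi
  | .t => .x
  | .y => .t
  | .xi => .y
  | .ti => .xi
  | .yi => .ti

abbrev Word : Type := List Letter

/-- The element of `N` represented by a word. -/
def eval (w : Word) : N := (w.map Letter.val).prod

/-! ### The projection to `ℤ²` -/

/-- The group `ℤ²`, written multiplicatively. -/
abbrev Plane : Type := Multiplicative (ℤ × ℤ)

def genPlane : Gen → Plane
  | .x => Multiplicative.ofAdd (1, 0)
  | .y => Multiplicative.ofAdd (0, 1)

theorem genPlane_rels : ∀ r ∈ rels, FreeGroup.lift genPlane r = 1 := by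
  intro r hr
  rcases hr with rfl | rfl <;> simp [map_commutatorElement, commutatorElement_eq_one_iff_mul_comm, mul_comm]

/-- The projection `N → ℤ²` with `x ↦ (1,0)` and `y ↦ (0,1)`. -/
def p : N →* Plane := PresentedGroup.toGroup genPlane_rels

/-- First coordinate of a point of `ℤ²`. -/
def fstCoord (P : Plane) : ℤ := (Multiplicative.toAdd P).1

/-- Second coordinate of a point of `ℤ²`. -/
def sndCoord (P : Plane) : ℤ := (Multiplicative.toAdd P).2

/-! ### Word metrics -/

/-- Word length with respect to the generators `gen`. -/
noncomputable def wordLength {G : Type} [Group G] (gen : Letter → G) (g : G) : ℕ :=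
  sInf {k : ℕ | ∃ w : Word, w.length = k ∧ (w.map gen).prod = g}

/-- The length of an element of `N` with respect to `{x, y, t}`. -/
noncomputable def len (g : N) : ℕ := wordLength Letter.val g

/-- The word metric of `N` with respect to `{x, y, t}`. -/
noncomputable def dist (g h : N) : ℕ := len (g⁻¹ * h)

/-- The length of an element of `ℤ²` with respect to the projections of `x, y, t`. -/
noncomputable def planeLen (P : Plane) : ℕ := wordLength (fun l => p l.val) P

/-- The word metric of `ℤ²` with respect to the projections of `x, y, t`. -/
noncomputable def planeDist (P Q : Plane) : ℕ := planeLen (P⁻¹ * Q)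

/-- A word is a geodesic if its length is the length of the element it represents. -/
def IsGeodesic (w : Word) : Prop := w.length = len (eval w)

/-! ### Paths in the Cayley graph of `ℤ²`, fellow travelling -/

/-- A point of the Cayley graph of `ℤ²` (every edge a unit interval): the point at distance
`s ∈ [0,1]` from `v` on the edge from `v` to `v'`. A vertex is also given by `v = v'`, `s = 0`. -/
structure GraphPoint where
  v : Plane
  v' : Plane
  s : ℝ

open Classical in
/-- The path metric of the Cayley graph of `ℤ²`: a shortest path between two points either leaves
the edges of both points through end points, or runs inside a common edge. -/
noncomputable def graphDist (P Q : GraphPoint) : ℝ :=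
  let via : ℝ :=
    min (min (P.s + planeDist P.v Q.v + Q.s) (P.s + planeDist P.v Q.v' + (1 - Q.s)))
      (min ((1 - P.s) + planeDist P.v' Q.v + Q.s) ((1 - P.s) + planeDist P.v' Q.v' + (1 - Q.s)))
  if P.v = Q.v ∧ P.v' = Q.v' then min via |P.s - Q.s|
  else if P.v = Q.v' ∧ P.v' = Q.v then min via |P.s - (1 - Q.s)|
  else via

/-- The projection to the Cayley graph of `ℤ²` of the path labelled `w` from the identity, at time
`τ ≥ 0`; unit speed on `[0, ℓ(w)]`, constant afterwards. -/
noncomputable def projPath (w : Word) (τ : ℝ) : GraphPoint :=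
  let σ : ℝ := min τ w.length
  { v := p (eval (w.take ⌊σ⌋₊))
    v' := p (eval (w.take (⌊σ⌋₊ + 1)))
    s := Int.fract σ }

/-- The projections of `w` and `w'` `K`-fellow travel. -/
def FellowTravel (K : ℝ) (w w' : Word) : Prop :=
  ∀ τ : ℝ, 0 ≤ τ → graphDist (projPath w τ) (projPath w' τ) ≤ K

/-- The projection of `w` lies in the `K`-neighbourhood of the projection of `w'`. -/
def InNeighbourhood (K : ℝ) (w w' : Word) : Prop :=
  ∀ τ : ℝ, 0 ≤ τ → ∃ σ : ℝ, 0 ≤ σ ∧ graphDist (projPath w τ) (projPath w' σ) ≤ K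

/-! ### Standard geodesics -/

/-- The part of the ball of radius `m` of `N` that lies over `P = (a,b) ∈ ℤ²`, where
`x^a y^b [x,y]^s` is identified with `s ∈ ℤ`. -/
def fibreBall (P : Plane) (m : ℕ) : Set ℤ :=
  {s : ℤ | len (x ^ fstCoord P * y ^ sndCoord P * z ^ s) ≤ m}

/-- `e` is at one of the two extremes of the part of the ball of radius `m` that lies over `P`. -/
def IsExtremal (P : Plane) (m : ℕ) (e : N) : Prop :=
  ∃ s : ℤ, e = x ^ fstCoord P * y ^ sndCoord P * z ^ s ∧
    (IsGreatest (fibreBall P m) s ∨ IsLeast (fibreBall P m) s)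

/-- The word that starts in direction `d`, and runs along six sides of lengths `s 0, …, s 5`,
changing direction by `turn` after every side. -/
def hexWord (turn : Letter → Letter) (d : Letter) (s : Fin 6 → ℕ) : Word :=
  (List.finRange 6).flatMap fun i => List.replicate (s i) (turn^[(i : ℕ)] d)

/-- The boundary of an almost regular hexagon, read from one of its corners in one of the two
directions: the circuit closes up in `ℤ²`, and no two sides differ in length by more than `2`. -/
def IsAlmostRegularHexagon (H : Word) : Prop :=
  ∃ (turn : Letter → Letter) (d : Letter) (s : Fin 6 → ℕ),
    (turn = Letter.next ∨ turn = Letter.prev) ∧ (∀ i j, s i ≤ s j + 2) ∧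
      H = hexWord turn d s ∧ p (eval H) = 1

/-- The projection of `w` is (up to translation) a subpath of an almost regular hexagon, going
round at most once. -/
def IsHexagonSubpath (w : Word) : Prop :=
  ∃ H : Word, IsAlmostRegularHexagon H ∧ w <:+: H ++ H ∧ w.length ≤ H.length

/-- `w` is a geodesic, running along an almost regular hexagon, for an extremal element over `P`
of the ball of radius `m`. -/
def IsExtremalPath (P : Plane) (m : ℕ) (w : Word) : Prop :=
  IsGeodesic w ∧ IsExtremal P m (eval w) ∧ IsHexagonSubpath w

/-- A path in a parallelogram with sides in two neighbouring axial directions `a`, `b` that stays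
along the `a`-side through the starting corner as long as possible: it follows that side, crosses
in direction `b` to the opposite side (with at most one unit step sideways, which adjusts the
enclosed area), and follows the opposite side to the end. For given directions `a`, `b`, each
element represented by a word in `a`, `b` has exactly one such word, and no other word in `a`, `b`
for it has a longer initial power of `a`. -/
def IsParallelogramPath (w : Word) : Prop :=
  ∃ (a b : Letter) (i j e k l : ℕ), (b = a.next ∨ b = a.prev) ∧ e ≤ 1 ∧
    w = List.replicate i a ++ List.replicate j b ++ List.replicate e a ++
      List.replicate k b ++ List.replicate l a

/-- A path over `P` that first follows the almost regular hexagon of an extremal element of the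
ball of radius `m`, then crosses by a single edge to the almost regular hexagon of an extremal
element of the ball of radius `m + 1`, and follows that one to its end. -/
def IsHexagonPath (P : Plane) (m : ℕ) (w : Word) : Prop :=
  ∃ α β u v : Word, ∃ c : Letter, IsExtremalPath P m α ∧ IsExtremalPath P (m + 1) β ∧
    u <+: α ∧ v <:+ β ∧ w = u ++ c :: v

/-- Standard geodesics: for an element as short as its projection to `ℤ²`, a parallelogram path;
for any other element, a path along two successive extremal hexagons. -/
def IsStandardGeodesic (w : Word) (g : N) : Prop :=
  eval w = g ∧ IsGeodesic w ∧
    ((len g = planeLen (p g) ∧ IsParallelogramPath w) ∨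
      ∃ m : ℕ, len g = m + 1 ∧ planeLen (p g) ≤ m ∧ IsHexagonPath (p g) m w)

/-- `g` and `h` have standard geodesics whose projections lie in `25`-neighbourhoods of each other
and `50`-fellow travel. -/
def HaveFellowTravellingGeodesics (g h : N) : Prop :=
  ∃ w w' : Word, IsStandardGeodesic w g ∧ IsStandardGeodesic w' h ∧
    InNeighbourhood 25 w w' ∧ InNeighbourhood 25 w' w ∧ FellowTravel 50 w w'

/-! ### Axes -/

/-- The three axes of the plane: the lines through the origin in the directions `x`, `y`, `t`. -/
inductive Axis
  | x
  | y
  | t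

/-- A linear form that vanishes on the axis; its sign distinguishes the two sides. -/
def Axis.form : Axis → Plane → ℤ
  | .x, P => sndCoord P
  | .y, P => fstCoord P
  | .t, P => fstCoord P - sndCoord P

/-- The projection of the path based at `g` with label `r` crosses the axis `A`, that is, has
vertices strictly on both sides of it. -/
def Crosses (g : N) (r : Word) (A : Axis) : Prop :=
  ∃ i j : ℕ, A.form (p (g * eval (r.take i))) < 0 ∧ 0 < A.form (p (g * eval (r.take j)))

end NilHex

namespace NilHex

open scoped commutatorElement

/-! ### The Heisenberg group -/

/-! In Heisenberg coordinates the exponent of the central element of a word is an area, so lengths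
in `N` are governed by an isoperimetric problem in the triangular tessellation. A `Frame` (an axial
direction with a sense of rotation) allows every argument to be made in the sector `a, b ≥ 0`, where
elements are written `f.pt a b s`. Those with `-(a * b) ≤ s ≤ 0` are exactly the ones as short as
their projection (`len_pt_eq_iff`), and exchanging the two directions (`Frame.flip`) turns `s < -(a
* b)` into `s > 0`. So the main case is `s > 0`.

For `s > 0`, sorting the letters of a word by direction does not lower its area
(`exists_hexArea_ge`), so only hexagonal paths compete; these are described by four offsets, and the
area is a concave quadratic function of them for a given total. `IsOptimal` is a discrete
first-order condition with complementary slackness: the path runs along a hexagon with almost equal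
sides. It implies maximality (`IsOptimal.area_le_of_sum_eq`), and pushing the side of largest gain
outwards leads from an optimal path to one that is longer by one (`IsOptimal.exists_push`). Between
two such consecutive paths, the words that leave the first one by a single letter and finish along
the second realise all intermediate areas (`Quad.exists_interpolation`). This computes the lengths
and yields the standard geodesics.

For neighbouring elements of equal length over one sector, strong concavity bounds the difference of
the optimal offsets (`IsOptimal.sub_bounds`), so the hexagons are close. The remaining positions of
`s` relative to `[-(a * b), 0]` are settled by hand: parallelogram paths are compared through their
division data, and mixed cases force thin parallelograms or short final sides
(`stdClose_of_sector`).

If the path of length two between the elements crosses an axis, its middle vertex `h` lies on it.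
Comparing `ℓ(h)` with the common length shows that either `h` or its successor along the axis has
that length (`exists_on_axis`); it lies in the closed sectors on both sides, so the sector case
applies twice. If no axis separates the end points, they lie in one sector. -/

/-- The triple `(a, b, s)` stands for `x ^ a * y ^ b * z ^ s`. -/
@[ext]
structure Heis where
  a : ℤ
  b : ℤ
  s : ℤ

namespace Heis

instance : Mul Heis := ⟨fun g h => ⟨g.a + h.a, g.b + h.b, g.s + h.s - g.b * h.a⟩⟩
instance : One Heis := ⟨⟨0, 0, 0⟩⟩
instance : Inv Heis := ⟨fun g => ⟨-g.a, -g.b, -g.s - g.a * g.b⟩⟩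

@[simp] theorem mul_a (g h : Heis) : (g * h).a = g.a + h.a := rfl
@[simp] theorem mul_b (g h : Heis) : (g * h).b = g.b + h.b := rfl
@[simp] theorem mul_s (g h : Heis) : (g * h).s = g.s + h.s - g.b * h.a := rfl
@[simp] theorem one_a : (1 : Heis).a = 0 := rfl
@[simp] theorem one_b : (1 : Heis).b = 0 := rfl
@[simp] theorem one_s : (1 : Heis).s = 0 := rfl
@[simp] theorem inv_a (g : Heis) : (g⁻¹).a = -g.a := rfl
@[simp] theorem inv_b (g : Heis) : (g⁻¹).b = -g.b := rfl
@[simp] theorem inv_s (g : Heis) : (g⁻¹).s = -g.s - g.a * g.b := rfl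

instance : Group Heis :=
  Group.ofLeftAxioms (fun g h k => by ext <;> simp <;> ring) (fun g => by ext <;> simp)
    (fun g => by ext <;> simp; ring)

end Heis

def genHeis : Gen → Heis
  | .x => ⟨1, 0, 0⟩
  | .y => ⟨0, 1, 0⟩

theorem genHeis_rels : ∀ r ∈ rels, FreeGroup.lift genHeis r = 1 := by
  intro r hr
  rcases hr with rfl | rfl <;>
    · simp only [commutatorElement_def]
      ext <;> simp [genHeis]

def toHeis : N →* Heis := PresentedGroup.toGroup genHeis_rels

@[simp] theorem toHeis_x : toHeis x = ⟨1, 0, 0⟩ := PresentedGroup.toGroup.of genHeis_rels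
@[simp] theorem toHeis_y : toHeis y = ⟨0, 1, 0⟩ := PresentedGroup.toGroup.of genHeis_rels
@[simp] theorem toHeis_z : toHeis z = ⟨0, 0, 1⟩ := by
  simp only [z, commutatorElement_def]
  ext <;> simp

theorem z_commute (g : N) : Commute z g := by
  have key : ∀ l : Gen, Commute z (PresentedGroup.of l : N) := by
    intro l
    rw [← commutatorElement_eq_one_iff_commute]
    have h1 : (⁅⁅FreeGroup.of Gen.x, FreeGroup.of Gen.y⁆, FreeGroup.of l⁆ : FreeGroup Gen)
        ∈ rels := by
      cases l
      · exact Or.inl rfl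
      · exact Or.inr rfl
    have h2 := PresentedGroup.one_of_mem h1
    simp only [map_commutatorElement] at h2
    exact h2
  have : g ∈ Subgroup.centralizer {z} := by
    have h : Subgroup.closure (Set.range (PresentedGroup.of : Gen → N)) ≤
        Subgroup.centralizer {z} := by
      rw [Subgroup.closure_le]
      rintro _ ⟨l, rfl⟩
      rw [SetLike.mem_coe, Subgroup.mem_centralizer_singleton_iff]
      exact (key l).eq.symm
    rw [PresentedGroup.closure_range_of] at h
    exact h trivial
  rw [Subgroup.mem_centralizer_singleton_iff] at this
  exact this.symm

/-- Multiplication of normal forms in a group of nilpotency class two. -/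
theorem normalForm_mul {G : Type*} [Group G] {U V Z : G} (hZU : Commute Z U) (hZV : Commute Z V)
    (hUV : U * V = V * U * Z) (a b s a' b' s' : ℤ) :
    U ^ a * V ^ b * Z ^ s * (U ^ a' * V ^ b' * Z ^ s') =
      U ^ (a + a') * V ^ (b + b') * Z ^ (s + s' - b * a') := by
  have h1 : V * U * V⁻¹ = U * Z⁻¹ := by
    rw [mul_inv_eq_iff_eq_mul, mul_assoc, (hZV.inv_left).eq, ← mul_assoc, hUV]; group
  have h2 : (U ^ a')⁻¹ * V * U ^ a' = V * Z ^ (-a') := by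
    have : V * U ^ a' * V⁻¹ = U ^ a' * Z ^ (-a') := by
      rw [← conj_zpow, h1, (hZU.symm.inv_right).mul_zpow, inv_zpow, zpow_neg]
    rw [mul_inv_eq_iff_eq_mul] at this
    rw [mul_assoc, this, mul_assoc, inv_mul_cancel_left]
    exact (hZV.zpow_left _).eq
  have h3 : V ^ b * U ^ a' = U ^ a' * V ^ b * Z ^ (-(b * a')) := by
    have h4 : (U ^ a')⁻¹ * V ^ b * U ^ a' = V ^ b * Z ^ (-(b * a')) := by
      have := conj_zpow (i := b) (a := (U ^ a')⁻¹) (b := V)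
      rw [inv_inv, h2, (hZV.symm.zpow_right _).mul_zpow, ← zpow_mul] at this
      rw [← this]; congr 2; ring
    rw [mul_assoc (U ^ a'), ← h4]; group
  have cU : ∀ i j : ℤ, Z ^ i * U ^ j = U ^ j * Z ^ i := fun i j => ((hZU.zpow_left i).zpow_right j).eq
  have cV : ∀ i j : ℤ, Z ^ i * V ^ j = V ^ j * Z ^ i := fun i j => ((hZV.zpow_left i).zpow_right j).eq
  calc U ^ a * V ^ b * Z ^ s * (U ^ a' * V ^ b' * Z ^ s')
      = U ^ a * V ^ b * (Z ^ s * U ^ a') * V ^ b' * Z ^ s' := by group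
    _ = U ^ a * (V ^ b * U ^ a') * (Z ^ s * V ^ b') * Z ^ s' := by rw [cU]; group
    _ = U ^ a * U ^ a' * V ^ b * (Z ^ (-(b * a')) * V ^ b') * Z ^ s * Z ^ s' := by
        rw [h3, cV]; group
    _ = U ^ (a + a') * V ^ (b + b') * Z ^ (s + s' - b * a') := by
        rw [cV]
        simp only [zpow_add, sub_eq_add_neg, mul_assoc]
        congr 4
        rw [← zpow_add, ← zpow_add, ← zpow_add, ← zpow_add]
        congr 1; ring

theorem x_mul_y : x * y = y * x * z := by
  rw [← (z_commute (y * x)).eq, z, commutatorElement_def]; group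

theorem exists_normalForm (g : N) : ∃ a b s : ℤ, g = x ^ a * y ^ b * z ^ s := by
  have hmul := normalForm_mul (z_commute x) (z_commute y) x_mul_y
  let H : Subgroup N :=
    { carrier := {g | ∃ a b s : ℤ, g = x ^ a * y ^ b * z ^ s}
      one_mem' := ⟨0, 0, 0, by simp⟩
      mul_mem' := by
        rintro _ _ ⟨a, b, s, rfl⟩ ⟨a', b', s', rfl⟩
        exact ⟨_, _, _, hmul _ _ _ _ _ _⟩
      inv_mem' := by
        rintro _ ⟨a, b, s, rfl⟩
        refine ⟨-a, -b, -s - a * b, ?_⟩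
        rw [inv_eq_iff_mul_eq_one, hmul]
        ring_nf; simp }
  have h := PresentedGroup.generated_by rels H (fun l => by
    cases l
    · exact ⟨1, 0, 0, by simp [x]⟩
    · exact ⟨0, 1, 0, by simp [y]⟩) g
  exact h

theorem Heis.zpow_fst (i : ℤ) : (⟨1, 0, 0⟩ : Heis) ^ i = ⟨i, 0, 0⟩ := by
  induction i with
  | zero => rfl
  | succ i ih => rw [zpow_add_one, ih]; ext <;> simp
  | pred i ih => rw [zpow_sub_one, ih]; ext <;> simp; ring

theorem Heis.zpow_snd (i : ℤ) : (⟨0, 1, 0⟩ : Heis) ^ i = ⟨0, i, 0⟩ := by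
  induction i with
  | zero => rfl
  | succ i ih => rw [zpow_add_one, ih]; ext <;> simp
  | pred i ih => rw [zpow_sub_one, ih]; ext <;> simp; ring

theorem Heis.zpow_center (i : ℤ) : (⟨0, 0, 1⟩ : Heis) ^ i = ⟨0, 0, i⟩ := by
  induction i with
  | zero => rfl
  | succ i ih => rw [zpow_add_one, ih]; ext <;> simp
  | pred i ih => rw [zpow_sub_one, ih]; ext <;> simp; ring

theorem toHeis_normalForm (a b s : ℤ) : toHeis (x ^ a * y ^ b * z ^ s) = ⟨a, b, s⟩ := by
  simp only [map_mul, map_zpow, toHeis_x, toHeis_y, toHeis_z, Heis.zpow_fst, Heis.zpow_snd,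
    Heis.zpow_center]
  ext <;> simp

/-- Normal forms exhaust `N` and their exponents are visible in `Heis`. Hence identities in `N` can
be checked on integer triples. -/
theorem toHeis_injective : Function.Injective toHeis := by
  intro g h hgh
  obtain ⟨a, b, s, rfl⟩ := exists_normalForm g
  obtain ⟨a', b', s', rfl⟩ := exists_normalForm h
  simp only [toHeis_normalForm, Heis.mk.injEq] at hgh
  obtain ⟨rfl, rfl, rfl⟩ := hgh
  rfl

@[simp] theorem p_x : p x = Multiplicative.ofAdd (1, 0) := PresentedGroup.toGroup.of genPlane_rels
@[simp] theorem p_y : p y = Multiplicative.ofAdd (0, 1) := PresentedGroup.toGroup.of genPlane_rels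

theorem p_z : p z = 1 := by
  rw [z, map_commutatorElement, commutatorElement_eq_one_iff_mul_comm, mul_comm]

theorem p_eq (g : N) : p g = Multiplicative.ofAdd ((toHeis g).a, (toHeis g).b) := by
  obtain ⟨a, b, s, rfl⟩ := exists_normalForm g
  rw [toHeis_normalForm]
  simp only [map_mul, map_zpow, p_z, p_x, p_y, one_zpow, mul_one]
  rw [← ofAdd_zsmul, ← ofAdd_zsmul, ← ofAdd_add]
  simp

/-! ### Frames -/

/-- A frame: an axial direction and a sense of rotation. -/
structure Frame where
  u : Letter
  pos : Bool

namespace Frame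

def turn (f : Frame) : Letter → Letter := match f.pos with
  | true => Letter.next
  | false => Letter.prev

/-- The axial directions, counted from `f.u` in the sense of rotation of the frame. -/
def letter (f : Frame) (i : Fin 6) : Letter := f.turn^[(i : ℕ)] f.u

def U (f : Frame) : N := (f.letter 0).val
def V (f : Frame) : N := (f.letter 1).val

/-- The commutator of the first two directions of the frame. -/
def Z (f : Frame) : N := match f.pos with
  | true => z
  | false => z⁻¹

/-- Whether the third direction is `U⁻¹ V` or `V U⁻¹`. -/
def eps (f : Frame) : ℤ := match f.pos, f.u with
  | true, .x => 0
  | true, .y => 0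
  | true, .ti => 0
  | true, _ => 1
  | false, .x => 1
  | false, .y => 1
  | false, .ti => 1
  | false, _ => 0

theorem eps_cases (f : Frame) : f.eps = 0 ∨ f.eps = 1 := by
  rcases f with ⟨u, pos⟩
  cases u <;> cases pos <;> simp [eps]

/-- Normal form with respect to a frame. -/
def pt (f : Frame) (a b s : ℤ) : N := f.U ^ a * f.V ^ b * f.Z ^ s

end Frame

/-! ### Words in the six directions of a frame: end point and area -/

def dU : Fin 6 → ℤ
  | 0 => 1 | 1 => 0 | 2 => -1 | 3 => -1 | 4 => 0 | 5 => 1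

def dV : Fin 6 → ℤ
  | 0 => 0 | 1 => 1 | 2 => 1 | 3 => 0 | 4 => -1 | 5 => -1

def dS (ε : ℤ) : Fin 6 → ℤ
  | 0 => 0 | 1 => 0 | 2 => ε | 3 => 0 | 4 => 0 | 5 => 1 - ε

def posU (W : List (Fin 6)) : ℤ := (W.map dU).sum
def posV (W : List (Fin 6)) : ℤ := (W.map dV).sum

/-- The exponent of the central element of a word in the directions of a frame. -/
def area (ε : ℤ) : List (Fin 6) → ℤ
  | [] => 0
  | i :: W => dS ε i + area ε W - dV i * posU W

@[simp] theorem posU_nil : posU [] = 0 := rfl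
@[simp] theorem posV_nil : posV [] = 0 := rfl
@[simp] theorem area_nil (ε : ℤ) : area ε [] = 0 := rfl
@[simp] theorem posU_cons (i : Fin 6) (W : List (Fin 6)) : posU (i :: W) = dU i + posU W := by
  simp [posU]
@[simp] theorem posV_cons (i : Fin 6) (W : List (Fin 6)) : posV (i :: W) = dV i + posV W := by
  simp [posV]
@[simp] theorem area_cons (ε : ℤ) (i : Fin 6) (W : List (Fin 6)) :
    area ε (i :: W) = dS ε i + area ε W - dV i * posU W := rfl
@[simp] theorem posU_append (W W' : List (Fin 6)) : posU (W ++ W') = posU W + posU W' := by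
  simp [posU]
@[simp] theorem posV_append (W W' : List (Fin 6)) : posV (W ++ W') = posV W + posV W' := by
  simp [posV]
@[simp] theorem area_append (ε : ℤ) (W W' : List (Fin 6)) :
    area ε (W ++ W') = area ε W + area ε W' - posV W * posU W' := by
  induction W with
  | nil => simp
  | cons i W ih => simp only [List.cons_append, area_cons, ih, posU_append, posV_cons]; ring

namespace Frame

variable (f : Frame)

theorem Z_commute (g : N) : Commute f.Z g := by
  unfold Z
  split
  · exact z_commute g
  · exact (z_commute g).inv_left

/-- All twelve frames look alike in their own normal form, up to the bit `eps`. This is what reduces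
the later arguments to a single sector. -/
theorem val_letter (i : Fin 6) : (f.letter i).val = f.pt (dU i) (dV i) (dS f.eps i) := by
  apply toHeis_injective
  rcases f with ⟨u, pos⟩
  cases pos <;> cases u <;> fin_cases i <;>
    simp [letter, pt, U, V, Z, turn, eps, dU, dV, dS, Letter.val, Letter.next, Letter.prev] <;>
    ext <;> simp

theorem U_mul_V : f.U * f.V = f.V * f.U * f.Z := by
  apply toHeis_injective
  rcases f with ⟨u, pos⟩
  cases pos <;> cases u <;>
    simp [letter, U, V, Z, turn, Letter.val, Letter.next, Letter.prev] <;>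
    ext <;> simp

theorem pt_mul (a b s a' b' s' : ℤ) :
    f.pt a b s * f.pt a' b' s' = f.pt (a + a') (b + b') (s + s' - b * a') :=
  normalForm_mul (f.Z_commute _) (f.Z_commute _) f.U_mul_V _ _ _ _ _ _

theorem pt_zero : f.pt 0 0 0 = 1 := by simp [pt]

theorem eval_map (W : List (Fin 6)) :
    eval (W.map f.letter) = f.pt (posU W) (posV W) (area f.eps W) := by
  induction W with
  | nil => simp [eval, pt_zero]
  | cons i W ih =>
    have : eval ((i :: W).map f.letter) = (f.letter i).val * eval (W.map f.letter) := by
      simp [eval]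
    rw [this, ih, val_letter, pt_mul]
    simp only [posU_cons, posV_cons, area_cons]

end Frame

/-! ### The rearrangement inequality -/

/-- Twice the area of the path with sides `n₁, n₂ - n₁, c₁ - n₂ + n₁ + n₃, c₂ + n₂ - n₃ + n₄,
n₃ - n₄, n₄` in the directions `4, 5, 0, 1, 2, 3`, which ends in `(c₁, c₂)`. -/
def hexArea (ε c₁ c₂ n₁ n₂ n₃ n₄ : ℤ) : ℤ :=
  2 * (c₁ * n₂ + c₂ * n₃ + n₁ * n₂ + n₂ * n₃ + n₃ * n₄) - (n₁ ^ 2 + n₂ ^ 2 + n₃ ^ 2 + n₄ ^ 2)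
    + (2 * ε - 1) * (n₁ + n₃) + (1 - 2 * ε) * (n₂ + n₄)

/-- The closed sector of the plane between the directions `i` and `i + 1`. -/
def InSector (i : Fin 6) (a b : ℤ) : Prop := match i with
  | 0 => 0 ≤ a ∧ 0 ≤ b
  | 1 => 0 ≤ a + b ∧ a ≤ 0
  | 2 => 0 ≤ b ∧ a + b ≤ 0
  | 3 => a ≤ 0 ∧ b ≤ 0
  | 4 => a + b ≤ 0 ∧ 0 ≤ a
  | 5 => b ≤ 0 ∧ 0 ≤ a + b

/-- Twice the area of the word with `kᵢ` letters of each direction `i`, sorted by direction,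
starting with the direction `i + 4`. -/
def sortedArea (ε : ℤ) (i : Fin 6) (k₀ k₁ k₂ k₃ k₄ k₅ : ℤ) : ℤ :=
  let a := k₀ + k₅ - k₂ - k₃
  let b := k₁ + k₂ - k₄ - k₅
  let A := hexArea ε a b k₄ (k₄ + k₅) (k₂ + k₃) k₃
  match i with
  | 0 => A
  | 1 => A - 2 * k₄ * a
  | 2 => A - 2 * k₄ * a - 2 * k₅ * (a + b)
  | 3 => A - 2 * k₄ * a - 2 * k₅ * (a + b) - 2 * k₀ * b
  | 4 => A - 2 * k₄ * a - 2 * k₅ * (a + b) - 2 * k₀ * b + 2 * k₁ * a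
  | 5 => A - 2 * k₄ * a - 2 * k₅ * (a + b) - 2 * k₀ * b + 2 * k₁ * a + 2 * k₂ * (a + b)

/-- Passing from one sorted word to the next moves all letters of one direction from the front to
the end. This changes the area by their number times a linear form of the end point, and the sector
of the end point determines the signs of these forms. -/
theorem sortedArea_le (ε : ℤ) (i j : Fin 6) {k₀ k₁ k₂ k₃ k₄ k₅ : ℤ} (h₀ : 0 ≤ k₀) (h₁ : 0 ≤ k₁)
    (h₂ : 0 ≤ k₂) (h₃ : 0 ≤ k₃) (h₄ : 0 ≤ k₄) (h₅ : 0 ≤ k₅)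
    (hi : InSector i (k₀ + k₅ - k₂ - k₃) (k₁ + k₂ - k₄ - k₅)) :
    sortedArea ε j k₀ k₁ k₂ k₃ k₄ k₅ ≤ sortedArea ε i k₀ k₁ k₂ k₃ k₄ k₅ := by
  have key : ∀ σ τ ρ : ℤ, 0 ≤ σ * (k₀ + k₅ - k₂ - k₃) → 0 ≤ τ * (k₁ + k₂ - k₄ - k₅) →
      0 ≤ ρ * ((k₀ + k₅ - k₂ - k₃) + (k₁ + k₂ - k₄ - k₅)) →
      0 ≤ k₄ * (σ * (k₀ + k₅ - k₂ - k₃)) ∧ 0 ≤ k₁ * (σ * (k₀ + k₅ - k₂ - k₃)) ∧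
      0 ≤ k₀ * (τ * (k₁ + k₂ - k₄ - k₅)) ∧ 0 ≤ k₃ * (τ * (k₁ + k₂ - k₄ - k₅)) ∧
      0 ≤ k₅ * (ρ * ((k₀ + k₅ - k₂ - k₃) + (k₁ + k₂ - k₄ - k₅))) ∧
      0 ≤ k₂ * (ρ * ((k₀ + k₅ - k₂ - k₃) + (k₁ + k₂ - k₄ - k₅))) := by
    intro σ τ ρ hσ hτ hρ
    refine ⟨?_, ?_, ?_, ?_, ?_, ?_⟩ <;> apply mul_nonneg <;> assumption
  have hs : ∃ σ τ ρ : ℤ, (σ, τ, ρ) = (match i with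
      | 0 => (1, 1, 1) | 1 => (-1, 1, 1) | 2 => (-1, 1, -1) | 3 => (-1, -1, -1)
      | 4 => (1, -1, -1) | 5 => (1, -1, 1) : ℤ × ℤ × ℤ) := ⟨_, _, _, rfl⟩
  obtain ⟨σ, τ, ρ, hs⟩ := hs
  have h := key σ τ ρ
  clear key
  fin_cases i <;> simp only [InSector, Prod.mk.injEq] at hi hs <;>
    obtain ⟨rfl, rfl, rfl⟩ := hs <;>
    obtain ⟨e1, e2, e3, e4, e5, e6⟩ := h (by omega) (by omega) (by omega) <;>
    fin_cases j <;> simp only [sortedArea] <;> linarith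

/-- The number of letters in direction `i`. -/
def cnt (W : List (Fin 6)) (i : Fin 6) : ℤ := W.count i

theorem cnt_nonneg (W : List (Fin 6)) (i : Fin 6) : 0 ≤ cnt W i := Int.natCast_nonneg _

theorem cnt_concat (W : List (Fin 6)) (l i : Fin 6) :
    cnt (W ++ [l]) i = cnt W i + if l = i then 1 else 0 := by
  simp only [cnt, List.count_append, List.count_singleton, beq_iff_eq]
  split <;> simp

theorem posU_eq_cnt (W : List (Fin 6)) : posU W = cnt W 0 + cnt W 5 - cnt W 2 - cnt W 3 := by
  induction W using List.reverseRecOn with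
  | nil => simp [cnt]
  | append_singleton W l ih =>
    simp only [posU_append, ih, cnt_concat]
    fin_cases l <;> simp [dU] <;> ring

theorem posV_eq_cnt (W : List (Fin 6)) : posV W = cnt W 1 + cnt W 2 - cnt W 4 - cnt W 5 := by
  induction W using List.reverseRecOn with
  | nil => simp [cnt]
  | append_singleton W l ih =>
    simp only [posV_append, ih, cnt_concat]
    fin_cases l <;> simp [dV] <;> ring

theorem length_eq_cnt (W : List (Fin 6)) :
    (W.length : ℤ) = cnt W 0 + cnt W 1 + cnt W 2 + cnt W 3 + cnt W 4 + cnt W 5 := by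
  induction W using List.reverseRecOn with
  | nil => simp [cnt]
  | append_singleton W l ih =>
    simp only [List.length_append, Nat.cast_add, ih, cnt_concat]
    fin_cases l <;> simp <;> ring

theorem exists_inSector (a b : ℤ) : ∃ i, InSector i a b := by
  have : InSector 0 a b ∨ InSector 1 a b ∨ InSector 2 a b ∨ InSector 3 a b ∨ InSector 4 a b ∨
      InSector 5 a b := by
    simp only [InSector]; omega
  rcases this with h | h | h | h | h | h <;> exact ⟨_, h⟩

/-- Induction on the last letter: sort for the sector of the old end point, where moving the new
letter to its place in the sorted word loses no area, and then change to the sector of the new end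
point by `sortedArea_le`. -/
theorem area_le_sortedArea {ε : ℤ} (W : List (Fin 6)) (i : Fin 6)
    (hi : InSector i (posU W) (posV W)) :
    2 * area ε W ≤
      sortedArea ε i (cnt W 0) (cnt W 1) (cnt W 2) (cnt W 3) (cnt W 4) (cnt W 5) := by
  induction W using List.reverseRecOn generalizing i with
  | nil =>
    fin_cases i <;> simp [sortedArea, cnt, hexArea]
  | append_singleton W l ih =>
    have c := cnt_nonneg W
    have h0 := c 0; have h1 := c 1; have h2 := c 2; have h3 := c 3; have h4 := c 4; have h5 := c 5
    obtain ⟨j, hj⟩ := exists_inSector (posU W) (posV W)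
    refine le_trans ?_ (sortedArea_le ε i j (cnt_nonneg _ _) (cnt_nonneg _ _) (cnt_nonneg _ _)
      (cnt_nonneg _ _) (cnt_nonneg _ _) (cnt_nonneg _ _)
      (by rw [← posU_eq_cnt, ← posV_eq_cnt]; exact hi))
    have hW := ih j hj
    rw [posU_eq_cnt, posV_eq_cnt] at hj
    simp only [area_append, cnt_concat, area_cons, area_nil, posU_cons, posU_nil, posV_eq_cnt]
    generalize cnt W 0 = k0 at *
    generalize cnt W 1 = k1 at *
    generalize cnt W 2 = k2 at *
    generalize cnt W 3 = k3 at *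
    generalize cnt W 4 = k4 at *
    generalize cnt W 5 = k5 at *
    fin_cases j <;> simp only [InSector] at hj <;>
      fin_cases l <;>
      simp only [sortedArea, hexArea, dU, dS, dV, Fin.zero_eta, Fin.mk_one, Fin.reduceFinMk, Fin.reduceEq,
        if_true, if_false, Fin.isValue] at hW ⊢ <;>
      linarith

/-- Rearranging a word that ends in the sector `a, b ≥ 0` along the sides of a hexagon does not
decrease its area. -/
theorem exists_hexArea_ge {ε : ℤ} (W : List (Fin 6)) (ha : 0 ≤ posU W) (hb : 0 ≤ posV W) :
    ∃ n₁ n₂ n₃ n₄ : ℤ, 0 ≤ n₁ ∧ 0 ≤ n₂ ∧ 0 ≤ n₃ ∧ 0 ≤ n₄ ∧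
      n₁ + n₂ + n₃ + n₄ = W.length - posU W - posV W ∧
      2 * area ε W ≤ hexArea ε (posU W) (posV W) n₁ n₂ n₃ n₄ := by
  have c := cnt_nonneg W
  have h2 := c 2; have h3 := c 3; have h4 := c 4; have h5 := c 5
  refine ⟨cnt W 4, cnt W 4 + cnt W 5, cnt W 2 + cnt W 3, cnt W 3, h4, by omega, by omega, h3, ?_, ?_⟩
  · rw [length_eq_cnt, posU_eq_cnt, posV_eq_cnt]; ring
  · have := area_le_sortedArea (ε := ε) W 0 ⟨ha, hb⟩
    rw [posU_eq_cnt, posV_eq_cnt]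
    exact this

/-! ### Optimal hexagonal paths -/

@[ext]
structure Quad where
  e₁ : ℤ
  e₂ : ℤ
  e₃ : ℤ
  e₄ : ℤ

namespace Quad

/-- Raising an offset moves the side of direction `5`, `0`, `1` or `2` outwards by one, at the cost
of one more letter. -/
def push (n : Quad) : Fin 4 → Quad
  | 0 => ⟨n.e₁ + 1, n.e₂, n.e₃, n.e₄⟩
  | 1 => ⟨n.e₁, n.e₂ + 1, n.e₃, n.e₄⟩
  | 2 => ⟨n.e₁, n.e₂, n.e₃ + 1, n.e₄⟩
  | 3 => ⟨n.e₁, n.e₂, n.e₃, n.e₄ + 1⟩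

/-- The excess of the length of the path over `c₁ + c₂`. -/
def sum (n : Quad) : ℤ := n.e₁ + n.e₂ + n.e₃ + n.e₄

structure Nonneg (n : Quad) : Prop where
  h₁ : 0 ≤ n.e₁
  h₂ : 0 ≤ n.e₂
  h₃ : 0 ≤ n.e₃
  h₄ : 0 ≤ n.e₄

/-- Twice the area of the hexagonal path with offsets `n` that ends in `(c₁, c₂)`. -/
def area (ε c₁ c₂ : ℤ) (n : Quad) : ℤ := hexArea ε c₁ c₂ n.e₁ n.e₂ n.e₃ n.e₄

/-- The lengths of the sides of this path in the directions `5, 0, 1, 2`. -/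
def sides (c₁ c₂ : ℤ) (n : Quad) : Quad :=
  ⟨n.e₂ - n.e₁, c₁ - n.e₂ + n.e₁ + n.e₃, c₂ + n.e₂ - n.e₃ + n.e₄, n.e₃ - n.e₄⟩

/-- The growth of the area if a side is moved outwards. -/
def gain (ε : ℤ) (t : Quad) : Fin 4 → ℤ
  | 0 => t.e₁ - (1 - ε)
  | 1 => t.e₂ - ε
  | 2 => t.e₃ - (1 - ε)
  | 3 => t.e₄ - ε

theorem area_push (ε c₁ c₂ : ℤ) (n : Quad) (j : Fin 4) :
    (n.push j).area ε c₁ c₂ = n.area ε c₁ c₂ + 2 * (n.sides c₁ c₂).gain ε j := by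
  fin_cases j <;> simp only [push, area, sides, gain, hexArea] <;> ring

theorem sum_push (n : Quad) (j : Fin 4) : (n.push j).sum = n.sum + 1 := by
  fin_cases j <;> simp only [push, sum] <;> ring

/-- The side lengths of optimal hexagons that the greedy choice of sides runs through. -/
def Balanced (ε : ℤ) (t : Quad) : Prop :=
  -1 ≤ t.e₁ - t.e₃ ∧ t.e₁ - t.e₃ ≤ 1 ∧ -1 ≤ t.e₂ - t.e₄ ∧ t.e₂ - t.e₄ ≤ 1 ∧
  -1 ≤ t.e₁ - t.e₃ + (t.e₂ - t.e₄) ∧ t.e₁ - t.e₃ + (t.e₂ - t.e₄) ≤ 1 ∧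
  ((ε = 0 ∧ 0 ≤ t.e₁ - t.e₄ ∧ t.e₁ - t.e₄ ≤ 2 ∧
      (t.e₁ - t.e₄ = 2 → t.e₁ = t.e₃ ∧ t.e₂ = t.e₄) ∧ (t.e₁ - t.e₄ = 0 → t.e₃ ≤ t.e₁)) ∨
    (ε = 1 ∧ -2 ≤ t.e₁ - t.e₄ ∧ t.e₁ - t.e₄ ≤ 0 ∧
      (t.e₁ - t.e₄ = -2 → t.e₁ = t.e₃ ∧ t.e₂ = t.e₄) ∧ (t.e₁ - t.e₄ = 0 → t.e₂ ≤ t.e₄)))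

/-- Shortens a side of the surrounding hexagon without changing the path. -/
def lower (t : Quad) : Fin 4 → Quad
  | 0 => ⟨t.e₁ - 1, t.e₂, t.e₃, t.e₄⟩
  | 1 => ⟨t.e₁, t.e₂ - 1, t.e₃, t.e₄⟩
  | 2 => ⟨t.e₁, t.e₂, t.e₃ - 1, t.e₄⟩
  | 3 => ⟨t.e₁, t.e₂, t.e₃, t.e₄ - 1⟩

/-- The effect on the side lengths of moving a side outwards. -/
def cut (t : Quad) : Fin 4 → Quad
  | 0 => ⟨t.e₁ - 1, t.e₂ + 1, t.e₃, t.e₄⟩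
  | 1 => ⟨t.e₁ + 1, t.e₂ - 1, t.e₃ + 1, t.e₄⟩
  | 2 => ⟨t.e₁, t.e₂ + 1, t.e₃ - 1, t.e₄ + 1⟩
  | 3 => ⟨t.e₁, t.e₂, t.e₃ + 1, t.e₄ - 1⟩

theorem sides_push (c₁ c₂ : ℤ) (n : Quad) (j : Fin 4) :
    (n.push j).sides c₁ c₂ = (n.sides c₁ c₂).cut j := by
  fin_cases j <;> simp only [push, sides, cut, Quad.mk.injEq] <;>
    refine ⟨?_, ?_, ?_, ?_⟩ <;> first | trivial | ring

/-- For fixed `ε`, both `Balanced` and the comparison of gains depend only on the differences of the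
sides, which take finitely many values. In each case one side of largest gain admits both moves, so
it can be used whether or not the path has filled it. -/
theorem Balanced.exists_cut {ε : ℤ} {t : Quad} (h : t.Balanced ε) :
    ∃ j, (t.cut j).Balanced ε ∧ (t.lower j).Balanced ε ∧ ∀ i, t.gain ε i ≤ t.gain ε j := by
  have key : ∀ j : Fin 4, ((t.cut j).Balanced ε ∧ (t.lower j).Balanced ε ∧
      t.gain ε 0 ≤ t.gain ε j ∧ t.gain ε 1 ≤ t.gain ε j ∧ t.gain ε 2 ≤ t.gain ε j ∧
      t.gain ε 3 ≤ t.gain ε j) → ∃ j, (t.cut j).Balanced ε ∧ (t.lower j).Balanced ε ∧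
      ∀ i, t.gain ε i ≤ t.gain ε j := by
    rintro j ⟨h1, h2, h3, h4, h5, h6⟩
    refine ⟨j, h1, h2, ?_⟩
    intro i
    fin_cases i <;> assumption
  rcases t with ⟨t₁, t₂, t₃, t₄⟩
  simp only [Balanced] at h
  obtain ⟨x, hx⟩ : ∃ x, x = t₁ - t₃ := ⟨_, rfl⟩
  obtain ⟨y, hy⟩ : ∃ y, y = t₂ - t₄ := ⟨_, rfl⟩
  obtain ⟨w, hw⟩ : ∃ w, w = t₁ - t₄ := ⟨_, rfl⟩
  have hx' : x = -1 ∨ x = 0 ∨ x = 1 := by omega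
  have hy' : y = -1 ∨ y = 0 ∨ y = 1 := by omega
  obtain ⟨_, _, _, _, _, _, ⟨rfl, h⟩ | ⟨rfl, h⟩⟩ := h
  · have hw' : w = 0 ∨ w = 1 ∨ w = 2 := by omega
    rcases hw' with rfl | rfl | rfl <;> rcases hx' with rfl | rfl | rfl <;>
      rcases hy' with rfl | rfl | rfl <;>
      first
      | omega
      | (apply key 0; simp only [cut, lower, gain, Balanced, true_and, false_and, or_false,
          zero_ne_one]; omega)
      | (apply key 1; simp only [cut, lower, gain, Balanced, true_and, false_and, or_false,
          zero_ne_one]; omega)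
      | (apply key 2; simp only [cut, lower, gain, Balanced, true_and, false_and, or_false,
          zero_ne_one]; omega)
      | (apply key 3; simp only [cut, lower, gain, Balanced, true_and, false_and, or_false,
          zero_ne_one]; omega)
  · have hw' : w = -2 ∨ w = -1 ∨ w = 0 := by omega
    rcases hw' with rfl | rfl | rfl <;> rcases hx' with rfl | rfl | rfl <;>
      rcases hy' with rfl | rfl | rfl <;>
      first
      | omega
      | (apply key 0; simp only [cut, lower, gain, Balanced, true_and, false_and, false_or,
          one_ne_zero]; omega)
      | (apply key 1; simp only [cut, lower, gain, Balanced, true_and, false_and, false_or,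
          one_ne_zero]; omega)
      | (apply key 2; simp only [cut, lower, gain, Balanced, true_and, false_and, false_or,
          one_ne_zero]; omega)
      | (apply key 3; simp only [cut, lower, gain, Balanced, true_and, false_and, false_or,
          one_ne_zero]; omega)

end Quad

/-- The path with offsets `n` to `(c₁, c₂)` runs along a hexagon with side lengths `t` in the
directions `5, 0, 1, 2`; a side is complete if it has been moved outwards. -/
structure IsOptimal (ε c₁ c₂ : ℤ) (n t : Quad) : Prop where
  nonneg : n.Nonneg
  balanced : t.Balanced ε
  le₁ : (n.sides c₁ c₂).e₁ ≤ t.e₁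
  le₂ : (n.sides c₁ c₂).e₂ ≤ t.e₂
  le₃ : (n.sides c₁ c₂).e₃ ≤ t.e₃
  le₄ : (n.sides c₁ c₂).e₄ ≤ t.e₄
  eq₁ : 0 < n.e₁ → (n.sides c₁ c₂).e₁ = t.e₁
  eq₂ : 0 < n.e₂ → (n.sides c₁ c₂).e₂ = t.e₂
  eq₃ : 0 < n.e₃ → (n.sides c₁ c₂).e₃ = t.e₃
  eq₄ : 0 < n.e₄ → (n.sides c₁ c₂).e₄ = t.e₄

namespace IsOptimal

variable {ε c₁ c₂ : ℤ} {n t : Quad}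

theorem eps_cases (h : IsOptimal ε c₁ c₂ n t) : ε = 0 ∨ ε = 1 := by
  obtain ⟨_, _, _, _, _, _, h | h⟩ := h.balanced
  · exact Or.inl h.1
  · exact Or.inr h.1

/-- Take a side of largest gain of the hexagon. If the path fills it, push it. Otherwise its offset
is zero by complementary slackness, so the hexagon can be shortened there without violating any
condition; this ends because `t.sum` decreases towards the sum of the actual sides. The bound on the
gain comes from the identity `2 * (c₁ + c₂) + n.sum = σ₁ + 2 * σ₂ + 2 * σ₃ + σ₄` for the sides `σ`,
each of which is bounded through the largest gain. -/
theorem exists_push (h : IsOptimal ε c₁ c₂ n t) :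
    ∃ j t', IsOptimal ε c₁ c₂ (n.push j) t' ∧
      2 * (c₁ + c₂) + n.sum ≤ 6 * (n.sides c₁ c₂).gain ε j + 3 := by
  obtain ⟨d, hd⟩ : ∃ d : ℕ, (t.sum - (n.sides c₁ c₂).sum).toNat = d := ⟨_, rfl⟩
  induction d using Nat.strong_induction_on generalizing t with
  | _ d ih =>
  obtain ⟨j, hcut, hlow, hmax⟩ := h.balanced.exists_cut
  have hle := h.le₁; have hle2 := h.le₂; have hle3 := h.le₃; have hle4 := h.le₄
  by_cases hj : (n.sides c₁ c₂).gain ε j = t.gain ε j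
  · refine ⟨j, t.cut j, ⟨?_, hcut, ?_, ?_, ?_, ?_, ?_, ?_, ?_, ?_⟩, ?_⟩
    · obtain ⟨a, b, c, d⟩ := h.nonneg
      constructor <;> fin_cases j <;> simp only [Quad.push] <;> omega
    iterate 4
      rw [Quad.sides_push]
      fin_cases j <;> simp only [Quad.cut] <;> omega
    iterate 4
      rw [Quad.sides_push]
      have e1 := h.eq₁; have e2 := h.eq₂; have e3 := h.eq₃; have e4 := h.eq₄
      fin_cases j <;> simp only [Quad.cut, Quad.push, Quad.gain] at hj ⊢ <;> omega
    · have := h.eps_cases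
      have m0 := hmax 0; have m1 := hmax 1; have m2 := hmax 2; have m3 := hmax 3
      rw [hj]
      generalize t.gain ε j = G at *
      simp only [Quad.gain, Quad.sum, Quad.sides] at *
      omega
  · refine ih _ ?_ (t := t.lower j) ⟨h.nonneg, hlow, ?_, ?_, ?_, ?_, ?_, ?_, ?_, ?_⟩ rfl
    · rw [← hd]
      fin_cases j <;> simp only [Quad.lower, Quad.sum, Quad.gain] at hj ⊢ <;> omega
    iterate 4
      fin_cases j <;> simp only [Quad.lower, Quad.gain] at hj ⊢ <;> omega
    iterate 4
      have e1 := h.eq₁; have e2 := h.eq₂; have e3 := h.eq₃; have e4 := h.eq₄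
      fin_cases j <;> simp only [Quad.lower, Quad.gain] at hj ⊢ <;> omega

theorem sq_ge (a : ℤ) : a ≤ a ^ 2 ∧ -a ≤ a ^ 2 := by
  constructor
  · exact Int.le_self_sq a
  · simpa using Int.le_self_sq (-a)

/-- Hexagonal paths along optimal hexagons are optimal among the paths of their length. -/
theorem area_le_of_sum_eq (h : IsOptimal ε c₁ c₂ n t) {n' : Quad} (hn' : n'.Nonneg)
    (hs : n'.sum = n.sum) : n'.area ε c₁ c₂ ≤ n.area ε c₁ c₂ := by
  obtain ⟨⟨p1, p2, p3, p4⟩, hbal, l1, l2, l3, l4, e1, e2, e3, e4⟩ := h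
  obtain ⟨p1', p2', p3', p4'⟩ := hn'
  -- Complementary slackness: an offset can only be lowered where the side is complete.
  have aux : ∀ m m' a b : ℤ, 0 ≤ m → 0 ≤ m' → a ≤ b → (0 < m → a = b) →
      0 ≤ (m' - m) * (b - a) := by
    intro m m' a b hm hm' hab hpos
    rcases hm.lt_or_eq with hlt | heq
    · rw [hpos hlt]; simp
    · subst heq; exact mul_nonneg (by omega) (by omega)
  have q1 := aux _ _ _ _ p1 p1' l1 e1
  have q2 := aux _ _ _ _ p2 p2' l2 e2
  have q3 := aux _ _ _ _ p3 p3' l3 e3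
  have q4 := aux _ _ _ _ p4 p4' l4 e4
  rcases n with ⟨n₁, n₂, n₃, n₄⟩
  rcases n' with ⟨m₁, m₂, m₃, m₄⟩
  rcases t with ⟨t₁, t₂, t₃, t₄⟩
  simp only [Quad.sides, Quad.sum, Quad.area, hexArea] at *
  obtain ⟨f₁, rfl⟩ : ∃ f, m₁ = n₁ + f := ⟨m₁ - n₁, by ring⟩
  obtain ⟨f₂, rfl⟩ : ∃ f, m₂ = n₂ + f := ⟨m₂ - n₂, by ring⟩
  obtain ⟨f₃, rfl⟩ : ∃ f, m₃ = n₃ + f := ⟨m₃ - n₃, by ring⟩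
  obtain rfl : m₄ = n₄ - f₁ - f₂ - f₃ := by linarith
  have s1 := sq_ge f₂; have s2 := sq_ge f₃; have s3 := sq_ge (f₂ + f₃); have s4 := sq_ge (f₁ + f₃)
  obtain ⟨x, rfl⟩ : ∃ x, t₃ = t₁ - x := ⟨t₁ - t₃, by ring⟩
  obtain ⟨y, rfl⟩ : ∃ y, t₂ = t₄ + y := ⟨t₂ - t₄, by ring⟩
  simp only [Quad.Balanced] at hbal
  have hw : ∃ w, t₁ = t₄ + w + (1 - 2 * ε) ∧ -1 ≤ w ∧ w ≤ 1 :=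
    ⟨t₁ - t₄ - (1 - 2 * ε), by ring, by omega, by omega⟩
  obtain ⟨w, rfl, hw1, hw2⟩ := hw
  have hw' : w = -1 ∨ w = 0 ∨ w = 1 := by omega
  have hx' : x = -1 ∨ x = 0 ∨ x = 1 := by omega
  have hy' : y = -1 ∨ y = 0 ∨ y = 1 := by omega
  obtain ⟨_, _, _, _, hxy1, hxy2, hbal⟩ := hbal
  -- The linear terms left over from the unequal sides have coefficients so small that, for
  -- integers, the squares absorb them.
  have hA : -2 * f₃ * x + 2 * f₂ * y ≤ f₂ ^ 2 + f₃ ^ 2 + (f₂ + f₃) ^ 2 := by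
    rcases hx' with rfl | rfl | rfl <;> rcases hy' with rfl | rfl | rfl <;>
      omega
  have hB : (f₁ + f₃) * w ≤ (f₁ + f₃) ^ 2 := by
    rcases hw' with rfl | rfl | rfl <;> linarith [s4.1, s4.2]
  clear hbal s1 s2 s3 s4 hw' hx' hy' aux e1 e2 e3 e4
  linarith

end IsOptimal

theorem exists_isOptimal {ε c₁ c₂ : ℤ} (hε : ε = 0 ∨ ε = 1) (h₁ : 0 ≤ c₁) (h₂ : 0 ≤ c₂) (k : ℕ) :
    ∃ n t, IsOptimal ε c₁ c₂ n t ∧ n.sum = k := by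
  induction k with
  | zero =>
    -- The path with two sides lies in any sufficiently large hexagon; no equality is required while
    -- all offsets vanish.
    refine ⟨⟨0, 0, 0, 0⟩, ⟨c₁ + c₂ + 2 - 2 * ε, c₁ + c₂ + 1, c₁ + c₂ + 2 - 2 * ε, c₁ + c₂ + 1⟩,
      ⟨⟨?_, ?_, ?_, ?_⟩, ?_, ?_, ?_, ?_, ?_, ?_, ?_, ?_, ?_⟩, ?_⟩ <;>
      simp only [Quad.Balanced, Quad.sides, Quad.sum] <;> omega
  | succ k ih =>
    obtain ⟨n, t, h, hs⟩ := ih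
    obtain ⟨j, t', h', -⟩ := h.exists_push
    exact ⟨_, t', h', by rw [Quad.sum_push, hs]; push_cast; ring⟩

namespace IsOptimal

variable {ε c₁ c₂ : ℤ} {n t : Quad}

theorem sum_nonneg (h : IsOptimal ε c₁ c₂ n t) : 0 ≤ n.sum := by
  obtain ⟨a, b, c, d⟩ := h.nonneg
  simp only [Quad.sum]; omega

/-- Start from an optimal path with the smaller sum and push until the sums agree: by the bound in
`exists_push` no gain is negative. -/
theorem area_mono (h : IsOptimal ε c₁ c₂ n t) (h₁ : 0 ≤ c₁) (h₂ : 0 ≤ c₂) {n' : Quad}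
    (hn' : n'.Nonneg) (hs : n'.sum ≤ n.sum) : n'.area ε c₁ c₂ ≤ n.area ε c₁ c₂ := by
  obtain ⟨k, hk⟩ : ∃ k : ℕ, n.sum - n'.sum = k := ⟨(n.sum - n'.sum).toNat, by omega⟩
  have hsum' : 0 ≤ n'.sum := by
    obtain ⟨a, b, c, d⟩ := hn'
    simp only [Quad.sum]; omega
  obtain ⟨m, u, hm, hms⟩ := exists_isOptimal h.eps_cases h₁ h₂ n'.sum.toNat
  have hms' : m.sum = n'.sum := by omega
  have hle := hm.area_le_of_sum_eq hn' hms'.symm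
  refine hle.trans ?_
  have key : ∀ k : ℕ, ∃ m' u', IsOptimal ε c₁ c₂ m' u' ∧ m'.sum = n'.sum + k ∧
      m.area ε c₁ c₂ ≤ m'.area ε c₁ c₂ := by
    intro k
    induction k with
    | zero => exact ⟨m, u, hm, by simpa using hms', le_rfl⟩
    | succ k ih =>
      obtain ⟨m', u', hm', hs', hle'⟩ := ih
      obtain ⟨j, u'', h'', hg⟩ := hm'.exists_push
      refine ⟨_, u'', h'', by rw [Quad.sum_push, hs']; push_cast; ring, ?_⟩
      rw [Quad.area_push]
      omega
  obtain ⟨m', u', hm', hs', hle'⟩ := key k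
  refine hle'.trans (h.area_le_of_sum_eq hm'.nonneg (by omega))

/-- The sides of the hexagon. -/
theorem le_six_mul (h : IsOptimal ε c₁ c₂ n t) :
    2 * (c₁ + c₂) + n.sum ≤ 6 * t.e₁ + 12 ∧ 2 * (c₁ + c₂) + n.sum ≤ 6 * t.e₂ + 12 ∧
    2 * (c₁ + c₂) + n.sum ≤ 6 * t.e₃ + 12 ∧ 2 * (c₁ + c₂) + n.sum ≤ 6 * t.e₄ + 12 := by
  -- The left side is `σ₁ + 2 * σ₂ + 2 * σ₃ + σ₄` for the actual sides `σ`; these are at most the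
  -- sides of `t`, which are almost equal.
  have l1 := h.le₁; have l2 := h.le₂; have l3 := h.le₃; have l4 := h.le₄
  have hb := h.balanced
  simp only [Quad.sides, Quad.Balanced, Quad.sum] at *
  omega

/-- A side with zero offset has nonnegative length by its formula. A side with positive offset is
complete, and the threshold `12` makes the sides of the hexagon nonnegative by `le_six_mul`. Only
then do the offsets describe an actual path. -/
theorem sides_nonneg (h : IsOptimal ε c₁ c₂ n t) (h₁ : 0 ≤ c₁) (h₂ : 0 ≤ c₂)
    (hl : 12 ≤ 2 * (c₁ + c₂) + n.sum) : (n.sides c₁ c₂).Nonneg := by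
  obtain ⟨a, b, c, d⟩ := h.nonneg
  have e1 := h.eq₁; have e2 := h.eq₂; have e3 := h.eq₃; have e4 := h.eq₄
  have := h.le_six_mul
  constructor <;> simp only [Quad.sides] at * <;> omega

theorem sq_le_sixteen {a : ℤ} (ha : -4 ≤ a ∧ a ≤ 4) : a ^ 2 ≤ 16 := by nlinarith

theorem abs_le_five {a : ℤ} (ha : a ^ 2 ≤ 32) : |a| ≤ 5 := abs_le.2 ⟨by nlinarith, by nlinarith⟩

theorem le_two_of_sq_sub_le {b : ℤ} (h : b ^ 2 - b ≤ 4) : b ≤ 2 := by nlinarith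

/-- The two first-order conditions, added, bound a positive definite quadratic form in the change of
the offsets by a linear form. Its coefficients are bounded because the end points are close and both
hexagons are balanced. -/
theorem sub_bounds {c₁' c₂' : ℤ} {n' t' : Quad} (h : IsOptimal ε c₁ c₂ n t)
    (h' : IsOptimal ε c₁' c₂' n' t') (hs : n'.sum = n.sum) (hc₁ : |c₁' - c₁| ≤ 2)
    (hc₂ : |c₂' - c₂| ≤ 2) :
    |n'.e₁ - n.e₁| ≤ 6 ∧ |n'.e₂ - n.e₂| ≤ 4 ∧ |n'.e₃ - n.e₃| ≤ 4 ∧ |n'.e₄ - n.e₄| ≤ 6 := by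
  have aux : ∀ m m' a b a' b' : ℤ, 0 ≤ m → 0 ≤ m' → a ≤ b → (0 < m → a = b) → a' ≤ b' →
      (0 < m' → a' = b') → 0 ≤ (m' - m) * ((a' - b') - (a - b)) := by
    intro m m' a b a' b' hm hm' hab hpos hab' hpos'
    rcases lt_trichotomy m m' with hlt | heq | hgt
    · rw [hpos' (by omega)]; exact mul_nonneg (by omega) (by omega)
    · subst heq; simp
    · rw [hpos (by omega)]; exact mul_nonneg_of_nonpos_of_nonpos (by omega) (by omega)
  have q1 := aux _ _ _ _ _ _ h.nonneg.h₁ h'.nonneg.h₁ h.le₁ h.eq₁ h'.le₁ h'.eq₁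
  have q2 := aux _ _ _ _ _ _ h.nonneg.h₂ h'.nonneg.h₂ h.le₂ h.eq₂ h'.le₂ h'.eq₂
  have q3 := aux _ _ _ _ _ _ h.nonneg.h₃ h'.nonneg.h₃ h.le₃ h.eq₃ h'.le₃ h'.eq₃
  have q4 := aux _ _ _ _ _ _ h.nonneg.h₄ h'.nonneg.h₄ h.le₄ h.eq₄ h'.le₄ h'.eq₄
  have hb := h.balanced
  have hb' := h'.balanced
  clear h h' aux
  rcases n with ⟨n₁, n₂, n₃, n₄⟩
  rcases n' with ⟨m₁, m₂, m₃, m₄⟩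
  rcases t with ⟨t₁, t₂, t₃, t₄⟩
  rcases t' with ⟨u₁, u₂, u₃, u₄⟩
  simp only [Quad.sides, Quad.sum, Quad.Balanced] at *
  obtain ⟨f₁, rfl⟩ : ∃ f, m₁ = n₁ + f := ⟨m₁ - n₁, by ring⟩
  obtain ⟨f₂, rfl⟩ : ∃ f, m₂ = n₂ + f := ⟨m₂ - n₂, by ring⟩
  obtain ⟨f₃, rfl⟩ : ∃ f, m₃ = n₃ + f := ⟨m₃ - n₃, by ring⟩
  obtain rfl : m₄ = n₄ - f₁ - f₂ - f₃ := by linarith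
  obtain ⟨X, hX⟩ : ∃ X, X = -(c₂' - c₂) - ((u₁ - u₃) - (t₁ - t₃)) := ⟨_, rfl⟩
  obtain ⟨Y, hY⟩ : ∃ Y, Y = (c₁' - c₁) - ((u₂ - u₄) - (t₂ - t₄)) := ⟨_, rfl⟩
  obtain ⟨W, hW⟩ : ∃ W, W = -((u₁ - u₄) - (t₁ - t₄)) := ⟨_, rfl⟩
  rw [abs_le] at hc₁ hc₂
  have bX : -4 ≤ X ∧ X ≤ 4 := by omega
  have bY : -4 ≤ Y ∧ Y ≤ 4 := by omega
  have bW : -2 ≤ W ∧ W ≤ 2 := by omega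
  -- Here `X`, `Y`, `W` collect the change of the end point and of the differences of the hexagon
  -- sides.
  have main : f₂ ^ 2 + f₃ ^ 2 + (f₂ + f₃) ^ 2 + 2 * (f₁ + f₃) ^ 2 ≤
      -f₃ * X + f₂ * Y + (f₁ + f₃) * W := by
    subst hX hY hW
    clear bX bY bW hb hb' hc₁ hc₂ hs
    linarith
  obtain ⟨β, hβ⟩ : ∃ β, β = f₁ + f₃ := ⟨_, rfl⟩
  rw [← hβ] at main
  have hW2 : β * W ≤ 2 * |β| := by
    calc β * W ≤ |β * W| := le_abs_self _
      _ = |β| * |W| := abs_mul _ _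
      _ ≤ |β| * 2 := by gcongr; exact abs_le.2 bW
      _ = 2 * |β| := by ring
  have hβ2 : β ^ 2 = |β| ^ 2 := (sq_abs β).symm
  have hX2 := sq_le_sixteen bX
  have hY2 := sq_le_sixteen bY
  have hb1 : |β| ≤ |β| ^ 2 := Int.le_self_sq _
  have tot : (2 * f₂ - Y) ^ 2 + (2 * f₃ + X) ^ 2 + 8 * (|β| ^ 2 - |β|) ≤ 32 := by
    linarith [sq_nonneg (f₂ + f₃)]
  have p2 := sq_nonneg (2 * f₂ - Y)
  have p3 := sq_nonneg (2 * f₃ + X)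
  have h2 := abs_le_five (show (2 * f₂ - Y) ^ 2 ≤ 32 by linarith)
  have h3 := abs_le_five (show (2 * f₃ + X) ^ 2 ≤ 32 by linarith)
  have hbb : |β| ≤ 2 := by
    exact le_two_of_sq_sub_le (by linarith)
  rw [abs_le] at hbb h2 h3
  simp only [abs_le]
  omega

end IsOptimal

/-! ### Lengths and coordinates in a frame -/

def Letter.vec : Letter → ℤ × ℤ
  | .x => (1, 0)
  | .y => (0, 1)
  | .t => (1, 1)
  | .xi => (-1, 0)
  | .yi => (0, -1)
  | .ti => (-1, -1)

theorem p_val (l : Letter) : p l.val = Multiplicative.ofAdd l.vec := by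
  cases l <;> rw [p_eq] <;> simp [Letter.val, Letter.vec]

theorem p_Z (f : Frame) : p f.Z = 1 := by
  unfold Frame.Z
  split <;> simp [p_z]

theorem p_pt (f : Frame) (a b s : ℤ) :
    p (f.pt a b s) = Multiplicative.ofAdd (a • (f.letter 0).vec + b • (f.letter 1).vec) := by
  simp only [Frame.pt, map_mul, map_zpow, p_Z, one_zpow, mul_one, Frame.U, Frame.V, p_val]
  rw [ofAdd_add, ofAdd_zsmul, ofAdd_zsmul]

theorem fstCoord_pt (f : Frame) (a b s : ℤ) :
    fstCoord (p (f.pt a b s)) = a * (f.letter 0).vec.1 + b * (f.letter 1).vec.1 := by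
  simp [p_pt, fstCoord]

theorem sndCoord_pt (f : Frame) (a b s : ℤ) :
    sndCoord (p (f.pt a b s)) = a * (f.letter 0).vec.2 + b * (f.letter 1).vec.2 := by
  simp [p_pt, sndCoord]

theorem p_pt_injective (f : Frame) {a b s a' b' s' : ℤ}
    (h : p (f.pt a b s) = p (f.pt a' b' s')) : a = a' ∧ b = b' := by
  have h1 := congrArg fstCoord h
  have h2 := congrArg sndCoord h
  rw [fstCoord_pt, fstCoord_pt] at h1
  rw [sndCoord_pt, sndCoord_pt] at h2
  rcases f with ⟨u, pos⟩
  cases u <;> cases pos <;>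
    simp [Frame.letter, Frame.turn, Letter.next, Letter.prev, Letter.vec] at h1 h2 <;> omega

theorem Z_zpow_injective (f : Frame) {s s' : ℤ} (h : f.Z ^ s = f.Z ^ s') : s = s' := by
  have := congrArg toHeis h
  rw [map_zpow, map_zpow] at this
  unfold Frame.Z at this
  split at this
  · rw [toHeis_z, Heis.zpow_center, Heis.zpow_center] at this
    simpa using this
  · rw [map_inv, toHeis_z, inv_zpow', inv_zpow', Heis.zpow_center, Heis.zpow_center] at this
    simpa using this

theorem pt_injective (f : Frame) {a b s a' b' s' : ℤ} (h : f.pt a b s = f.pt a' b' s') :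
    a = a' ∧ b = b' ∧ s = s' := by
  obtain ⟨rfl, rfl⟩ := p_pt_injective f (congrArg p h)
  refine ⟨rfl, rfl, Z_zpow_injective f ?_⟩
  simpa [Frame.pt] using h

theorem letter_surjective (f : Frame) : Function.Surjective f.letter := by
  intro l
  rcases f with ⟨u, pos⟩
  have : l = Frame.letter ⟨u, pos⟩ 0 ∨ l = Frame.letter ⟨u, pos⟩ 1 ∨ l = Frame.letter ⟨u, pos⟩ 2 ∨
      l = Frame.letter ⟨u, pos⟩ 3 ∨ l = Frame.letter ⟨u, pos⟩ 4 ∨ l = Frame.letter ⟨u, pos⟩ 5 := by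
    cases u <;> cases pos <;> cases l <;>
      simp [Frame.letter, Frame.turn, Letter.next, Letter.prev]
  rcases this with h | h | h | h | h | h <;> exact ⟨_, h.symm⟩

theorem exists_map_letter (f : Frame) (w : Word) : ∃ W : List (Fin 6), W.map f.letter = w := by
  induction w with
  | nil => exact ⟨[], rfl⟩
  | cons l w ih =>
    obtain ⟨W, rfl⟩ := ih
    obtain ⟨i, rfl⟩ := letter_surjective f l
    exact ⟨i :: W, rfl⟩

@[simp] theorem eval_nil : eval [] = 1 := rfl

theorem eval_cons (l : Letter) (w : Word) : eval (l :: w) = l.val * eval w := by simp [eval]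

theorem eval_append (w w' : Word) : eval (w ++ w') = eval w * eval w' := by simp [eval]

theorem Letter.exists_inv (l : Letter) : ∃ l' : Letter, l'.val = l.val⁻¹ := by
  cases l
  exacts [⟨.xi, rfl⟩, ⟨.yi, rfl⟩, ⟨.ti, rfl⟩, ⟨.x, by simp [Letter.val]⟩,
    ⟨.y, by simp [Letter.val]⟩, ⟨.t, by simp [Letter.val]⟩]

theorem exists_eval (g : N) : ∃ w : Word, eval w = g := by
  let H : Subgroup N :=
    { carrier := {g | ∃ w : Word, eval w = g}
      one_mem' := ⟨[], rfl⟩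
      mul_mem' := by
        rintro _ _ ⟨w, rfl⟩ ⟨w', rfl⟩
        exact ⟨w ++ w', eval_append _ _⟩
      inv_mem' := by
        rintro _ ⟨w, rfl⟩
        induction w with
        | nil => exact ⟨[], by simp⟩
        | cons l w ih =>
          obtain ⟨w', hw'⟩ := ih
          obtain ⟨l', hl'⟩ := l.exists_inv
          exact ⟨w' ++ [l'], by rw [eval_append, eval_cons, hw', eval_cons]; simp [hl']⟩ }
  exact PresentedGroup.generated_by rels H (fun l => by
    cases l
    · exact ⟨[.x], by simp [eval_cons, Letter.val, x]⟩
    · exact ⟨[.y], by simp [eval_cons, Letter.val, y]⟩) g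

theorem exists_pt (f : Frame) (g : N) : ∃ a b s : ℤ, g = f.pt a b s := by
  obtain ⟨w, rfl⟩ := exists_eval g
  obtain ⟨W, rfl⟩ := exists_map_letter f w
  exact ⟨_, _, _, f.eval_map W⟩

theorem len_le {g : N} {w : Word} (h : eval w = g) : len g ≤ w.length :=
  Nat.sInf_le ⟨w, rfl, h⟩

theorem exists_word (g : N) : ∃ w : Word, w.length = len g ∧ eval w = g := by
  obtain ⟨w, hw⟩ := exists_eval g
  exact Nat.sInf_mem (s := {k : ℕ | ∃ w : Word, w.length = k ∧ eval w = g}) ⟨_, w, rfl, hw⟩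

theorem prod_map_p (w : Word) : (w.map fun l => p l.val).prod = p (eval w) := by
  induction w with
  | nil => simp
  | cons l w ih => rw [List.map_cons, List.prod_cons, ih, eval_cons, map_mul]

theorem planeLen_le {P : Plane} {w : Word} (h : p (eval w) = P) : planeLen P ≤ w.length :=
  Nat.sInf_le ⟨w, rfl, by rw [prod_map_p, h]⟩

theorem p_surjective : Function.Surjective p := by
  intro P
  refine ⟨x ^ (Multiplicative.toAdd P).1 * y ^ (Multiplicative.toAdd P).2 * z ^ (0 : ℤ), ?_⟩
  rw [p_eq, toHeis_normalForm]
  rfl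

theorem exists_plane_word (P : Plane) : ∃ w : Word, w.length = planeLen P ∧ p (eval w) = P := by
  obtain ⟨g, rfl⟩ := p_surjective P
  obtain ⟨w, rfl⟩ := exists_eval g
  obtain ⟨w', h1, h2⟩ := Nat.sInf_mem
    (s := {k : ℕ | ∃ w' : Word, w'.length = k ∧ (w'.map fun l => p l.val).prod = p (eval w)})
    ⟨_, w, rfl, prod_map_p w⟩
  exact ⟨w', h1, by rw [← prod_map_p, h2]⟩

theorem planeLen_mul (P Q : Plane) : planeLen (P * Q) ≤ planeLen P + planeLen Q := by
  obtain ⟨w, h1, h2⟩ := exists_plane_word P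
  obtain ⟨w', h1', h2'⟩ := exists_plane_word Q
  rw [← h1, ← h1', ← List.length_append]
  exact planeLen_le (by rw [eval_append, map_mul, h2, h2'])

theorem planeDist_triangle (P Q R : Plane) : planeDist P R ≤ planeDist P Q + planeDist Q R := by
  have : P⁻¹ * R = P⁻¹ * Q * (Q⁻¹ * R) := by group
  rw [planeDist, this]
  exact planeLen_mul _ _

theorem len_pt_le_iff (f : Frame) (a b s : ℤ) (m : ℕ) :
    len (f.pt a b s) ≤ m ↔ ∃ W : List (Fin 6), W.length ≤ m ∧ posU W = a ∧ posV W = b ∧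
      area f.eps W = s := by
  constructor
  · intro h
    obtain ⟨w, h1, h2⟩ := exists_word (f.pt a b s)
    obtain ⟨W, rfl⟩ := exists_map_letter f w
    rw [f.eval_map] at h2
    obtain ⟨e1, e2, e3⟩ := pt_injective f h2
    rw [List.length_map] at h1
    exact ⟨W, by omega, e1, e2, e3⟩
  · rintro ⟨W, h1, rfl, rfl, rfl⟩
    refine (len_le (f.eval_map W)).trans ?_
    rwa [List.length_map]

theorem posU_add_posV_le (W : List (Fin 6)) : posU W + posV W ≤ W.length := by
  have h := cnt_nonneg W
  have h2 := h 2; have h3 := h 3; have h4 := h 4; have h5 := h 5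
  rw [posU_eq_cnt, posV_eq_cnt, length_eq_cnt]
  omega

theorem posU_replicate (k : ℕ) (i : Fin 6) : posU (List.replicate k i) = k * dU i := by
  simp [posU]

theorem posV_replicate (k : ℕ) (i : Fin 6) : posV (List.replicate k i) = k * dV i := by
  simp [posV]

theorem two_mul_area_replicate (ε : ℤ) (k : ℕ) (i : Fin 6) :
    2 * area ε (List.replicate k i) = 2 * k * dS ε i - dU i * dV i * (k * (k - 1)) := by
  induction k with
  | zero => simp
  | succ k ih =>
    rw [List.replicate_succ, area_cons, posU_replicate]
    push_cast
    linear_combination ih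

/-- A short word for a point of the plane. -/
theorem exists_short_word {a b : ℤ} {K : ℕ} (h : -K ≤ a ∧ a ≤ K ∧ -K ≤ b ∧ b ≤ K ∧
    -K ≤ a + b ∧ a + b ≤ K) : ∃ W : List (Fin 6), W.length ≤ K ∧ posU W = a ∧ posV W = b := by
  have key : ∀ (i j : Fin 6) (m m' : ℤ), 0 ≤ m → 0 ≤ m' → m + m' ≤ K →
      m * dU i + m' * dU j = a → m * dV i + m' * dV j = b →
      ∃ W : List (Fin 6), W.length ≤ K ∧ posU W = a ∧ posV W = b := by
    intro i j m m' hm hm' hle ha hb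
    refine ⟨List.replicate m.toNat i ++ List.replicate m'.toNat j, ?_, ?_, ?_⟩
    · simp only [List.length_append, List.length_replicate]; omega
    · rw [posU_append, posU_replicate, posU_replicate, Int.toNat_of_nonneg hm,
        Int.toNat_of_nonneg hm', ha]
    · rw [posV_append, posV_replicate, posV_replicate, Int.toNat_of_nonneg hm,
        Int.toNat_of_nonneg hm', hb]
  obtain ⟨i, hi⟩ := exists_inSector a b
  fin_cases i <;> simp only [InSector] at hi
  · exact key 0 1 a b (by omega) (by omega) (by omega) (by simp [dU]) (by simp [dV])
  · exact key 1 2 (a + b) (-a) (by omega) (by omega) (by omega) (by simp [dU]) (by simp [dV])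
  · exact key 2 3 b (-a - b) (by omega) (by omega) (by omega) (by simp [dU]) (by simp [dV])
  · exact key 3 4 (-a) (-b) (by omega) (by omega) (by omega) (by simp [dU]) (by simp [dV])
  · exact key 4 5 (-a - b) a (by omega) (by omega) (by omega) (by simp [dU]) (by simp [dV])
  · exact key 5 0 (-b) (a + b) (by omega) (by omega) (by omega) (by simp [dU]) (by simp [dV])

theorem planeLen_pt (f : Frame) {a b : ℤ} (s : ℤ) (ha : 0 ≤ a) (hb : 0 ≤ b) :
    (planeLen (p (f.pt a b s)) : ℤ) = a + b := by
  apply le_antisymm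
  · obtain ⟨W, h1, h2, h3⟩ := exists_short_word (a := a) (b := b) (K := (a + b).toNat) (by omega)
    have := planeLen_le (P := p (f.pt a b s)) (w := W.map f.letter)
      (by rw [f.eval_map, p_pt, p_pt, h2, h3])
    rw [List.length_map] at this
    omega
  · obtain ⟨w, h1, h2⟩ := exists_plane_word (p (f.pt a b s))
    obtain ⟨W, rfl⟩ := exists_map_letter f w
    rw [f.eval_map] at h2
    obtain ⟨e1, e2⟩ := p_pt_injective f h2
    have := posU_add_posV_le W
    rw [List.length_map] at h1
    omega

theorem planeDist_pt_le (f : Frame) {a b s a' b' s' : ℤ} {K : ℕ} (h : -K ≤ a' - a ∧ a' - a ≤ K ∧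
    -K ≤ b' - b ∧ b' - b ≤ K ∧ -K ≤ (a' - a) + (b' - b) ∧ (a' - a) + (b' - b) ≤ K) :
    planeDist (p (f.pt a b s)) (p (f.pt a' b' s')) ≤ K := by
  obtain ⟨W, h1, h2, h3⟩ := exists_short_word h
  have := planeLen_le (P := (p (f.pt a b s))⁻¹ * p (f.pt a' b' s')) (w := W.map f.letter) (by
    rw [f.eval_map, eq_inv_mul_iff_mul_eq, ← map_mul, f.pt_mul, p_pt, p_pt, h2, h3]
    simp)
  rw [List.length_map] at this
  exact this.trans h1

/-! ### Paths along hexagons -/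

/-- A straight path of length `k`. -/
def run (i : Fin 6) (k : ℤ) : List (Fin 6) := List.replicate k.toNat i

theorem length_run (i : Fin 6) {k : ℤ} (hk : 0 ≤ k) : ((run i k).length : ℤ) = k := by
  simp [run, hk]

theorem posU_run (i : Fin 6) {k : ℤ} (hk : 0 ≤ k) : posU (run i k) = k * dU i := by
  rw [run, posU_replicate, Int.toNat_of_nonneg hk]

theorem posV_run (i : Fin 6) {k : ℤ} (hk : 0 ≤ k) : posV (run i k) = k * dV i := by
  rw [run, posV_replicate, Int.toNat_of_nonneg hk]

theorem two_mul_area_run (ε : ℤ) (i : Fin 6) {k : ℤ} (hk : 0 ≤ k) :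
    2 * area ε (run i k) = 2 * k * dS ε i - dU i * dV i * (k * (k - 1)) := by
  rw [run, two_mul_area_replicate, Int.toNat_of_nonneg hk]

theorem run_add (i : Fin 6) {k l : ℤ} (hk : 0 ≤ k) (hl : 0 ≤ l) :
    run i (k + l) = run i k ++ run i l := by
  rw [run, run, run, List.replicate_append_replicate, Int.toNat_add hk hl]

theorem run_one (i : Fin 6) : run i 1 = [i] := rfl

@[simp] theorem run_zero (i : Fin 6) : run i 0 = [] := rfl

/-- The path from `(0, 0)` to `(c₁, c₂)` with sides `n₁, n₂ - n₁, …, n₃ - n₄, n₄` in the directions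
`4, 5, 0, 1, 2, 3`. -/
def Quad.path (c₁ c₂ : ℤ) (n : Quad) : List (Fin 6) :=
  run 4 n.e₁ ++ run 5 (n.sides c₁ c₂).e₁ ++ run 0 (n.sides c₁ c₂).e₂ ++
    run 1 (n.sides c₁ c₂).e₃ ++ run 2 (n.sides c₁ c₂).e₄ ++ run 3 n.e₄

/-- Length, end point and area of a path with six sides. -/
theorem six_runs {i₁ i₂ i₃ i₄ i₅ i₆ : Fin 6} {a b c d e g : ℤ} (ha : 0 ≤ a) (hb : 0 ≤ b)
    (hc : 0 ≤ c) (hd : 0 ≤ d) (he : 0 ≤ e) (hg : 0 ≤ g) (ε : ℤ) (W : List (Fin 6))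
    (hW : W = run i₁ a ++ run i₂ b ++ run i₃ c ++ run i₄ d ++ run i₅ e ++ run i₆ g) :
    (W.length : ℤ) = a + b + c + d + e + g ∧
    posU W = a * dU i₁ + b * dU i₂ + c * dU i₃ + d * dU i₄ + e * dU i₅ + g * dU i₆ ∧
    posV W = a * dV i₁ + b * dV i₂ + c * dV i₃ + d * dV i₄ + e * dV i₅ + g * dV i₆ ∧
    2 * area ε W = (2 * a * dS ε i₁ - dU i₁ * dV i₁ * (a * (a - 1)))
      + (2 * b * dS ε i₂ - dU i₂ * dV i₂ * (b * (b - 1)))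
      + (2 * c * dS ε i₃ - dU i₃ * dV i₃ * (c * (c - 1)))
      + (2 * d * dS ε i₄ - dU i₄ * dV i₄ * (d * (d - 1)))
      + (2 * e * dS ε i₅ - dU i₅ * dV i₅ * (e * (e - 1)))
      + (2 * g * dS ε i₆ - dU i₆ * dV i₆ * (g * (g - 1)))
      - 2 * (a * dV i₁ * (b * dU i₂)) - 2 * ((a * dV i₁ + b * dV i₂) * (c * dU i₃))
      - 2 * ((a * dV i₁ + b * dV i₂ + c * dV i₃) * (d * dU i₄))
      - 2 * ((a * dV i₁ + b * dV i₂ + c * dV i₃ + d * dV i₄) * (e * dU i₅))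
      - 2 * ((a * dV i₁ + b * dV i₂ + c * dV i₃ + d * dV i₄ + e * dV i₅) * (g * dU i₆)) := by
  subst hW
  refine ⟨?_, ?_, ?_, ?_⟩
  · simp only [List.length_append, Nat.cast_add, length_run, *]
  · simp only [posU_append, posU_run, *]
  · simp only [posV_append, posV_run, *]
  · simp only [area_append, posV_append, posU_run, posV_run, *]
    linear_combination two_mul_area_run ε i₁ ha + two_mul_area_run ε i₂ hb +
      two_mul_area_run ε i₃ hc + two_mul_area_run ε i₄ hd + two_mul_area_run ε i₅ he +
      two_mul_area_run ε i₆ hg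

namespace Quad

variable {c₁ c₂ : ℤ} {n : Quad}

theorem length_path (hn : n.Nonneg) (ht : (n.sides c₁ c₂).Nonneg) :
    ((n.path c₁ c₂).length : ℤ) = c₁ + c₂ + n.sum := by
  rw [path, (six_runs hn.h₁ ht.h₁ ht.h₂ ht.h₃ ht.h₄ hn.h₄ 0 _ rfl).1]
  simp only [sides, sum]; ring

theorem posU_path (hn : n.Nonneg) (ht : (n.sides c₁ c₂).Nonneg) : posU (n.path c₁ c₂) = c₁ := by
  rw [path, (six_runs hn.h₁ ht.h₁ ht.h₂ ht.h₃ ht.h₄ hn.h₄ 0 _ rfl).2.1]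
  simp only [sides, dU]; ring

theorem posV_path (hn : n.Nonneg) (ht : (n.sides c₁ c₂).Nonneg) : posV (n.path c₁ c₂) = c₂ := by
  rw [path, (six_runs hn.h₁ ht.h₁ ht.h₂ ht.h₃ ht.h₄ hn.h₄ 0 _ rfl).2.2.1]
  simp only [sides, dV]; ring

theorem two_mul_area_path (ε : ℤ) (hn : n.Nonneg) (ht : (n.sides c₁ c₂).Nonneg) :
    2 * NilHex.area ε (n.path c₁ c₂) = n.area ε c₁ c₂ := by
  rw [path, (six_runs hn.h₁ ht.h₁ ht.h₂ ht.h₃ ht.h₄ hn.h₄ ε _ rfl).2.2.2]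
  simp only [sides, dV, dU, dS, area, hexArea]; ring

end Quad

/-- Replacing the corner `d' d` by `d d'`, letter by letter, changes the area by one each time. -/
theorem area_swap (ε : ℤ) (d' d : Fin 6) (i : ℤ) (hi : 0 ≤ i) (A B : List (Fin 6)) :
    area ε (A ++ (run d i ++ d' :: B)) =
      area ε (A ++ (d' :: (run d i ++ B))) - i * (dV d * dU d' - dV d' * dU d) := by
  simp only [area_append, area_cons, posU_append, posU_cons, posU_run, posV_run, hi]
  ring

theorem posU_swap (d' d : Fin 6) (i : ℤ) (A B : List (Fin 6)) :
    posU (A ++ (run d i ++ d' :: B)) = posU (A ++ (d' :: (run d i ++ B))) := by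
  simp only [posU_append, posU_cons]; ring

theorem posV_swap (d' d : Fin 6) (i : ℤ) (A B : List (Fin 6)) :
    posV (A ++ (run d i ++ d' :: B)) = posV (A ++ (d' :: (run d i ++ B))) := by
  simp only [posV_append, posV_cons]; ring

/-- The three consecutive sides of a path that are affected if the middle one, of direction `d`, is
moved outwards by one. -/
theorem Quad.exists_decomp (c₁ c₂ : ℤ) {n : Quad} (hn : n.Nonneg) (ht : (n.sides c₁ c₂).Nonneg)
    (j : Fin 4) : ∃ (d' d d'' : Fin 6) (a b c : ℤ) (A B : List (Fin 6)),
      dV d * dU d' - dV d' * dU d = 1 ∧ dU d' + dU d'' = dU d ∧ dV d' + dV d'' = dV d ∧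
      (∀ ε : ℤ, ε = 0 ∨ ε = 1 → (n.sides c₁ c₂).gain ε j ≤ b) ∧ 0 ≤ a ∧ 0 ≤ c ∧ 0 ≤ b ∧
      n.path c₁ c₂ = A ++ (run d' a ++ run d b ++ run d'' c) ++ B ∧
      (n.push j).path c₁ c₂ = A ++ (run d' (a + 1) ++ run d (b - 1) ++ run d'' (c + 1)) ++ B := by
  have := hn.h₁; have := hn.h₄
  have := ht.h₁; have := ht.h₂; have := ht.h₃; have := ht.h₄
  fin_cases j <;> simp only [path, push, sides, gain] at *
  · refine ⟨4, 5, 0, n.e₁, n.e₂ - n.e₁, c₁ - n.e₂ + n.e₁ + n.e₃, [],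
      run 1 (c₂ + n.e₂ - n.e₃ + n.e₄) ++ run 2 (n.e₃ - n.e₄) ++ run 3 n.e₄, ?_⟩
    refine ⟨rfl, rfl, rfl, by omega, by omega, by omega, by omega,
      by simp only [List.nil_append, List.append_assoc], ?_⟩
    simp only [List.nil_append, List.append_assoc]
    ring_nf
  · refine ⟨5, 0, 1, n.e₂ - n.e₁, c₁ - n.e₂ + n.e₁ + n.e₃, c₂ + n.e₂ - n.e₃ + n.e₄, run 4 n.e₁,
      run 2 (n.e₃ - n.e₄) ++ run 3 n.e₄, ?_⟩
    refine ⟨rfl, rfl, rfl, by omega, by omega, by omega, by omega,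
      by simp only [List.append_assoc], ?_⟩
    simp only [List.append_assoc]
    ring_nf
  · refine ⟨0, 1, 2, c₁ - n.e₂ + n.e₁ + n.e₃, c₂ + n.e₂ - n.e₃ + n.e₄, n.e₃ - n.e₄,
      run 4 n.e₁ ++ run 5 (n.e₂ - n.e₁), run 3 n.e₄, ?_⟩
    refine ⟨rfl, rfl, rfl, by omega, by omega, by omega, by omega,
      by simp only [List.append_assoc], ?_⟩
    simp only [List.append_assoc]
    ring_nf
  · refine ⟨1, 2, 3, c₂ + n.e₂ - n.e₃ + n.e₄, n.e₃ - n.e₄, n.e₄,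
      run 4 n.e₁ ++ run 5 (n.e₂ - n.e₁) ++ run 0 (c₁ - n.e₂ + n.e₁ + n.e₃), [], ?_⟩
    refine ⟨rfl, rfl, rfl, by omega, by omega, by omega, by omega,
      by simp only [List.append_assoc, List.append_nil], ?_⟩
    simp only [List.append_assoc, List.append_nil]
    ring_nf

/-! ### Paths that stay close to each other -/

/-- The end points and the lengths of two paths differ by at most `K`. -/
structure Near (K : ℤ) (A A' : List (Fin 6)) : Prop where
  u₁ : -K ≤ posU A' - posU A
  u₂ : posU A' - posU A ≤ K
  v₁ : -K ≤ posV A' - posV A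
  v₂ : posV A' - posV A ≤ K
  w₁ : -K ≤ (posU A' - posU A) + (posV A' - posV A)
  w₂ : (posU A' - posU A) + (posV A' - posV A) ≤ K
  l₁ : -K ≤ (A'.length : ℤ) - A.length
  l₂ : (A'.length : ℤ) - A.length ≤ K

theorem Near.symm {K : ℤ} {A A' : List (Fin 6)} (h : Near K A A') : Near K A' A := by
  obtain ⟨h1, h2, h3, h4, h5, h6, h7, h8⟩ := h
  constructor <;> omega

theorem prefix_append_run {A W : List (Fin 6)} {d : Fin 6} {m : ℤ} (hm : 0 ≤ m)
    (h : A <+: W ++ run d m) : A <+: W ∨ ∃ i : ℤ, 0 ≤ i ∧ i ≤ m ∧ A = W ++ run d i := by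
  obtain ⟨B, hB⟩ := h
  rcases List.append_eq_append_iff.1 hB with ⟨C, hC, -⟩ | ⟨C, hC, hC'⟩
  · exact Or.inl ⟨C, hC.symm⟩
  · have hC'' := List.append_eq_replicate_iff.1 hC'.symm
    exact Or.inr ⟨C.length, by omega, by omega, by rw [hC, run, Int.toNat_natCast, ← hC''.2.1]⟩

/-- Two paths each initial segment of which is near an initial segment of the other one. -/
structure Tracks (K : ℤ) (W W' : List (Fin 6)) : Prop where
  near : Near K W W'
  left : ∀ A, A <+: W → ∃ A', A' <+: W' ∧ Near K A A'
  right : ∀ A', A' <+: W' → ∃ A, A <+: W ∧ Near K A A'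

namespace Tracks

variable {K : ℤ} {W W' : List (Fin 6)}

theorem symm (h : Tracks K W W') : Tracks K W' W :=
  ⟨h.near.symm, fun A hA => (h.right A hA).imp fun _ hB => ⟨hB.1, hB.2.symm⟩,
    fun A hA => (h.left A hA).imp fun _ hB => ⟨hB.1, hB.2.symm⟩⟩

theorem nil (hK : 0 ≤ K) : Tracks K [] [] := by
  have : Near K [] [] := by constructor <;> simp [hK]
  exact ⟨this, fun A hA => ⟨[], List.prefix_rfl, by rwa [List.prefix_nil.1 hA]⟩,
    fun A hA => ⟨[], List.prefix_rfl, by rwa [List.prefix_nil.1 hA]⟩⟩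

/-- While both paths run in the direction `d` their difference is constant. After the second one
stops, the difference moves monotonically from its initial value to its final value, and both are
within `K`. -/
theorem left_append_run (h : Tracks K W W') (d : Fin 6) {m m' : ℤ} (hm : 0 ≤ m) (hm' : 0 ≤ m')
    (hn : Near K (W ++ run d m) (W' ++ run d m')) (A : List (Fin 6)) (hA : A <+: W ++ run d m) :
    ∃ A', A' <+: W' ++ run d m' ∧ Near K A A' := by
  rcases prefix_append_run hm hA with hA | ⟨i, hi, him, rfl⟩
  · obtain ⟨A', hA', hN⟩ := h.left A hA
    exact ⟨A', hA'.trans (List.prefix_append _ _), hN⟩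
  · have h0 := h.near
    rcases le_total i m' with hi' | hi'
    · refine ⟨W' ++ run d i, ⟨run d (m' - i), ?_⟩, ?_⟩
      · rw [List.append_assoc, ← run_add d hi (by omega)]; simp
      · obtain ⟨h1, h2, h3, h4, h5, h6, h7, h8⟩ := h0
        constructor <;> simp only [posU_append, posV_append, List.length_append, Nat.cast_add] <;>
          omega
    · refine ⟨W' ++ run d m', List.prefix_rfl, ?_⟩
      obtain ⟨h1, h2, h3, h4, h5, h6, h7, h8⟩ := h0
      obtain ⟨k1, k2, k3, k4, k5, k6, k7, k8⟩ := hn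
      simp only [posU_append, posV_append, List.length_append, Nat.cast_add, posU_run, posV_run,
        length_run, hm, hm'] at k1 k2 k3 k4 k5 k6 k7 k8
      constructor <;> simp only [posU_append, posV_append, List.length_append, Nat.cast_add,
        posU_run, posV_run, length_run, hi, hm'] <;>
        fin_cases d <;> simp only [dU, dV, Fin.zero_eta, Fin.mk_one, Fin.reduceFinMk] at * <;> omega

theorem append_run (h : Tracks K W W') (d : Fin 6) {m m' : ℤ} (hm : 0 ≤ m) (hm' : 0 ≤ m')
    (hn : Near K (W ++ run d m) (W' ++ run d m')) : Tracks K (W ++ run d m) (W' ++ run d m') :=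
  ⟨hn, h.left_append_run d hm hm' hn, fun A hA =>
    (h.symm.left_append_run d hm' hm hn.symm A hA).imp fun _ hB => ⟨hB.1, hB.2.symm⟩⟩

theorem append_right (h : Tracks K W W') (B : List (Fin 6)) : Tracks K (W ++ B) (W' ++ B) := by
  induction B using List.reverseRecOn with
  | nil => simpa using h
  | append_singleton B d ih =>
    rw [← run_one d, ← List.append_assoc, ← List.append_assoc]
    refine ih.append_run d (by omega) (by omega) ?_
    obtain ⟨h1, h2, h3, h4, h5, h6, h7, h8⟩ := ih.near
    constructor <;>
      simp only [posU_append, posV_append, List.length_append, Nat.cast_add] at * <;> omega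

theorem refl (hK : 0 ≤ K) (W : List (Fin 6)) : Tracks K W W := (nil hK).append_right W

end Tracks

/-- Each point of one of the projected paths is close to a point of the other one, at almost the same
time. -/
def Close (K : ℕ) (w w' : Word) : Prop :=
  ∀ u, u <+: w → ∃ u', u' <+: w' ∧ -(K : ℤ) ≤ (u'.length : ℤ) - u.length ∧
    (u'.length : ℤ) - u.length ≤ K ∧ planeDist (p (eval u)) (p (eval u')) ≤ K

theorem Close.trans {K K' : ℕ} {w w' w'' : Word} (h : Close K w w') (h' : Close K' w' w'') :
    Close (K + K') w w'' := by
  intro u hu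
  obtain ⟨u', hu', h1, h2, h3⟩ := h u hu
  obtain ⟨u'', hu'', h1', h2', h3'⟩ := h' u' hu'
  refine ⟨u'', hu'', by omega, by omega, ?_⟩
  have := planeDist_triangle (p (eval u)) (p (eval u')) (p (eval u''))
  omega

theorem Close.mono {K K' : ℕ} {w w' : Word} (h : Close K w w') (hK : K ≤ K') : Close K' w w' := by
  intro u hu
  obtain ⟨u', hu', h1, h2, h3⟩ := h u hu
  exact ⟨u', hu', by omega, by omega, by omega⟩

/-- Closeness in both directions. -/
def Similar (K : ℕ) (w w' : Word) : Prop := Close K w w' ∧ Close K w' w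

theorem Similar.symm {K : ℕ} {w w' : Word} (h : Similar K w w') : Similar K w' w := ⟨h.2, h.1⟩

theorem Similar.trans {K K' : ℕ} {w w' w'' : Word} (h : Similar K w w') (h' : Similar K' w' w'') :
    Similar (K + K') w w'' :=
  ⟨h.1.trans h'.1, (h'.2.trans h.2).mono (by omega)⟩

theorem Similar.mono {K K' : ℕ} {w w' : Word} (h : Similar K w w') (hK : K ≤ K') :
    Similar K' w w' := ⟨h.1.mono hK, h.2.mono hK⟩

theorem Tracks.close {K : ℕ} {W W' : List (Fin 6)} (h : Tracks K W W') (f : Frame) :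
    Close K (W.map f.letter) (W'.map f.letter) := by
  rintro u ⟨v, huv⟩
  obtain ⟨A, B, rfl, rfl, rfl⟩ := List.map_eq_append_iff.1 huv.symm
  obtain ⟨A', hA', hN⟩ := h.left A (List.prefix_append _ _)
  refine ⟨A'.map f.letter, hA'.map _, ?_, ?_, ?_⟩
  · simpa using hN.l₁
  · simpa using hN.l₂
  · rw [f.eval_map, f.eval_map]
    exact planeDist_pt_le f ⟨hN.u₁, hN.u₂, hN.v₁, hN.v₂, hN.w₁, hN.w₂⟩

theorem Tracks.similar {K : ℕ} {W W' : List (Fin 6)} (h : Tracks K W W') (f : Frame) :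
    Similar K (W.map f.letter) (W'.map f.letter) := ⟨h.close f, h.symm.close f⟩

/-! ### From initial subwords to points of the Cayley graph at real times -/

theorem graphDist_le (P Q : GraphPoint) : graphDist P Q ≤ P.s + planeDist P.v Q.v + Q.s := by
  unfold graphDist
  dsimp only
  split_ifs
  · exact (min_le_left _ _).trans ((min_le_left _ _).trans (min_le_left _ _))
  · exact (min_le_left _ _).trans ((min_le_left _ _).trans (min_le_left _ _))
  · exact (min_le_left _ _).trans (min_le_left _ _)

theorem planeDist_take_le (w : Word) {i j : ℕ} (hij : i ≤ j) :
    planeDist (p (eval (w.take i))) (p (eval (w.take j))) ≤ j - i := by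
  obtain ⟨k, rfl⟩ := Nat.exists_eq_add_of_le hij
  rw [List.take_add, eval_append, map_mul, planeDist, inv_mul_cancel_left]
  refine (planeLen_le rfl).trans ?_
  simp

theorem exists_inv_word (w : Word) : ∃ w' : Word, w'.length = w.length ∧ eval w' = (eval w)⁻¹ := by
  induction w with
  | nil => exact ⟨[], rfl, by simp⟩
  | cons l w ih =>
    obtain ⟨w', e1, e2⟩ := ih
    obtain ⟨l', hl'⟩ := l.exists_inv
    exact ⟨w' ++ [l'], by simp [e1], by rw [eval_append, eval_cons, eval_cons, e2]; simp [hl']⟩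

theorem planeLen_inv_le (P : Plane) : planeLen P⁻¹ ≤ planeLen P := by
  obtain ⟨w, h1, h2⟩ := exists_plane_word P
  obtain ⟨w', e1, e2⟩ := exists_inv_word w
  rw [← h1, ← e1]
  exact planeLen_le (by rw [e2, map_inv, h2])

theorem planeDist_comm (P Q : Plane) : planeDist P Q = planeDist Q P := by
  have h : P⁻¹ * Q = (Q⁻¹ * P)⁻¹ := by group
  have h' : Q⁻¹ * P = (P⁻¹ * Q)⁻¹ := by group
  apply le_antisymm
  · rw [planeDist, h]; exact planeLen_inv_le _
  · rw [planeDist, h']; exact planeLen_inv_le _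

theorem Close.take {K : ℕ} {w w' : Word} (h : Close K w w') (i : ℕ) (hi : i ≤ w.length) :
    ∃ i' ≤ w'.length, i' ≤ i + K ∧ i ≤ i' + K ∧
      planeDist (p (eval (w.take i))) (p (eval (w'.take i'))) ≤ K := by
  obtain ⟨u', hu', h1, h2, h3⟩ := h (w.take i) (List.take_prefix _ _)
  rw [List.length_take, min_eq_left hi] at h1 h2
  exact ⟨u'.length, hu'.length_le, by omega, by omega, by rwa [← List.prefix_iff_eq_take.1 hu']⟩

/-- Rounding the time down costs less than one edge, and the partner is a vertex: `24 + 1 = 25`. -/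
theorem Close.inNeighbourhood {w w' : Word} (h : Close 24 w w') : InNeighbourhood 25 w w' := by
  intro τ hτ
  have hσ : (0 : ℝ) ≤ min τ w.length := le_min hτ (Nat.cast_nonneg _)
  obtain ⟨i', hi', -, -, hd⟩ := h.take ⌊min τ w.length⌋₊ (Nat.floor_le_of_le (min_le_right _ _))
  refine ⟨i', Nat.cast_nonneg _, (graphDist_le _ _).trans ?_⟩
  have e : min (i' : ℝ) (w'.length : ℝ) = i' := min_eq_left (by exact_mod_cast hi')
  simp only [projPath, e, Nat.floor_natCast, Int.fract_natCast]
  have h1 := (Int.fract_lt_one (min τ (w.length : ℝ))).le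
  have h2 : ((planeDist (p (eval (w.take ⌊min τ (w.length : ℝ)⌋₊))) (p (eval (w'.take i'))) : ℕ) : ℝ)
      ≤ 24 := by exact_mod_cast hd
  linarith

/-- `24` for the partner, `24` for the shift in time, and one for each of the two fractional parts
of an edge. -/
theorem Close.fellowTravel {w w' : Word} (h : Close 24 w w') (hl : w.length = w'.length) :
    FellowTravel 50 w w' := by
  intro τ hτ
  refine (graphDist_le _ _).trans ?_
  simp only [projPath, ← hl]
  obtain ⟨i', hi', h1, h2, hd⟩ := h.take ⌊min τ w.length⌋₊ (Nat.floor_le_of_le (min_le_right _ _))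
  generalize ⌊min τ (w.length : ℝ)⌋₊ = i at *
  have h3 := (Int.fract_lt_one (min τ (w.length : ℝ))).le
  have h4 : planeDist (p (eval (w'.take i'))) (p (eval (w'.take i))) ≤ 24 := by
    rcases le_total i i' with hii | hii
    · rw [planeDist_comm]
      exact (planeDist_take_le w' hii).trans (by omega)
    · exact (planeDist_take_le w' hii).trans (by omega)
  have h5 := planeDist_triangle (p (eval (w.take i))) (p (eval (w'.take i'))) (p (eval (w'.take i)))
  have h6 : ((planeDist (p (eval (w.take i))) (p (eval (w'.take i))) : ℕ) : ℝ) ≤ 48 := by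
    exact_mod_cast (by omega : planeDist (p (eval (w.take i))) (p (eval (w'.take i))) ≤ 48)
  linarith

/-- There are standard geodesics for `g` and `h` that stay close to each other. -/
def StdClose (g h : N) : Prop :=
  ∃ w w' : Word, IsStandardGeodesic w g ∧ IsStandardGeodesic w' h ∧ Similar 24 w w'

theorem StdClose.symm {g h : N} (H : StdClose g h) : StdClose h g := by
  obtain ⟨w, w', hw, hw', hs⟩ := H
  exact ⟨w', w, hw', hw, hs.symm⟩

theorem StdClose.haveFellowTravellingGeodesics {g h : N} (H : StdClose g h) (hgh : len g = len h) :
    HaveFellowTravellingGeodesics g h := by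
  obtain ⟨w, w', hw, hw', hs⟩ := H
  refine ⟨w, w', hw, hw', hs.1.inNeighbourhood, hs.2.inNeighbourhood, hs.1.fellowTravel ?_⟩
  have h1 := hw.2.1; have h2 := hw'.2.1
  rw [IsGeodesic, hw.1] at h1
  rw [IsGeodesic, hw'.1] at h2
  omega

/-! ### Paths between two successive hexagons -/

theorem abs_dU_dV_le (d : Fin 6) : -1 ≤ dU d ∧ dU d ≤ 1 ∧ -1 ≤ dV d ∧ dV d ≤ 1 ∧
    -1 ≤ dU d + dV d ∧ dU d + dV d ≤ 1 := by
  fin_cases d <;> simp [dU, dV]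

/-- The push replaces `d'^a d^b d''^c` by `d'^(a+1) d^(b-1) d''^(c+1)`. Delaying the additional
letter `d'` until after `i` letters `d` lowers the area by `i`. The delayed word begins along the
old path and ends along the new one, so letting `i` vary gives all areas between the two. -/
theorem Quad.exists_interpolation {ε c₁ c₂ s : ℤ} {n : Quad} {j : Fin 4} (hε : ε = 0 ∨ ε = 1)
    (hn : n.Nonneg) (ht : (n.sides c₁ c₂).Nonneg) (hn' : (n.push j).Nonneg)
    (ht' : ((n.push j).sides c₁ c₂).Nonneg) (h₁ : n.area ε c₁ c₂ < 2 * s)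
    (h₂ : 2 * s ≤ (n.push j).area ε c₁ c₂) :
    ∃ (A B : List (Fin 6)) (d : Fin 6), A <+: n.path c₁ c₂ ∧ B <:+ (n.push j).path c₁ c₂ ∧
      posU (A ++ d :: B) = c₁ ∧ posV (A ++ d :: B) = c₂ ∧ NilHex.area ε (A ++ d :: B) = s ∧
      ((A ++ d :: B).length : ℤ) = c₁ + c₂ + n.sum + 1 ∧
      Tracks 1 (A ++ d :: B) (n.path c₁ c₂) := by
  have hp := area_push ε c₁ c₂ n j
  have hβ := two_mul_area_path ε hn' ht'
  have hU := posU_path hn' ht'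
  have hV := posV_path hn' ht'
  have hL := length_path hn' ht'
  rw [sum_push] at hL
  obtain ⟨d', d, d'', a, b, c, A, B, hd, hdU, hdV, hb, ha0, hc0, hb0, eα, eβ⟩ :=
    exists_decomp c₁ c₂ hn ht j
  have hb := hb ε hε
  obtain ⟨i, hi⟩ : ∃ i, i = NilHex.area ε ((n.push j).path c₁ c₂) - s := ⟨_, rfl⟩
  have hi0 : 0 ≤ i := by omega
  -- The areas of the two paths differ by the gain, which is at most `b`, and `s` lies strictly
  -- above the smaller area.
  have hib : i ≤ b - 1 := by omega
  have eα' : n.path c₁ c₂ = (A ++ run d' a ++ run d i) ++ (run d (b - i) ++ run d'' c ++ B) := by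
    rw [eα, show b = i + (b - i) by ring, run_add d hi0 (by omega)]
    simp
  have eβ' : (n.push j).path c₁ c₂ = (A ++ run d' a) ++
      (d' :: (run d i ++ (run d (b - 1 - i) ++ run d'' (c + 1) ++ B))) := by
    rw [eβ, run_add d' ha0 (by omega), show b - 1 = i + (b - 1 - i) by ring,
      run_add d hi0 (by omega), run_one]
    simp
  have e : (A ++ run d' a ++ run d i) ++ d' :: (run d (b - 1 - i) ++ run d'' (c + 1) ++ B) =
      (A ++ run d' a) ++ (run d i ++ d' :: (run d (b - 1 - i) ++ run d'' (c + 1) ++ B)) := by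
    simp
  refine ⟨A ++ run d' a ++ run d i, run d (b - 1 - i) ++ run d'' (c + 1) ++ B, d', ?_, ?_, ?_, ?_,
    ?_, ?_, ?_⟩
  · rw [eα']; exact List.prefix_append _ _
  · rw [eβ']; exact ⟨(A ++ run d' a) ++ d' :: run d i, by simp⟩
  · rw [e, posU_swap, ← eβ', hU]
  · rw [e, posV_swap, ← eβ', hV]
  · rw [e, area_swap _ _ _ _ hi0, ← eβ', hd, hi]; ring
  · rw [← add_assoc] at hL
    rw [← hL, eβ']
    simp only [List.length_append, List.length_cons]
    push_cast; ring
  · have q1 := abs_dU_dV_le d'; have q2 := abs_dU_dV_le d; have q3 := abs_dU_dV_le d''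
    have T0 := Tracks.refl (K := 1) (by omega) (A ++ run d' a ++ run d i)
    have z0 : (0 : ℤ) ≤ 0 := le_rfl
    have z1 : (0 : ℤ) ≤ 1 := by omega
    have z2 : 0 ≤ b - 1 - i := by omega
    have z3 : 0 ≤ b - i := by omega
    have z4 : 0 ≤ c + 1 := by omega
    have T1 := T0.append_run d' (m := 1) (m' := 0) (by omega) le_rfl (by
      constructor <;> simp only [posU_append, posV_append, List.length_append, Nat.cast_add,
        posU_run, posV_run, length_run, ha0, hi0, z0, z1] <;> linarith)
    have T2 := T1.append_run d (m := b - 1 - i) (m' := b - i) (by omega) (by omega) (by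
      constructor <;> simp only [posU_append, posV_append, List.length_append, Nat.cast_add,
        posU_run, posV_run, length_run, ha0, hi0, z0, z1, z2, z3] <;> linarith)
    have T3 := T2.append_run d'' (m := c + 1) (m' := c) (by omega) (by omega) (by
      constructor <;> simp only [posU_append, posV_append, List.length_append, Nat.cast_add,
        posU_run, posV_run, length_run, ha0, hi0, z0, z1, z2, z3, z4, hc0] <;> linarith)
    have T4 := T3.append_right B
    rw [eα']
    simpa [run_one] using T4

/-! ### The lengths of the elements over a point -/

theorem area_run_of_even (ε : ℤ) {i : Fin 6} (hi : i = 0 ∨ i = 1 ∨ i = 3 ∨ i = 4) (k : ℤ) :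
    area ε (run i k) = 0 := by
  have h := two_mul_area_replicate ε k.toNat i
  rcases hi with rfl | rfl | rfl | rfl <;> simp [dU, dV, dS] at h <;> exact h

/-- A path in a parallelogram that follows one side, crosses to the opposite side and follows it. -/
def parPath (i j e k l : ℤ) : List (Fin 6) := run 0 i ++ run 1 j ++ run 0 e ++ run 1 k ++ run 0 l

/-- Division of `-s` by `c₂`: the quotient is the length `l` of the last side, and a nonzero
remainder `j` is the height at which the sideways step `e = 1` is made. -/
theorem exists_parPath {c₁ c₂ s : ℤ} (h₁ : 0 ≤ c₁) (h₂ : 0 ≤ c₂) (hs : -(c₁ * c₂) ≤ s)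
    (hs0 : s ≤ 0) : ∃ i j e k l : ℤ, 0 ≤ i ∧ 0 ≤ j ∧ 0 ≤ e ∧ e ≤ 1 ∧ 0 ≤ k ∧ 0 ≤ l ∧
      i + e + l = c₁ ∧ j + k = c₂ ∧ s = -(l * c₂ + e * j) ∧ (e = 0 → k = 0) := by
  rcases h₂.eq_or_lt with rfl | h₂
  · exact ⟨c₁, 0, 0, 0, 0, by omega, le_rfl, le_rfl, by omega, le_rfl, le_rfl, by omega, by omega,
      by simp at hs; omega, by omega⟩
  have hd := Int.emod_add_mul_ediv (-s) c₂
  have hr := Int.emod_nonneg (-s) h₂.ne'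
  have hr' := Int.emod_lt_of_pos (-s) h₂
  have hl : 0 ≤ (-s) / c₂ := Int.ediv_nonneg (by omega) h₂.le
  generalize (-s) % c₂ = r at *
  generalize (-s) / c₂ = l at *
  rcases hr.eq_or_lt with rfl | hr
  · have : l ≤ c₁ := by nlinarith
    exact ⟨c₁ - l, c₂, 0, 0, l, by omega, by omega, le_rfl, by omega, le_rfl, hl, by omega,
      by omega, by linarith, by omega⟩
  · have : l < c₁ := by nlinarith
    exact ⟨c₁ - l - 1, r, 1, c₂ - r, l, by omega, by omega, by omega, by omega, by omega, hl,
      by omega, by omega, by linarith, by omega⟩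

theorem parPath_spec {i j e k l : ℤ} (hi : 0 ≤ i) (hj : 0 ≤ j) (he : 0 ≤ e) (hk : 0 ≤ k)
    (hl : 0 ≤ l) (ε : ℤ) : posU (parPath i j e k l) = i + e + l ∧
      posV (parPath i j e k l) = j + k ∧
      ((parPath i j e k l).length : ℤ) = i + e + l + (j + k) ∧
      area ε (parPath i j e k l) = -(l * (j + k) + e * j) := by
  refine ⟨?_, ?_, ?_, ?_⟩
  · simp only [parPath, posU_append, posU_run, *, dU]; ring
  · simp only [parPath, posV_append, posV_run, *, dV]; ring
  · simp only [parPath, List.length_append, Nat.cast_add, length_run, *]; ring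
  · simp only [parPath, area_append, posV_append, posU_run, posV_run, *, dU, dV,
      area_run_of_even ε (i := 0) (by simp), area_run_of_even ε (i := 1) (by simp)]
    ring

theorem len_pt_le_of_neg (f : Frame) {c₁ c₂ s : ℤ} (h₁ : 0 ≤ c₁) (h₂ : 0 ≤ c₂)
    (hs : -(c₁ * c₂) ≤ s) (hs0 : s ≤ 0) : (len (f.pt c₁ c₂ s) : ℤ) ≤ c₁ + c₂ := by
  obtain ⟨i, j, e, k, l, hi, hj, he, -, hk, hl, e1, e2, e3, -⟩ := exists_parPath h₁ h₂ hs hs0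
  obtain ⟨q1, q2, q3, q4⟩ := parPath_spec hi hj he hk hl f.eps
  have := (len_pt_le_iff f c₁ c₂ s (c₁ + c₂).toNat).2 ⟨parPath i j e k l, by omega, by omega,
    by omega, by rw [q4, e3, e2]⟩
  omega

/-- A closed loop of length `2 * q + 16 ≤ 28` with area `7 * q + r`, followed by a path of length
`c₁ + c₂` of area zero. It replaces hexagons when these are too small for `sides_nonneg`. -/
theorem len_pt_le_of_small (f : Frame) {c₁ c₂ s : ℤ} (h₁ : 0 ≤ c₁) (h₂ : 0 ≤ c₂)
    (hs : 0 ≤ s) (hs' : s ≤ 48) : (len (f.pt c₁ c₂ s) : ℤ) ≤ c₁ + c₂ + 28 := by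
  obtain ⟨q, r, hq, hr, hr', hq', rfl⟩ : ∃ q r : ℤ, 0 ≤ q ∧ 0 ≤ r ∧ r ≤ 7 ∧ q ≤ 6 ∧ s = 7 * q + r :=
    ⟨s / 7, s % 7, by omega, by omega, by omega, by omega, by omega⟩
  have z7 : 0 ≤ 7 - r := by omega
  have z1 : (0 : ℤ) ≤ 1 := by omega
  have z8 : (0 : ℤ) ≤ 7 := by omega
  have zq : 0 ≤ q + 1 := by omega
  have := (len_pt_le_iff f c₁ c₂ (7 * q + r) (c₁ + c₂ + 28).toNat).2 ⟨run 4 q ++ run 0 (7 - r) ++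
    run 4 1 ++ run 0 r ++ run 1 (q + 1) ++ run 3 7 ++ run 0 c₁ ++ run 1 c₂, by
      zify
      simp only [List.length_append, Nat.cast_add, length_run, *]
      omega, by
      simp only [posU_append, posU_run, *, dU]; ring, by
      simp only [posV_append, posV_run, *, dV]; ring, by
      simp only [area_append, posV_append, posU_run, posV_run, *, dU, dV,
        area_run_of_even f.eps (i := 0) (by simp), area_run_of_even f.eps (i := 1) (by simp),
        area_run_of_even f.eps (i := 3) (by simp), area_run_of_even f.eps (i := 4) (by simp)]
      ring⟩
  omega

/-- At the threshold of `sides_nonneg` the area exponent is at most `42`, within reach of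
`len_pt_le_of_small`. -/
theorem Quad.area_le_of_sum_le {ε c₁ c₂ : ℤ} {n : Quad} (hε : ε = 0 ∨ ε = 1) (hn : n.Nonneg)
    (h₁ : 0 ≤ c₁) (h₂ : 0 ≤ c₂) (hs : 2 * (c₁ + c₂) + n.sum = 12) : n.area ε c₁ c₂ ≤ 84 := by
  obtain ⟨p1, p2, p3, p4⟩ := hn
  obtain ⟨n1, n2, n3, n4⟩ := n
  simp only [area, hexArea, sum] at *
  obtain ⟨k, hk⟩ : ∃ k, k = n1 + n2 + n3 + n4 := ⟨_, rfl⟩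
  have e1 : c₁ * n2 ≤ c₁ * k := mul_le_mul_of_nonneg_left (by omega) h₁
  have e2 : c₂ * n3 ≤ c₂ * k := mul_le_mul_of_nonneg_left (by omega) h₂
  have e3 : 4 * ((n1 + n3) * (n2 + n4)) ≤ k ^ 2 := by rw [hk]; nlinarith [sq_nonneg (n1 + n3 - n2 - n4)]
  have e4 : 0 ≤ n1 * n4 := mul_nonneg p1 p4
  have e5 : (2 * ε - 1) * (n1 + n3) + (1 - 2 * ε) * (n2 + n4) ≤ k := by
    rcases hε with rfl | rfl <;> omega
  have e6 : k = 12 - 2 * (c₁ + c₂) := by omega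
  have e7 : (c₁ + c₂) * k + (c₁ + c₂) * (c₁ + c₂) * 2 = 12 * (c₁ + c₂) := by rw [e6]; ring
  have e8 : k ^ 2 = 144 - 48 * (c₁ + c₂) + 4 * ((c₁ + c₂) * (c₁ + c₂)) := by rw [e6]; ring
  nlinarith [sq_nonneg n1, sq_nonneg n2, sq_nonneg n3, sq_nonneg n4, mul_nonneg (add_nonneg h₁ h₂) (add_nonneg h₁ h₂)]

namespace IsOptimal

variable {f : Frame} {c₁ c₂ s : ℤ} {n t : Quad}

theorem le_area_of_len_le (h : IsOptimal f.eps c₁ c₂ n t) (h₁ : 0 ≤ c₁) (h₂ : 0 ≤ c₂)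
    (hl : (len (f.pt c₁ c₂ s) : ℤ) ≤ c₁ + c₂ + n.sum) : 2 * s ≤ n.area f.eps c₁ c₂ := by
  obtain ⟨W, e1, rfl, rfl, rfl⟩ := (len_pt_le_iff f c₁ c₂ s _).1 le_rfl
  obtain ⟨n₁, n₂, n₃, n₄, p1, p2, p3, p4, e5, e6⟩ := exists_hexArea_ge (ε := f.eps) W h₁ h₂
  exact e6.trans (h.area_mono h₁ h₂ (n' := ⟨n₁, n₂, n₃, n₄⟩) ⟨p1, p2, p3, p4⟩
    (by simp only [Quad.sum] at *; omega))

/-- Descent on `n.sum`: either `s` is already within reach of the optimal path shorter by one, or it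
lies between two consecutive optimal areas and interpolation applies. Below the threshold for
genuine paths, the second alternative comes from `c₁ + c₂ + 28 ≤ 34`. -/
theorem len_le_of_pos (h : IsOptimal f.eps c₁ c₂ n t) (h₁ : 0 ≤ c₁) (h₂ : 0 ≤ c₂) (hs : 0 < s)
    (hS : 2 * s ≤ n.area f.eps c₁ c₂) :
    (len (f.pt c₁ c₂ s) : ℤ) ≤ c₁ + c₂ + n.sum ∨ (len (f.pt c₁ c₂ s) : ℤ) ≤ 34 := by
  have hn0 := h.sum_nonneg
  obtain ⟨k, hk⟩ : ∃ k : ℕ, n.sum = k := ⟨n.sum.toNat, by omega⟩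
  induction k generalizing n t with
  | zero =>
    exfalso
    obtain ⟨p1, p2, p3, p4⟩ := h.nonneg
    obtain ⟨n1, n2, n3, n4⟩ := n
    simp only [Quad.sum] at hk p1 p2 p3 p4
    obtain ⟨rfl, rfl, rfl, rfl⟩ : n1 = 0 ∧ n2 = 0 ∧ n3 = 0 ∧ n4 = 0 := by omega
    simp [Quad.area, hexArea] at hS
    omega
  | succ k ih =>
    rcases le_or_gt (n.sum) (12 - 2 * (c₁ + c₂)) with hb | hb
    · right
      obtain ⟨m, t', h', hm⟩ := exists_isOptimal (ε := f.eps) f.eps_cases h₁ h₂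
        (12 - 2 * (c₁ + c₂)).toNat
      have := h'.area_mono h₁ h₂ h.nonneg (by omega)
      have := Quad.area_le_of_sum_le f.eps_cases h'.nonneg h₁ h₂ (by omega)
      have := len_pt_le_of_small f h₁ h₂ hs.le (by omega)
      omega
    obtain ⟨m, t', h', hm⟩ := exists_isOptimal (ε := f.eps) f.eps_cases h₁ h₂ k
    obtain ⟨j, t'', h'', -⟩ := h'.exists_push
    have hpush := Quad.sum_push m j
    have hle := h''.area_le_of_sum_eq h.nonneg (by omega)
    rcases le_or_gt (2 * s) (m.area f.eps c₁ c₂) with hlt | hlt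
    · rcases ih h' hlt h'.sum_nonneg hm with h4 | h4
      · left; omega
      · exact Or.inr h4
    · left
      obtain ⟨A, B, d, -, -, e1, e2, e3, e4, -⟩ := Quad.exists_interpolation f.eps_cases h'.nonneg
        (h'.sides_nonneg h₁ h₂ (by omega)) h''.nonneg (h''.sides_nonneg h₁ h₂ (by omega)) hlt
        (hS.trans hle)
      have := (len_pt_le_iff f c₁ c₂ s (c₁ + c₂ + n.sum).toNat).2
        ⟨A ++ d :: B, by omega, e1, e2, e3⟩
      omega

/-- The elements over `(c₁, c₂)` of length at most `c₁ + c₂ + n.sum` form an interval. -/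
theorem len_le (h : IsOptimal f.eps c₁ c₂ n t) (h₁ : 0 ≤ c₁) (h₂ : 0 ≤ c₂)
    (hl : 34 ≤ c₁ + c₂ + n.sum) (hs : -(c₁ * c₂) ≤ s) (hS : 2 * s ≤ n.area f.eps c₁ c₂) :
    (len (f.pt c₁ c₂ s) : ℤ) ≤ c₁ + c₂ + n.sum := by
  rcases le_or_gt s 0 with h0 | h0
  · have := len_pt_le_of_neg f h₁ h₂ hs h0
    have := h.sum_nonneg
    omega
  · rcases h.len_le_of_pos h₁ h₂ h0 hS with h | h <;> omega

end IsOptimal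

/-! ### Extremal paths -/

theorem Frame.pt_mul_Z_zpow (f : Frame) (a b s k : ℤ) : f.pt a b s * f.Z ^ k = f.pt a b (s + k) := by
  rw [Frame.pt, Frame.pt, mul_assoc, ← zpow_add]

/-- The exponent in the frame and the one in `x ^ a * y ^ b * z ^ s` differ by a constant on each
fibre, and by a sign if the frame is negatively oriented. So a maximum in the frame is either the
largest or the smallest exponent of the fibre. -/
theorem isExtremal_pt (f : Frame) {a b s : ℤ} (s₀ : ℤ) {m : ℕ} (hm : len (f.pt a b s) ≤ m)
    (hmax : ∀ s', len (f.pt a b s') ≤ m → s' ≤ s) :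
    IsExtremal (p (f.pt a b s₀)) m (f.pt a b s) := by
  obtain ⟨a', b', t, ht⟩ := exists_normalForm (f.pt a b s)
  have hP : p (f.pt a b s₀) = Multiplicative.ofAdd (a', b') := by
    rw [show p (f.pt a b s₀) = p (f.pt a b s) by rw [p_pt, p_pt], ht, p_eq, toHeis_normalForm]
  have hP1 : fstCoord (p (f.pt a b s₀)) = a' := by rw [hP]; rfl
  have hP2 : sndCoord (p (f.pt a b s₀)) = b' := by rw [hP]; rfl
  have hz : ∀ τ : ℤ, x ^ a' * y ^ b' * z ^ τ = f.pt a b s * z ^ (τ - t) := by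
    intro τ
    rw [ht, mul_assoc _ (z ^ t), ← zpow_add]
    congr 2; ring
  refine ⟨t, by rw [hP1, hP2, ht], ?_⟩
  have hmem : t ∈ fibreBall (p (f.pt a b s₀)) m := by
    rw [fibreBall, Set.mem_ofPred_eq, hP1, hP2, ← ht]; exact hm
  cases hpos : f.pos
  · have hZ : f.Z = z⁻¹ := by simp [Frame.Z, hpos]
    refine Or.inr ⟨hmem, fun τ hτ => ?_⟩
    rw [fibreBall, Set.mem_ofPred_eq, hP1, hP2, hz,
      show z ^ (τ - t) = f.Z ^ (t - τ) by rw [hZ, inv_zpow', neg_sub], f.pt_mul_Z_zpow] at hτ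
    have := hmax _ hτ
    omega
  · have hZ : f.Z = z := by simp [Frame.Z, hpos]
    refine Or.inl ⟨hmem, fun τ hτ => ?_⟩
    rw [fibreBall, Set.mem_ofPred_eq, hP1, hP2, hz, ← hZ, f.pt_mul_Z_zpow] at hτ
    have := hmax _ hτ
    omega

theorem suffix_runs {i j k : Fin 6} {a b c a' b' c' : ℤ} (ha : 0 ≤ a) (hb : 0 ≤ b) (hc : 0 ≤ c)
    (ha' : a ≤ a') (hb' : b ≤ b') (hc' : c ≤ c') (hab : 0 < a → b = b') (hbc : 0 < b → c = c')
    (hac : 0 < a → c = c') :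
    run i a ++ run j b ++ run k c <:+ run i a' ++ run j b' ++ run k c' := by
  rcases ha.eq_or_lt with rfl | h
  · rcases hb.eq_or_lt with rfl | h
    · refine ⟨run i a' ++ run j b' ++ run k (c' - c), ?_⟩
      rw [show c' = c' - c + c by ring, run_add k (by omega) hc]
      simp
    · rw [← hbc h]
      refine ⟨run i a' ++ run j (b' - b), ?_⟩
      conv_rhs => rw [show b' = b' - b + b by ring, run_add j (by omega) hb]
      simp
  · rw [← hab h, ← hac h]
    refine ⟨run i (a' - a), ?_⟩
    conv_rhs => rw [show a' = a' - a + a by ring, run_add i (by omega) ha]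
    simp

theorem prefix_runs {i j k : Fin 6} {a b c a' b' c' : ℤ} (ha : 0 ≤ a) (hb : 0 ≤ b) (hc : 0 ≤ c)
    (ha' : a ≤ a') (hb' : b ≤ b') (hc' : c ≤ c') (hcb : 0 < c → b = b') (hba : 0 < b → a = a')
    (hca : 0 < c → a = a') :
    run i a ++ run j b ++ run k c <+: run i a' ++ run j b' ++ run k c' := by
  rcases hc.eq_or_lt with rfl | h
  · rcases hb.eq_or_lt with rfl | h
    · refine ⟨run i (a' - a) ++ run j b' ++ run k c', ?_⟩
      conv_rhs => rw [show a' = a + (a' - a) by ring, run_add i ha (by omega)]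
      simp
    · rw [← hba h]
      refine ⟨run j (b' - b) ++ run k c', ?_⟩
      conv_rhs => rw [show b' = b + (b' - b) by ring, run_add j hb (by omega)]
      simp
  · rw [← hcb h, ← hca h]
    refine ⟨run k (c' - c), ?_⟩
    conv_rhs => rw [show c' = c + (c' - c) by ring, run_add k hc (by omega)]
    simp

theorem map_run (f : Frame) (i : Fin 6) (k : ℤ) :
    (run i k).map f.letter = List.replicate k.toNat (f.letter i) := by
  rw [run, List.map_replicate]

theorem hexWord_letter (f : Frame) (s : Fin 6 → ℕ) :
    hexWord f.turn (f.letter 4) s = List.replicate (s 0) (f.letter 4) ++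
      List.replicate (s 1) (f.letter 5) ++ List.replicate (s 2) (f.letter 0) ++
      List.replicate (s 3) (f.letter 1) ++ List.replicate (s 4) (f.letter 2) ++
      List.replicate (s 5) (f.letter 3) := by
  obtain ⟨u, pos⟩ := f
  have h2 : (⟨u, pos⟩ : Frame).turn^[2] (Frame.letter ⟨u, pos⟩ 4) = Frame.letter ⟨u, pos⟩ 0 := by
    cases u <;> cases pos <;> rfl
  have h3 : (⟨u, pos⟩ : Frame).turn^[3] (Frame.letter ⟨u, pos⟩ 4) = Frame.letter ⟨u, pos⟩ 1 := by
    cases u <;> cases pos <;> rfl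
  have h4 : (⟨u, pos⟩ : Frame).turn^[4] (Frame.letter ⟨u, pos⟩ 4) = Frame.letter ⟨u, pos⟩ 2 := by
    cases u <;> cases pos <;> rfl
  have h5 : (⟨u, pos⟩ : Frame).turn^[5] (Frame.letter ⟨u, pos⟩ 4) = Frame.letter ⟨u, pos⟩ 3 := by
    cases u <;> cases pos <;> rfl
  have h1 : (⟨u, pos⟩ : Frame).turn^[1] (Frame.letter ⟨u, pos⟩ 4) = Frame.letter ⟨u, pos⟩ 5 := by
    cases u <;> cases pos <;> rfl
  have e : List.finRange 6 = [0, 1, 2, 3, 4, 5] := by decide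
  simp only [hexWord, e, List.flatMap_cons, List.flatMap_nil, List.append_nil, List.append_assoc]
  exact congrArg₂ _ rfl (congrArg₂ _ (by rw [← h1]; rfl) (congrArg₂ _ (by rw [← h2]; rfl)
    (congrArg₂ _ (by rw [← h3]; rfl) (congrArg₂ _ (by rw [← h4]; rfl) (by rw [← h5]; rfl)))))

theorem turn_eq (f : Frame) : f.turn = Letter.next ∨ f.turn = Letter.prev := by
  obtain ⟨u, pos⟩ := f
  cases pos
  · exact Or.inr rfl
  · exact Or.inl rfl

/-- The sides of the hexagon that is completed from four consecutive sides. -/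
theorem Quad.Balanced.sides_close {ε : ℤ} {t : Quad} (h : t.Balanced ε) :
    ∃ b : ℤ, (b ≤ t.e₁ ∧ t.e₁ ≤ b + 2) ∧ (b ≤ t.e₂ ∧ t.e₂ ≤ b + 2) ∧ (b ≤ t.e₃ ∧ t.e₃ ≤ b + 2) ∧
      (b ≤ t.e₄ ∧ t.e₄ ≤ b + 2) ∧ (b ≤ t.e₃ + t.e₄ - t.e₁ ∧ t.e₃ + t.e₄ - t.e₁ ≤ b + 2) ∧
      (b ≤ t.e₁ + t.e₂ - t.e₄ ∧ t.e₁ + t.e₂ - t.e₄ ≤ b + 2) := by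
  obtain ⟨t1, t2, t3, t4⟩ := t
  simp only [Balanced] at h ⊢
  refine ⟨min (min t1 t2) (min (min t3 t4) (min (t3 + t4 - t1) (t1 + t2 - t4))), ?_⟩
  omega

namespace IsOptimal

variable {f : Frame} {c₁ c₂ s : ℤ} {n t : Quad}

/-- The four sides `t` close up with `t.e₃ + t.e₄ - t.e₁` and `t.e₁ + t.e₂ - t.e₄` to an almost
regular hexagon. By complementary slackness the first three runs of the path form a final segment of
three sides, and the last three an initial segment of the other three. -/
theorem isHexagonSubpath (h : IsOptimal f.eps c₁ c₂ n t) (h₁ : 0 ≤ c₁) (h₂ : 0 ≤ c₂)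
    (hl : 34 ≤ c₁ + c₂ + n.sum) : IsHexagonSubpath ((n.path c₁ c₂).map f.letter) := by
  have h6 := h.le_six_mul
  have hn := h.nonneg
  have ht := h.sides_nonneg h₁ h₂ (by omega)
  obtain ⟨b, b1, b2, b3, b4, b5, b6⟩ := h.balanced.sides_close
  have q1 : 0 ≤ t.e₁ := by omega
  have q2 : 0 ≤ t.e₂ := by omega
  have q3 : 0 ≤ t.e₃ := by omega
  have q4 : 0 ≤ t.e₄ := by omega
  have q5 : 0 ≤ t.e₃ + t.e₄ - t.e₁ := by omega
  have q6 : 0 ≤ t.e₁ + t.e₂ - t.e₄ := by omega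
  obtain ⟨H, hH⟩ : ∃ H, H = run 4 (t.e₃ + t.e₄ - t.e₁) ++ run 5 t.e₁ ++ run 0 t.e₂ ++ run 1 t.e₃ ++
    run 2 t.e₄ ++ run 3 (t.e₁ + t.e₂ - t.e₄) := ⟨_, rfl⟩
  have hspec := six_runs q5 q1 q2 q3 q4 q6 f.eps H hH
  have hinf : n.path c₁ c₂ <:+: H := by
    have l1 := h.le₁; have l2 := h.le₂; have l3 := h.le₃; have l4 := h.le₄
    have e1 := h.eq₁; have e2 := h.eq₂; have e3 := h.eq₃; have e4 := h.eq₄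
    obtain ⟨p1, p2, p3, p4⟩ := hn
    obtain ⟨p5, p6, p7, p8⟩ := ht
    have hX := suffix_runs (i := 4) (j := 5) (k := 0) (a := n.e₁) (a' := t.e₃ + t.e₄ - t.e₁)
      (b' := t.e₁) (c' := t.e₂) p1 p5 p6 (by simp only [Quad.sides] at *; omega) l1 l2
      (by simp only [Quad.sides] at *; omega) (by simp only [Quad.sides] at *; omega)
      (by simp only [Quad.sides] at *; omega)
    have hY := prefix_runs (i := 1) (j := 2) (k := 3) (c := n.e₄) (a' := t.e₃) (b' := t.e₄)
      (c' := t.e₁ + t.e₂ - t.e₄) p7 p8 p4 l3 l4 (by simp only [Quad.sides] at *; omega)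
      (by simp only [Quad.sides] at *; omega) (by simp only [Quad.sides] at *; omega)
      (by simp only [Quad.sides] at *; omega)
    obtain ⟨X, hX⟩ := hX
    obtain ⟨Y, hY⟩ := hY
    refine ⟨X, Y, ?_⟩
    rw [hH]
    simp only [List.append_assoc] at hX hY ⊢
    rw [← hY]
    simp only [← List.append_assoc] at hX ⊢
    rw [← hX]
    simp [Quad.path]
  refine ⟨H.map f.letter, ⟨f.turn, f.letter 4, ![(t.e₃ + t.e₄ - t.e₁).toNat, t.e₁.toNat, t.e₂.toNat,
    t.e₃.toNat, t.e₄.toNat, (t.e₁ + t.e₂ - t.e₄).toNat], turn_eq f, ?_, ?_, ?_⟩, ?_, ?_⟩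
  · have key : ∀ i : Fin 6, b ≤ (![(t.e₃ + t.e₄ - t.e₁).toNat, t.e₁.toNat, t.e₂.toNat,
        t.e₃.toNat, t.e₄.toNat, (t.e₁ + t.e₂ - t.e₄).toNat] i : ℤ) ∧
        (![(t.e₃ + t.e₄ - t.e₁).toNat, t.e₁.toNat, t.e₂.toNat,
        t.e₃.toNat, t.e₄.toNat, (t.e₁ + t.e₂ - t.e₄).toNat] i : ℤ) ≤ b + 2 := by
      intro i
      fin_cases i <;> simp [-Int.ofNat_toNat] <;> omega
    intro i j
    have := key i; have := key j
    omega
  · rw [hexWord_letter, hH]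
    simp only [List.map_append, map_run]
    rfl
  · rw [f.eval_map, p_pt, hspec.2.1, hspec.2.2.1]
    simp only [dU, dV]
    rw [← ofAdd_zero]
    congr 1
    ring_nf
  · exact (hinf.map _).trans (List.prefix_append _ _).isInfix
  · simpa using hinf.length_le

end IsOptimal

/-! ### Standard geodesics -/

theorem planeLen_le_len (g : N) : planeLen (p g) ≤ len g := by
  obtain ⟨w, h1, h2⟩ := exists_word g
  rw [← h1]
  exact planeLen_le (by rw [h2])

theorem add_le_len_pt (f : Frame) {c₁ c₂ : ℤ} (s : ℤ) (h₁ : 0 ≤ c₁) (h₂ : 0 ≤ c₂) :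
    c₁ + c₂ ≤ len (f.pt c₁ c₂ s) := by
  rw [← planeLen_pt f s h₁ h₂]
  exact_mod_cast planeLen_le_len _

namespace IsOptimal

variable {f : Frame} {c₁ c₂ s : ℤ} {n t : Quad}

theorem eval_path (h : IsOptimal f.eps c₁ c₂ n t) (h₁ : 0 ≤ c₁) (h₂ : 0 ≤ c₂)
    (hl : 34 ≤ c₁ + c₂ + n.sum) : ∃ S : ℤ, 2 * S = n.area f.eps c₁ c₂ ∧
      eval ((n.path c₁ c₂).map f.letter) = f.pt c₁ c₂ S := by
  have ht := h.sides_nonneg h₁ h₂ (by omega)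
  refine ⟨_, Quad.two_mul_area_path f.eps h.nonneg ht, ?_⟩
  rw [f.eval_map, Quad.posU_path h.nonneg ht, Quad.posV_path h.nonneg ht]

/-- From the previous length to this one the optimal area grows strictly, since at this size the
gain in `exists_push` is positive. A shorter word therefore cannot reach the maximal area. -/
theorem len_eq_of_two_mul_eq (h : IsOptimal f.eps c₁ c₂ n t) (h₁ : 0 ≤ c₁) (h₂ : 0 ≤ c₂)
    (hl : 34 ≤ c₁ + c₂ + n.sum) (hs : 2 * s = n.area f.eps c₁ c₂) :
    (len (f.pt c₁ c₂ s) : ℤ) = c₁ + c₂ + n.sum := by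
  have h0 := h.sum_nonneg
  apply le_antisymm
  · refine h.len_le h₁ h₂ hl ?_ hs.le
    have := h.area_mono h₁ h₂ (n' := ⟨0, 0, 0, 0⟩) ⟨le_rfl, le_rfl, le_rfl, le_rfl⟩
      (by simpa [Quad.sum] using h0)
    have h3 : (⟨0, 0, 0, 0⟩ : Quad).area f.eps c₁ c₂ = 0 := by simp [Quad.area, hexArea]
    have := mul_nonneg h₁ h₂
    omega
  · by_contra hlt
    push Not at hlt
    have hL := add_le_len_pt f s h₁ h₂
    obtain ⟨n', t', h', hk⟩ := exists_isOptimal (ε := f.eps) f.eps_cases h₁ h₂ (n.sum - 1).toNat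
    obtain ⟨j, t'', h'', hg⟩ := h'.exists_push
    have e1 := Quad.area_push f.eps c₁ c₂ n' j
    have e2 := Quad.sum_push n' j
    have e3 := h.area_le_of_sum_eq h''.nonneg (by omega)
    have e4 := h'.le_area_of_len_le h₁ h₂ (s := s) (by omega)
    omega

theorem isExtremalPath (h : IsOptimal f.eps c₁ c₂ n t) (h₁ : 0 ≤ c₁) (h₂ : 0 ≤ c₂)
    (hl : 34 ≤ c₁ + c₂ + n.sum) (s₀ : ℤ) {m : ℕ} (hm : (m : ℤ) = c₁ + c₂ + n.sum) :
    IsExtremalPath (p (f.pt c₁ c₂ s₀)) m ((n.path c₁ c₂).map f.letter) := by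
  obtain ⟨S, hS, he⟩ := h.eval_path h₁ h₂ hl
  have hlen := h.len_eq_of_two_mul_eq h₁ h₂ hl hS
  refine ⟨?_, ?_, h.isHexagonSubpath h₁ h₂ hl⟩
  · rw [IsGeodesic, he, List.length_map]
    have := Quad.length_path h.nonneg (h.sides_nonneg h₁ h₂ (by omega))
    omega
  · rw [he]
    refine isExtremal_pt f s₀ (by omega) fun s' hs' => ?_
    have := h.le_area_of_len_le h₁ h₂ (s := s') (by omega)
    omega

/-- An element that is longer than its projection has a standard geodesic near any optimal path of
the next smaller length. -/
theorem exists_isStandardGeodesic (h : IsOptimal f.eps c₁ c₂ n t) (h₁ : 0 ≤ c₁) (h₂ : 0 ≤ c₂)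
    (hl : 34 ≤ c₁ + c₂ + n.sum) (hs : 0 < s)
    (hlen : (len (f.pt c₁ c₂ s) : ℤ) = c₁ + c₂ + n.sum + 1) :
    ∃ w, IsStandardGeodesic w (f.pt c₁ c₂ s) ∧ Similar 1 w ((n.path c₁ c₂).map f.letter) := by
  have h0 := h.sum_nonneg
  obtain ⟨j, t', h', -⟩ := h.exists_push
  have e1 := Quad.sum_push n j
  have hlt : n.area f.eps c₁ c₂ < 2 * s := by
    by_contra hle
    have := mul_nonneg h₁ h₂
    have := h.len_le h₁ h₂ hl (s := s) (by omega) (by omega)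
    omega
  have hle := h'.le_area_of_len_le h₁ h₂ (s := s) (by omega)
  obtain ⟨A, B, d, hA, hB, e2, e3, e4, e5, hT⟩ := Quad.exists_interpolation f.eps_cases h.nonneg
    (h.sides_nonneg h₁ h₂ (by omega)) h'.nonneg (h'.sides_nonneg h₁ h₂ (by omega)) hlt hle
  have he : eval ((A ++ d :: B).map f.letter) = f.pt c₁ c₂ s := by rw [f.eval_map, e2, e3, e4]
  have hm : ∃ m : ℕ, (m : ℤ) = c₁ + c₂ + n.sum := ⟨(c₁ + c₂ + n.sum).toNat, by omega⟩
  obtain ⟨m, hm⟩ := hm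
  refine ⟨(A ++ d :: B).map f.letter, ⟨he, ?_, Or.inr ⟨m, by omega, ?_, ?_⟩⟩, hT.similar f⟩
  · rw [IsGeodesic, he, List.length_map]; omega
  · have := planeLen_pt f s h₁ h₂
    omega
  · refine ⟨_, _, A.map f.letter, B.map f.letter, f.letter d, h.isExtremalPath h₁ h₂ hl s hm,
      h'.isExtremalPath h₁ h₂ (by omega) s (m := m + 1) (by omega), hA.map _, hB.map _, by simp⟩

end IsOptimal

theorem isStandardGeodesic_parPath (f : Frame) {c₁ c₂ s i j e k l : ℤ} (hi : 0 ≤ i) (hj : 0 ≤ j)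
    (he : 0 ≤ e) (he' : e ≤ 1) (hk : 0 ≤ k) (hl : 0 ≤ l) (e₁ : i + e + l = c₁) (e₂ : j + k = c₂)
    (e₃ : s = -(l * c₂ + e * j)) :
    IsStandardGeodesic ((parPath i j e k l).map f.letter) (f.pt c₁ c₂ s) := by
  have hp := parPath_spec hi hj he hk hl f.eps
  have heval : eval ((parPath i j e k l).map f.letter) = f.pt c₁ c₂ s := by
    rw [f.eval_map, hp.1, hp.2.1, hp.2.2.2, e₁, e₂, e₃]
  have h₁ : 0 ≤ c₁ := by omega
  have h₂ : 0 ≤ c₂ := by omega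
  have hL := add_le_len_pt f s h₁ h₂
  have hlen := len_le heval
  rw [List.length_map] at hlen
  have hP := planeLen_pt f s h₁ h₂
  refine ⟨heval, ?_, Or.inl ⟨by omega, f.letter 0, f.letter 1, i.toNat, j.toNat, e.toNat, k.toNat,
    l.toNat, ?_, by omega, ?_⟩⟩
  · rw [IsGeodesic, heval, List.length_map]; omega
  · exact (turn_eq f).imp (fun h => by rw [← h]; rfl) (fun h => by rw [← h]; rfl)
  · simp only [parPath, List.map_append, map_run]

/-- The frame with the first two directions exchanged. -/
def Frame.flip (f : Frame) : Frame := ⟨f.letter 1, !f.pos⟩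

theorem Frame.flip_letter (f : Frame) (i : Fin 6) : f.flip.letter i = f.letter (1 - i) := by
  obtain ⟨u, pos⟩ := f
  cases u <;> cases pos <;> fin_cases i <;> rfl

theorem Frame.flip_Z (f : Frame) : f.flip.Z = f.Z⁻¹ := by
  obtain ⟨u, pos⟩ := f
  cases pos <;> simp [Frame.flip, Frame.Z]

/-- The reflection `s ↦ -s - a * b` preserves the interval of elements that are as short as their
projection and exchanges the two outer ranges. -/
theorem Frame.flip_pt (f : Frame) (a b s : ℤ) : f.flip.pt a b s = f.pt b a (-s - a * b) := by
  have h : f.flip.pt a b s = f.pt 0 a 0 * f.pt b 0 0 * f.pt 0 0 (-s) := by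
    simp [Frame.pt, Frame.flip_Z, Frame.U, Frame.V, Frame.flip_letter]
  rw [h, f.pt_mul, f.pt_mul]
  congr 1 <;> ring

theorem map_flip_letter (f : Frame) (W : List (Fin 6)) :
    W.map f.flip.letter = (W.map (1 - ·)).map f.letter := by
  rw [List.map_map]
  exact List.map_congr_left fun i _ => f.flip_letter i

/-- The fibre of the elements that are as short as their projection. -/
theorem len_pt_eq_iff (f : Frame) {c₁ c₂ : ℤ} (s : ℤ) (h₁ : 0 ≤ c₁) (h₂ : 0 ≤ c₂) :
    (len (f.pt c₁ c₂ s) : ℤ) = c₁ + c₂ ↔ -(c₁ * c₂) ≤ s ∧ s ≤ 0 := by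
  have key : ∀ (f : Frame) {c₁ c₂ : ℤ} (s : ℤ), 0 ≤ c₁ → 0 ≤ c₂ →
      (len (f.pt c₁ c₂ s) : ℤ) = c₁ + c₂ → s ≤ 0 := by
    intro f c₁ c₂ s h₁ h₂ h
    obtain ⟨n, t, hn, hs⟩ := exists_isOptimal (ε := f.eps) f.eps_cases h₁ h₂ 0
    have := hn.le_area_of_len_le h₁ h₂ (s := s) (by omega)
    obtain ⟨p1, p2, p3, p4⟩ := hn.nonneg
    obtain ⟨n1, n2, n3, n4⟩ := n
    simp only [Quad.sum] at hs p1 p2 p3 p4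
    obtain ⟨rfl, rfl, rfl, rfl⟩ : n1 = 0 ∧ n2 = 0 ∧ n3 = 0 ∧ n4 = 0 := by omega
    simp [Quad.area, hexArea] at this
    omega
  constructor
  · intro h
    refine ⟨?_, key f s h₁ h₂ h⟩
    have := key f.flip (-s - c₁ * c₂) h₂ h₁ (by
      rw [f.flip_pt, show -(-s - c₁ * c₂) - c₂ * c₁ = s by ring, h]; ring)
    omega
  · rintro ⟨h, h'⟩
    exact le_antisymm (len_pt_le_of_neg f h₁ h₂ h h') (add_le_len_pt f s h₁ h₂)

/-! ### Neighbouring elements over a common sector -/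

theorem dist_le_iff {g h : N} {k : ℕ} : dist g h ≤ k ↔ ∃ r : Word, r.length ≤ k ∧ h = g * eval r := by
  constructor
  · intro hd
    obtain ⟨w, h1, h2⟩ := exists_word (g⁻¹ * h)
    exact ⟨w, by rw [h1]; exact hd, by rw [h2]; group⟩
  · rintro ⟨r, hr, rfl⟩
    exact (len_le (by group)).trans hr

theorem dist_le_symm {g h : N} {k : ℕ} (hd : dist g h ≤ k) : dist h g ≤ k := by
  obtain ⟨r, hr, rfl⟩ := dist_le_iff.1 hd
  obtain ⟨r', e1, e2⟩ := exists_inv_word r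
  exact dist_le_iff.2 ⟨r', by omega, by rw [e2]; group⟩

theorem dS_bounds {ε : ℤ} (hε : ε = 0 ∨ ε = 1) (d : Fin 6) : 0 ≤ dS ε d ∧ dS ε d ≤ 1 := by
  rcases hε with rfl | rfl <;> fin_cases d <;> simp [dS]

theorem coord_bounds (f : Frame) {c₁ c₂ s c₁' c₂' s' : ℤ}
    (h : dist (f.pt c₁ c₂ s) (f.pt c₁' c₂' s') ≤ 2) :
    (-2 ≤ c₁' - c₁ ∧ c₁' - c₁ ≤ 2 ∧ -2 ≤ c₂' - c₂ ∧ c₂' - c₂ ≤ 2 ∧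
      -2 ≤ (c₁' - c₁) + (c₂' - c₂) ∧ (c₁' - c₁) + (c₂' - c₂) ≤ 2) ∧
      ∃ a, -1 ≤ a ∧ a ≤ 3 ∧ s' = s + a - c₂ * (c₁' - c₁) := by
  obtain ⟨r, hr, he⟩ := dist_le_iff.1 h
  obtain ⟨R, rfl⟩ := exists_map_letter f r
  rw [f.eval_map, f.pt_mul] at he
  obtain ⟨rfl, rfl, rfl⟩ := pt_injective f he
  rw [List.length_map] at hr
  simp only [add_sub_cancel_left]
  match R, hr with
  | [], _ => simp
  | [i], _ =>
    have h1 := abs_dU_dV_le i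
    have h2 := dS_bounds f.eps_cases i
    simp only [posU_cons, posV_cons, posU_nil, posV_nil, area_cons, area_nil, add_zero, mul_zero,
      sub_zero]
    exact ⟨by omega, dS f.eps i, by omega, by omega, rfl⟩
  | [i, j], _ =>
    have h1 := abs_dU_dV_le i
    have h1' := abs_dU_dV_le j
    have h2 := dS_bounds f.eps_cases i
    have h2' := dS_bounds f.eps_cases j
    have h3 : -1 ≤ dV i * dU j ∧ dV i * dU j ≤ 1 := by
      constructor <;> nlinarith
    simp only [posU_cons, posV_cons, posU_nil, posV_nil, area_cons, area_nil, add_zero, mul_zero,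
      sub_zero]
    -- Each `dS` is `0` or `1` and the product lies between `-1` and `1`, hence the asymmetric range
    -- from `-1` to `3`.
    exact ⟨by omega, dS f.eps i + dS f.eps j - dV i * dU j, by omega, by omega, by ring⟩

theorem IsOptimal.exists_raise {ε c₁ c₂ : ℤ} {n t : Quad} (h : IsOptimal ε c₁ c₂ n t) (k : ℕ) :
    ∃ n' t', IsOptimal ε c₁ c₂ n' t' ∧ n'.sum = n.sum + k ∧
      (n.e₁ ≤ n'.e₁ ∧ n'.e₁ ≤ n.e₁ + k) ∧ (n.e₂ ≤ n'.e₂ ∧ n'.e₂ ≤ n.e₂ + k) ∧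
      (n.e₃ ≤ n'.e₃ ∧ n'.e₃ ≤ n.e₃ + k) ∧ (n.e₄ ≤ n'.e₄ ∧ n'.e₄ ≤ n.e₄ + k) := by
  induction k with
  | zero => exact ⟨n, t, h, by simp, by simp, by simp, by simp, by simp⟩
  | succ k ih =>
    obtain ⟨n', t', h', e, b1, b2, b3, b4⟩ := ih
    obtain ⟨j, t'', h'', -⟩ := h'.exists_push
    have hs := Quad.sum_push n' j
    refine ⟨_, t'', h'', by push_cast; omega, ?_⟩
    push_cast
    fin_cases j <;> simp only [Quad.push] <;> omega

/-- `sub_bounds` compares paths with equal sums. Raising the smaller sum by at most two changes each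
offset by at most two. -/
theorem IsOptimal.sub_bounds_of_sum_le {ε c₁ c₂ c₁' c₂' : ℤ} {n t n' t' : Quad}
    (h : IsOptimal ε c₁ c₂ n t) (h' : IsOptimal ε c₁' c₂' n' t') (hs : n.sum ≤ n'.sum)
    (hs' : n'.sum ≤ n.sum + 2) (hc₁ : |c₁' - c₁| ≤ 2) (hc₂ : |c₂' - c₂| ≤ 2) :
    |n'.e₁ - n.e₁| ≤ 8 ∧ |n'.e₂ - n.e₂| ≤ 6 ∧ |n'.e₃ - n.e₃| ≤ 6 ∧ |n'.e₄ - n.e₄| ≤ 8 := by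
  obtain ⟨m, u, hm, e, b1, b2, b3, b4⟩ := h.exists_raise (n'.sum - n.sum).toNat
  have := hm.sub_bounds h' (by omega) hc₁ hc₂
  simp only [abs_le] at *
  omega

theorem Quad.tracks_path {c₁ c₂ c₁' c₂' : ℤ} {n n' : Quad} (hn : n.Nonneg)
    (ht : (n.sides c₁ c₂).Nonneg) (hn' : n'.Nonneg) (ht' : (n'.sides c₁' c₂').Nonneg)
    (hc : -2 ≤ c₁' - c₁ ∧ c₁' - c₁ ≤ 2 ∧ -2 ≤ c₂' - c₂ ∧ c₂' - c₂ ≤ 2 ∧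
      -2 ≤ (c₁' - c₁) + (c₂' - c₂) ∧ (c₁' - c₁) + (c₂' - c₂) ≤ 2)
    (hl : -1 ≤ c₁' + c₂' + n'.sum - (c₁ + c₂ + n.sum) ∧
      c₁' + c₂' + n'.sum - (c₁ + c₂ + n.sum) ≤ 1)
    (hb : |n'.e₁ - n.e₁| ≤ 8 ∧ |n'.e₂ - n.e₂| ≤ 6 ∧ |n'.e₃ - n.e₃| ≤ 6 ∧ |n'.e₄ - n.e₄| ≤ 8) :
    Tracks 18 (n.path c₁ c₂) (n'.path c₁' c₂') := by
  obtain ⟨p1, p2, p3, p4⟩ := hn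
  obtain ⟨p1', p2', p3', p4'⟩ := hn'
  obtain ⟨q1, q2, q3, q4⟩ := ht
  obtain ⟨q1', q2', q3', q4'⟩ := ht'
  simp only [abs_le] at hb
  simp only [path]
  simp only [sides] at *
  simp only [Quad.sum] at hl
  refine ((((((Tracks.nil (by omega)).append_run 4 p1 p1' ?_).append_run 5 q1 q1' ?_).append_run 0
    q2 q2' ?_).append_run 1 q3 q3' ?_).append_run 2 q4 q4' ?_).append_run 3 p4 p4' ?_ <;>
  · constructor <;>
      simp only [List.nil_append, posU_append, posV_append, List.length_append, Nat.cast_add,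
        posU_run, posV_run, length_run, dU, dV, p1, p1', q1, q1', q2, q2', q3, q3', q4, q4', p4,
        p4'] <;>
      omega

section

variable {f : Frame} {c₁ c₂ s c₁' c₂' s' : ℤ} {L : ℕ}

/-- The optimal path one shorter than the element: it encloses too little area, so the last letter
of a standard geodesic is needed. -/
theorem exists_isOptimal_of_len (h₁ : 0 ≤ c₁) (h₂ : 0 ≤ c₂) (hs : 0 < s)
    (hg : len (f.pt c₁ c₂ s) = L) (hL : 50 ≤ L) :
    ∃ n t, IsOptimal f.eps c₁ c₂ n t ∧ c₁ + c₂ + n.sum + 1 = L ∧ n.area f.eps c₁ c₂ < 2 * s := by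
  have h1 := add_le_len_pt f s h₁ h₂
  have h2 : (len (f.pt c₁ c₂ s) : ℤ) ≠ c₁ + c₂ := fun h =>
    absurd ((len_pt_eq_iff f s h₁ h₂).1 h).2 (by omega)
  obtain ⟨n, t, h, hk⟩ := exists_isOptimal (ε := f.eps) f.eps_cases h₁ h₂
    ((L : ℤ) - 1 - c₁ - c₂).toNat
  refine ⟨n, t, h, by omega, ?_⟩
  by_contra hle
  have := mul_nonneg h₁ h₂
  have := h.len_le h₁ h₂ (by omega) (s := s) (by omega) (by omega)
  omega

/-- Both elements are longer than their projections, and on the same side. -/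
theorem stdClose_of_pos (h₁ : 0 ≤ c₁) (h₂ : 0 ≤ c₂) (h₁' : 0 ≤ c₁') (h₂' : 0 ≤ c₂') (hs : 0 < s)
    (hs' : 0 < s') (hg : len (f.pt c₁ c₂ s) = L) (hg' : len (f.pt c₁' c₂' s') = L) (hL : 50 ≤ L)
    (hd : dist (f.pt c₁ c₂ s) (f.pt c₁' c₂' s') ≤ 2) :
    StdClose (f.pt c₁ c₂ s) (f.pt c₁' c₂' s') := by
  obtain ⟨hc, -⟩ := coord_bounds f hd
  obtain ⟨n, t, hn, hk, -⟩ := exists_isOptimal_of_len h₁ h₂ hs hg hL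
  obtain ⟨n', t', hn', hk', -⟩ := exists_isOptimal_of_len h₁' h₂' hs' hg' hL
  have hb : |n'.e₁ - n.e₁| ≤ 8 ∧ |n'.e₂ - n.e₂| ≤ 6 ∧ |n'.e₃ - n.e₃| ≤ 6 ∧ |n'.e₄ - n.e₄| ≤ 8 := by
    rcases le_total n.sum n'.sum with h | h
    · exact hn.sub_bounds_of_sum_le hn' h (by omega) (abs_le.2 ⟨by omega, by omega⟩)
        (abs_le.2 ⟨by omega, by omega⟩)
    · have := hn'.sub_bounds_of_sum_le hn h (by omega) (abs_le.2 ⟨by omega, by omega⟩)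
        (abs_le.2 ⟨by omega, by omega⟩)
      simp only [abs_le] at *
      omega
  obtain ⟨w, hw, hS⟩ := hn.exists_isStandardGeodesic h₁ h₂ (by omega) hs (by omega)
  obtain ⟨w', hw', hS'⟩ := hn'.exists_isStandardGeodesic h₁' h₂' (by omega) hs' (by omega)
  have hT := Quad.tracks_path hn.nonneg (hn.sides_nonneg h₁ h₂ (by omega)) hn'.nonneg
    (hn'.sides_nonneg h₁' h₂' (by omega)) hc (by omega) hb
  exact ⟨w, w', hw, hw', ((hS.trans (Tracks.similar (K := 18) hT f)).trans hS'.symm).mono (by omega)⟩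

theorem Quad.path_eq_of_sum_eq_zero {n : Quad} (hn : n.Nonneg) (h : n.sum = 0) (c₁ c₂ : ℤ) :
    n.path c₁ c₂ = run 0 c₁ ++ run 1 c₂ := by
  obtain ⟨p1, p2, p3, p4⟩ := hn
  obtain ⟨n1, n2, n3, n4⟩ := n
  simp only [sum] at *
  obtain ⟨rfl, rfl, rfl, rfl⟩ : n1 = 0 ∧ n2 = 0 ∧ n3 = 0 ∧ n4 = 0 := by omega
  simp [path, sides]

/-- The parallelogram path of an element of small area stays near two sides of the parallelogram. -/
theorem tracks_parPath {i j e k l : ℤ} (hi : 0 ≤ i) (hj : 0 ≤ j) (he : 0 ≤ e) (he' : e ≤ 1)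
    (hk : 0 ≤ k) (hl : 0 ≤ l) (h : l ≤ 2 ∨ j + k ≤ 2) :
    Tracks 3 (parPath i j e k l) (run 0 (i + e + l) ++ run 1 (j + k)) := by
  have z0 : (0 : ℤ) ≤ 0 := le_rfl
  have T0 := Tracks.nil (K := 3) (by omega)
  rcases h with h | h
  · have z1 : 0 ≤ i + e + l := by omega
    have := ((((T0.append_run 0 hi z1 ?_).append_run 1 hj hj ?_).append_run 0 he z0 ?_).append_run 1
      hk hk ?_).append_run 0 hl z0 ?_
    · simpa [parPath, run_add 1 hj hk] using this
    all_goals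
      constructor <;> simp only [List.nil_append, posU_append, posV_append, List.length_append,
        Nat.cast_add, posU_run, posV_run, length_run, dU, dV, hi, hj, he, hk, hl, z0, z1] <;> omega
  · have z1 : 0 ≤ i + e := by omega
    have z2 : 0 ≤ j + k := by omega
    have := (((((T0.append_run 0 hi hi ?_).append_run 1 hj z0 ?_).append_run 0 he he ?_).append_run 1
      hk z0 ?_).append_run 0 hl hl ?_).append_run 1 z0 z2 ?_
    · simpa [parPath, run_add 0 z1 hl, run_add 0 hi he] using this
    all_goals
      constructor <;> simp only [List.nil_append, posU_append, posV_append, List.length_append,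
        Nat.cast_add, posU_run, posV_run, length_run, dU, dV, hi, hj, he, hk, hl, z0, z2] <;> omega

/-- One of the elements is as short as its projection, the other one is not. -/
theorem stdClose_of_nonpos_of_pos (h₁ : 0 ≤ c₁) (h₂ : 0 ≤ c₂) (h₁' : 0 ≤ c₁') (h₂' : 0 ≤ c₂')
    (hs : -(c₁ * c₂) ≤ s) (hs0 : s ≤ 0) (hs' : 0 < s') (hg : len (f.pt c₁ c₂ s) = L)
    (hg' : len (f.pt c₁' c₂' s') = L) (hL : 50 ≤ L)
    (hd : dist (f.pt c₁ c₂ s) (f.pt c₁' c₂' s') ≤ 2) :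
    StdClose (f.pt c₁ c₂ s) (f.pt c₁' c₂' s') := by
  obtain ⟨hc, a, ha, ha', hss⟩ := coord_bounds f hd
  obtain ⟨n', t', hn', hk', -⟩ := exists_isOptimal_of_len h₁' h₂' hs' hg' hL
  obtain ⟨w', hw', hS'⟩ := hn'.exists_isStandardGeodesic h₁' h₂' (by omega) hs' (by omega)
  have hlen := (len_pt_eq_iff f s h₁ h₂).2 ⟨hs, hs0⟩
  obtain ⟨i, j, e, k, l, hi, hj, he, he', hk, hl, e1, e2, e3, -⟩ := exists_parPath h₁ h₂ hs hs0
  -- Otherwise `s ≤ -3 * c₂`, and two letters raise `s` by at most `2 * c₂ + 3`, so `s'` could not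
  -- be positive. Thus the parallelogram path is near the path with two sides, which is the
  -- hexagonal path with zero offsets.
  have hlc : l ≤ 2 ∨ j + k ≤ 2 := by
    by_contra! hcon
    have q1 : 3 * c₂ ≤ l * c₂ := mul_le_mul_of_nonneg_right (by omega) h₂
    have q2 : 0 ≤ e * j := mul_nonneg he hj
    have q3 : c₂ * (-2) ≤ c₂ * (c₁' - c₁) := mul_le_mul_of_nonneg_left (by omega) h₂
    omega
  have hT := tracks_parPath hi hj he he' hk hl hlc
  have hz : (⟨0, 0, 0, 0⟩ : Quad).Nonneg := ⟨le_rfl, le_rfl, le_rfl, le_rfl⟩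
  rw [e1, e2, ← Quad.path_eq_of_sum_eq_zero hz rfl] at hT
  have hb := hn'.nonneg
  have hT' := Quad.tracks_path (n := ⟨0, 0, 0, 0⟩) (c₁ := c₁) (c₂ := c₂) (c₁' := c₁') (c₂' := c₂') hz
    (by constructor <;> simp [Quad.sides, *]) hn'.nonneg (hn'.sides_nonneg h₁' h₂' (by omega)) hc
    (by simp only [Quad.sum] at *; omega) (by
      obtain ⟨p1, p2, p3, p4⟩ := hb
      simp only [abs_le, Quad.sum] at *
      omega)
  exact ⟨_, w', isStandardGeodesic_parPath f hi hj he he' hk hl e1 e2 e3, hw',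
    (((Tracks.similar (K := 3) hT f).trans (Tracks.similar (K := 18) hT' f)).trans hS'.symm).mono
      (by omega)⟩

end

section

variable {f : Frame} {c₁ c₂ s c₁' c₂' s' : ℤ} {L : ℕ}

theorem IsOptimal.area_nonneg {ε : ℤ} {n t : Quad} (h : IsOptimal ε c₁ c₂ n t) (h₁ : 0 ≤ c₁)
    (h₂ : 0 ≤ c₂) : 0 ≤ n.area ε c₁ c₂ := by
  have := h.area_mono h₁ h₂ (n' := ⟨0, 0, 0, 0⟩) ⟨le_rfl, le_rfl, le_rfl, le_rfl⟩
    (by simpa [Quad.sum] using h.sum_nonneg)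
  simpa [Quad.area, hexArea] using this

/-- The last push alone gains at least `8`, hence `16` in the doubled area. -/
theorem IsOptimal.sixteen_le_area {ε : ℤ} {n t : Quad} (h : IsOptimal ε c₁ c₂ n t) (h₁ : 0 ≤ c₁)
    (h₂ : 0 ≤ c₂) (hn : 1 ≤ n.sum) (hl : 49 ≤ c₁ + c₂ + n.sum) : 16 ≤ n.area ε c₁ c₂ := by
  obtain ⟨m, u, hm, hk⟩ := exists_isOptimal (ε := ε) h.eps_cases h₁ h₂ (n.sum - 1).toNat
  obtain ⟨j, u', hm', hgain⟩ := hm.exists_push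
  have e1 := Quad.area_push ε c₁ c₂ m j
  have e2 := Quad.sum_push m j
  have e3 := h.area_le_of_sum_eq hm'.nonneg (by omega)
  have e4 := hm.area_nonneg h₁ h₂
  omega

/-- The elements are longer than their projections, and on different sides. -/
theorem stdClose_of_pos_of_neg (h₁ : 0 ≤ c₁) (h₂ : 0 ≤ c₂) (h₁' : 0 ≤ c₁') (h₂' : 0 ≤ c₂')
    (hs : 0 < s) (hs' : s' < -(c₁' * c₂')) (hg : len (f.pt c₁ c₂ s) = L)
    (hg' : len (f.pt c₁' c₂' s') = L) (hL : 50 ≤ L)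
    (hd : dist (f.pt c₁ c₂ s) (f.pt c₁' c₂' s') ≤ 2) :
    StdClose (f.pt c₁ c₂ s) (f.pt c₁' c₂' s') := by
  obtain ⟨hc, a, ha, ha', hss⟩ := coord_bounds f hd
  have hflip : f.pt c₁ c₂ s = f.flip.pt c₂ c₁ (-s - c₁ * c₂) := by
    rw [f.flip_pt]; congr 1; ring
  have hflip' : f.pt c₁' c₂' s' = f.flip.pt c₂' c₁' (-s' - c₁' * c₂') := by
    rw [f.flip_pt]; congr 1; ring
  obtain ⟨-, b, hb, hb', hss'⟩ : _ ∧ ∃ b, -1 ≤ b ∧ b ≤ 3 ∧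
      -s' - c₁' * c₂' = -s - c₁ * c₂ + b - c₁ * (c₂' - c₂) := by
    rw [hflip, hflip'] at hd
    exact coord_bounds f.flip hd
  obtain ⟨n, t, hn, hk, hF⟩ := exists_isOptimal_of_len h₁ h₂ hs hg hL
  rw [hflip'] at hg' ⊢
  obtain ⟨n', t', hn', hk', hF'⟩ := exists_isOptimal_of_len h₂' h₁' (by omega) hg' hL
  have p0 := mul_nonneg h₁ h₂
  have p0' := mul_nonneg h₁' h₂'
  have q0 := hn.area_nonneg h₁ h₂
  have q0' := hn'.area_nonneg h₂' h₁'
  have r0 := hn.sum_nonneg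
  have r0' := hn'.sum_nonneg
  have i1 : c₂ * (c₁' - c₁) ≤ c₂ * 2 := mul_le_mul_of_nonneg_left (by omega) h₂
  have i2 : c₁ * (-2) ≤ c₁ * (c₂' - c₂) := mul_le_mul_of_nonneg_left (by omega) h₁
  -- A nonzero sum would put one of the exponents far outside the interval. Then `hss` forces `c₂`
  -- to be at least `2`, and `hss'` bounds the excess on both sides by `2 * c₁ - c₁ * c₂ + 3`, which
  -- is too small.
  have hsum : n.sum = 0 ∧ n'.sum = 0 := by
    by_contra hcon
    have h16 : 16 ≤ n.area f.eps c₁ c₂ + n'.area f.flip.eps c₂' c₁' := by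
      rcases le_or_gt 1 n.sum with h | h
      · have := hn.sixteen_le_area h₁ h₂ h (by omega)
        omega
      · have := hn'.sixteen_le_area h₂' h₁' (by omega) (by omega)
        omega
    have h5 : 2 ≤ c₂ := by omega
    have : c₁ * 2 ≤ c₁ * c₂ := mul_le_mul_of_nonneg_left h5 h₁
    omega
  -- Two letters can only jump over the whole interval of length `c₁ * c₂` if the parallelogram is
  -- thin. Then its two boundary paths are close to each other.
  have hthin : c₂ ≤ 2 ∨ c₁ = 0 := by
    by_contra! hcon
    have h3 : 3 ≤ c₂ := by omega
    have h4 : 1 ≤ c₁ := by omega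
    rcases le_or_gt 4 c₂ with h5 | h5
    · have : c₁ * 4 ≤ c₁ * c₂ := mul_le_mul_of_nonneg_left h5 h₁
      omega
    · have : c₂ = 3 := by omega
      subst this
      omega
  obtain ⟨w, hw, hS⟩ := hn.exists_isStandardGeodesic h₁ h₂ (by omega) hs (by omega)
  obtain ⟨w', hw', hS'⟩ := hn'.exists_isStandardGeodesic h₂' h₁' (by omega)
    (s := -s' - c₁' * c₂') (by omega) (by omega)
  rw [Quad.path_eq_of_sum_eq_zero hn.nonneg hsum.1] at hS
  rw [Quad.path_eq_of_sum_eq_zero hn'.nonneg hsum.2, map_flip_letter,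
    show ((run 0 c₂' ++ run 1 c₁').map (1 - ·) : List (Fin 6)) = run 1 c₂' ++ run 0 c₁' by
      simp [run]] at hS'
  have z0 : (0 : ℤ) ≤ 0 := le_rfl
  have hT : Tracks 18 (run 0 c₁ ++ run 1 c₂) (run 1 c₂' ++ run 0 c₁') := by
    have T0 := Tracks.nil (K := 18) (by omega)
    rcases hthin with h | h
    · have := ((T0.append_run 1 z0 h₂' ?_).append_run 0 h₁ h₁' ?_).append_run 1 h₂ z0 ?_
      · simpa using this
      all_goals
        constructor <;> simp only [List.nil_append, posU_append, posV_append, List.length_append,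
          Nat.cast_add, posU_run, posV_run, length_run, dU, dV, h₁, h₂, h₁', h₂', z0] <;> omega
    · have := ((T0.append_run 0 h₁ z0 ?_).append_run 1 h₂ h₂' ?_).append_run 0 z0 h₁' ?_
      · simpa using this
      all_goals
        constructor <;> simp only [List.nil_append, posU_append, posV_append, List.length_append,
          Nat.cast_add, posU_run, posV_run, length_run, dU, dV, h₁, h₂, h₁', h₂', z0] <;> omega
  exact ⟨w, w', hw, hw', ((hS.trans (Tracks.similar (K := 18) hT f)).trans hS'.symm).mono (by omega)⟩

theorem tracks_parPath_straight {i j e k l : ℤ} (hi : 0 ≤ i) (hj : 0 ≤ j) (he : 0 ≤ e) (he' : e ≤ 1)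
    (hk : 0 ≤ k) (hl : 0 ≤ l) :
    Tracks 1 (parPath i j e k l) (run 0 i ++ run 1 (j + k) ++ run 0 (e + l)) := by
  have z0 : (0 : ℤ) ≤ 0 := le_rfl
  have z1 : 0 ≤ e + l := by omega
  have T0 := Tracks.nil (K := 1) (by omega)
  have := ((((T0.append_run 0 hi hi ?_).append_run 1 hj hj ?_).append_run 0 he z0 ?_).append_run 1
      hk hk ?_).append_run 0 hl z1 ?_
  · simpa [parPath, run_add 1 hj hk] using this
  all_goals
    constructor <;> simp only [List.nil_append, posU_append, posV_append, List.length_append,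
      Nat.cast_add, posU_run, posV_run, length_run, dU, dV, hi, hj, he, hk, hl, z0, z1] <;> omega

theorem tracks_three_runs {a b c a' b' c' : ℤ} (ha : 0 ≤ a) (hb : 0 ≤ b) (hc : 0 ≤ c) (ha' : 0 ≤ a')
    (hb' : 0 ≤ b') (hc' : 0 ≤ c') (h₁ : -8 ≤ a' - a ∧ a' - a ≤ 8) (h₂ : -2 ≤ b' - b ∧ b' - b ≤ 2)
    (h₃ : -8 ≤ c' - c ∧ c' - c ≤ 8) :
    Tracks 18 (run 0 a ++ run 1 b ++ run 0 c) (run 0 a' ++ run 1 b' ++ run 0 c') := by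
  refine (((Tracks.nil (K := 18) (by omega)).append_run 0 ha ha' ?_).append_run 1 hb hb'
    ?_).append_run 0 hc hc' ?_
  all_goals
    constructor <;> simp only [List.nil_append, posU_append, posV_append, List.length_append,
      Nat.cast_add, posU_run, posV_run, length_run, dU, dV, ha, hb, hc, ha', hb', hc'] <;> omega

/-- Both elements are as short as their projections. -/
theorem stdClose_of_nonpos (h₁ : 0 ≤ c₁) (h₂ : 0 ≤ c₂) (h₁' : 0 ≤ c₁') (h₂' : 0 ≤ c₂')
    (hs : -(c₁ * c₂) ≤ s) (hs0 : s ≤ 0) (hs' : -(c₁' * c₂') ≤ s') (hs0' : s' ≤ 0) (hc₁₂ : c₁ ≤ c₂)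
    (hL : 50 ≤ c₁ + c₂) (hd : dist (f.pt c₁ c₂ s) (f.pt c₁' c₂' s') ≤ 2) :
    StdClose (f.pt c₁ c₂ s) (f.pt c₁' c₂' s') := by
  obtain ⟨hc, a, ha, ha', hss⟩ := coord_bounds f hd
  obtain ⟨i, j, e, k, l, hi, hj, he, he', hk, hl, e1, e2, e3, -⟩ := exists_parPath h₁ h₂ hs hs0
  obtain ⟨i', j', e', k', l', hi', hj', hee, hee', hk', hl', e1', e2', e3', -⟩ :=
    exists_parPath h₁' h₂' hs' hs0'
  have hT := tracks_parPath_straight hi hj he he' hk hl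
  have hT' := tracks_parPath_straight hi' hj' hee hee' hk' hl'
  have b1 : 0 ≤ e * j ∧ e * j ≤ c₂ := 
    ⟨mul_nonneg he hj, by have := mul_le_mul_of_nonneg_right he' hj; omega⟩
  have b2 : 0 ≤ e' * j' ∧ e' * j' ≤ c₂' := 
    ⟨mul_nonneg hee hj', by have := mul_le_mul_of_nonneg_right hee' hj'; omega⟩
  have b3 : l' * (-2) ≤ l' * (c₂' - c₂) ∧ l' * (c₂' - c₂) ≤ l' * 2 :=
    ⟨mul_le_mul_of_nonneg_left (by omega) hl', mul_le_mul_of_nonneg_left (by omega) hl'⟩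
  have b4 : c₂ * (-2) ≤ c₂ * (c₁' - c₁) ∧ c₂ * (c₁' - c₁) ≤ c₂ * 2 :=
    ⟨mul_le_mul_of_nonneg_left (by omega) h₂, mul_le_mul_of_nonneg_left (by omega) h₂⟩
  -- Every term on the right is bounded by a small multiple of `c₂` up to a constant; for the last
  -- one this uses `l' ≤ c₁' ≤ c₂ + 2`, hence the assumption `c₁ ≤ c₂`. As `c₂ ≥ 25`, the difference
  -- `l' - l` is at most `5` in absolute value.
  have key : (l' - l) * c₂ = c₂ * (c₁' - c₁) - a + e * j - e' * j' - l' * (c₂' - c₂) := by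
    linear_combination e3' - e3 - hss
  have b5 : l' - l ≤ 5 := by
    by_contra! hcon
    have : 6 * c₂ ≤ (l' - l) * c₂ := mul_le_mul_of_nonneg_right (by omega) h₂
    omega
  have b6 : -5 ≤ l' - l := by
    by_contra! hcon
    have : (l' - l) * c₂ ≤ -6 * c₂ := mul_le_mul_of_nonneg_right (by omega) h₂
    omega
  have z1 : 0 ≤ e + l := by omega
  have z1' : 0 ≤ e' + l' := by omega
  have z2 : 0 ≤ j + k := by omega
  have z2' : 0 ≤ j' + k' := by omega
  have hT'' := tracks_three_runs hi z2 z1 hi' z2' z1' (by omega) (by omega) (by omega)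
  exact ⟨_, _, isStandardGeodesic_parPath f hi hj he he' hk hl e1 e2 e3,
    isStandardGeodesic_parPath f hi' hj' hee hee' hk' hl' e1' e2' e3',
    (((Tracks.similar (K := 1) hT f).trans (Tracks.similar (K := 18) hT'' f)).trans
      (Tracks.similar (K := 1) hT' f).symm).mono (by omega)⟩

/-- Neighbouring elements of the same length over a common sector have standard geodesics that stay
close to each other. -/
theorem stdClose_of_sector (h₁ : 0 ≤ c₁) (h₂ : 0 ≤ c₂) (h₁' : 0 ≤ c₁') (h₂' : 0 ≤ c₂')
    (hg : len (f.pt c₁ c₂ s) = L) (hg' : len (f.pt c₁' c₂' s') = L) (hL : 50 ≤ L)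
    (hd : dist (f.pt c₁ c₂ s) (f.pt c₁' c₂' s') ≤ 2) :
    StdClose (f.pt c₁ c₂ s) (f.pt c₁' c₂' s') := by
  have hflip : f.pt c₁ c₂ s = f.flip.pt c₂ c₁ (-s - c₁ * c₂) := by
    rw [f.flip_pt]; congr 1; ring
  have hflip' : f.pt c₁' c₂' s' = f.flip.pt c₂' c₁' (-s' - c₁' * c₂') := by
    rw [f.flip_pt]; congr 1; ring
  have hd' := dist_le_symm hd
  have hgf := hg; have hgf' := hg'; have hdf := hd; have hdf' := hd'
  rw [hflip] at hgf
  rw [hflip'] at hgf'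
  rw [hflip, hflip'] at hdf hdf'
  have m := mul_comm c₁ c₂
  have m' := mul_comm c₁' c₂'
  rcases lt_or_ge 0 s with u | u
  · rcases lt_or_ge 0 s' with u' | u'
    · exact stdClose_of_pos h₁ h₂ h₁' h₂' u u' hg hg' hL hd
    · rcases le_or_gt (-(c₁' * c₂')) s' with v' | v'
      · exact (stdClose_of_nonpos_of_pos h₁' h₂' h₁ h₂ v' u' u hg' hg hL hd').symm
      · exact stdClose_of_pos_of_neg h₁ h₂ h₁' h₂' u v' hg hg' hL hd
  rcases le_or_gt (-(c₁ * c₂)) s with v | v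
  · rcases lt_or_ge 0 s' with u' | u'
    · exact stdClose_of_nonpos_of_pos h₁ h₂ h₁' h₂' v u u' hg hg' hL hd
    · rcases le_or_gt (-(c₁' * c₂')) s' with v' | v'
      · have := (len_pt_eq_iff f s h₁ h₂).2 ⟨v, u⟩
        rcases le_total c₁ c₂ with h | h
        · exact stdClose_of_nonpos h₁ h₂ h₁' h₂' v u v' u' h (by omega) hd
        · rw [hflip, hflip']
          exact stdClose_of_nonpos h₂ h₁ h₂' h₁' (by omega) (by omega) (by omega) (by omega) h
            (by omega) hdf
      · rw [hflip, hflip']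
        exact stdClose_of_nonpos_of_pos h₂ h₁ h₂' h₁' (by omega) (by omega) (by omega) hgf hgf' hL hdf
  · rcases lt_or_ge 0 s' with u' | u'
    · exact (stdClose_of_pos_of_neg h₁' h₂' h₁ h₂ u' v hg' hg hL hd').symm
    · rcases le_or_gt (-(c₁' * c₂')) s' with v' | v'
      · rw [hflip, hflip']
        exact (stdClose_of_nonpos_of_pos h₂' h₁' h₂ h₁ (by omega) (by omega) (by omega) hgf' hgf hL
          hdf').symm
      · rw [hflip, hflip']
        exact stdClose_of_pos h₂ h₁ h₂' h₁' (by omega) (by omega) hgf hgf' hL hdf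

end

/-! ### Crossing an axis -/

namespace Frame

/-- The frame with the opposite first direction. -/
def opp (f : Frame) : Frame := ⟨f.letter 3, f.pos⟩

/-- The frame with the opposite sense of rotation. -/
def mirror (f : Frame) : Frame := ⟨f.u, !f.pos⟩

/-- The frame whose second direction is the first direction of `f`. -/
def lower (f : Frame) : Frame := ⟨f.letter 5, f.pos⟩

theorem opp_letter (f : Frame) (i : Fin 6) : f.opp.letter i = f.letter (i + 3) := by
  obtain ⟨u, pos⟩ := f
  cases u <;> cases pos <;> fin_cases i <;> rfl

theorem lower_letter (f : Frame) (i : Fin 6) : f.lower.letter i = f.letter (i + 5) := by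
  obtain ⟨u, pos⟩ := f
  cases u <;> cases pos <;> fin_cases i <;> rfl

theorem lower_eps (f : Frame) : f.lower.eps = 1 - f.eps := by
  obtain ⟨u, pos⟩ := f
  cases u <;> cases pos <;> rfl

theorem opp_pt (f : Frame) (c s : ℤ) : f.opp.pt c 0 s = f.pt (-c) 0 s := by
  have h : f.opp.U = f.U⁻¹ := by
    rw [U, opp_letter]
    have h1 := f.val_letter 3
    simp only [dU, dV, dS] at h1
    rw [show (0 : Fin 6) + 3 = 3 from rfl, h1]
    simp [pt]
  have hZ : f.opp.Z = f.Z := rfl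
  simp only [pt, h, hZ, inv_zpow', zpow_zero]

theorem mirror_pt (f : Frame) (c s : ℤ) : f.mirror.pt c 0 s = f.pt c 0 (-s) := by
  obtain ⟨u, pos⟩ := f
  cases pos <;> simp [pt, mirror, Z, U, letter]

theorem lower_pt (f : Frame) (c s : ℤ) : f.lower.pt 0 c s = f.pt c 0 s := by
  have h : f.lower.V = f.U := by rw [V, lower_letter]; rfl
  simp only [pt, h, zpow_zero, one_mul, mul_one]
  rfl

end Frame

section

variable {f : Frame} {c s : ℤ} {L : ℕ}

/-- A point on the first side of the sector is no further away than the point next to it inside. -/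
theorem len_pt_zero_le {s' : ℤ} (hc : 0 ≤ c) (hs : 0 ≤ s) (hss : s ≤ s') (hL : 50 ≤ L)
    (h : len (f.pt c 1 s') ≤ L) :
    len (f.pt (c + 1) 0 s) ≤ L := by
  have hl := add_le_len_pt f s' hc (zero_le_one (α := ℤ))
  obtain ⟨n, t, hn, hk⟩ := exists_isOptimal (ε := f.eps) (c₁ := c) (c₂ := 1) f.eps_cases hc
    (by omega) (L - (c + 1)).toNat
  obtain ⟨m, u, hm, hk'⟩ := exists_isOptimal (ε := f.eps) (c₁ := c + 1) (c₂ := 0) f.eps_cases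
    (by omega) le_rfl (L - (c + 1)).toNat
  have h1 := hn.le_area_of_len_le hc (by omega) (s := s') (by omega)
  -- With the same offsets the area changes by `2 * (n₂ - n₃)`. If `n₃` and `n₄` are positive, one
  -- unit is shifted from each of them to `n₁` and `n₂`.
  have key : ∃ n' : Quad, n'.Nonneg ∧ n'.sum = n.sum ∧
      n.area f.eps c 1 ≤ n'.area f.eps (c + 1) 0 := by
    have hpos := hn.nonneg
    have e3 := hn.eq₃
    have h6 := hn.le_six_mul
    obtain ⟨n1, n2, n3, n4⟩ := n
    obtain ⟨p1, p2, p3, p4⟩ := hpos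
    simp only [Quad.sum, Quad.sides] at *
    rcases le_or_gt 1 n4 with q4 | q4
    · rcases le_or_gt 1 n3 with q3 | q3
      · refine ⟨⟨n1 + 1, n2 + 1, n3 - 1, n4 - 1⟩, ⟨by simp only; omega, by simp only; omega,
          by simp only; omega, by simp only; omega⟩, by simp only; ring, ?_⟩
        simp only [Quad.area, hexArea]
        linarith
      · refine ⟨⟨n1, n2, n3, n4⟩, ⟨p1, p2, p3, p4⟩, rfl, ?_⟩
        simp only [Quad.area, hexArea]
        linarith
    · refine ⟨⟨n1, n2, n3, n4⟩, ⟨p1, p2, p3, p4⟩, rfl, ?_⟩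
      have : n3 ≤ n2 := by omega
      simp only [Quad.area, hexArea]
      linarith
  obtain ⟨n', hn', hs', ha⟩ := key
  have h2 := hm.area_mono (by omega) le_rfl hn' (by omega)
  have := hm.len_le (by omega) le_rfl (s := s) (by omega) (by simpa using hs) (by omega)
  omega

/-- Below a point on the axis that is enclosed by a path of positive area, the length is smaller. -/
theorem len_mul_letter_le (hc : 0 ≤ c) (hs : 0 < s) (hL : 40 ≤ L) (h : len (f.pt c 0 s) ≤ L)
    {j : Fin 6} (hj : j = 5 ∨ (j = 4 ∧ 1 ≤ c)) : len (f.pt c 0 s * (f.letter j).val) ≤ L := by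
  have hl := add_le_len_pt f s hc (le_refl (0 : ℤ))
  obtain ⟨n, t, hn, hk⟩ := exists_isOptimal (ε := f.eps) (c₁ := c) (c₂ := 0) f.eps_cases hc
    le_rfl (L - c).toNat
  have h1 := hn.le_area_of_len_le hc le_rfl (s := s) (by omega)
  have ht := hn.sides_nonneg hc le_rfl (by omega)
  have hpos := hn.nonneg
  have e4 := hn.eq₄
  have h6 := hn.le_six_mul
  have hε := f.eps_cases
  obtain ⟨n1, n2, n3, n4⟩ := n
  obtain ⟨p1, p2, p3, p4⟩ := hpos
  obtain ⟨q1, q2, q3, q4⟩ := ht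
  simp only [Quad.sum, Quad.sides] at *
  -- The path must dip below the axis: if `n2 = 0`, nonnegative sides and a complete side of
  -- direction `2` leave only zero offsets, which enclose no positive area.
  have hn2 : 1 ≤ n2 := by
    by_contra hcon
    obtain ⟨rfl, rfl, rfl⟩ : n1 = 0 ∧ n2 = 0 ∧ n4 = n3 := by omega
    have : n4 = 0 := by omega
    subst this
    simp [Quad.area, hexArea] at h1
    omega
  have hn34 : n4 < n3 ∨ (n3 = 0 ∧ n4 = 0) := by omega
  -- Any offsets over the new point with enough area suffice; they need not be optimal.
  have final : ∀ (a b s' : ℤ) (n' : Quad), 0 ≤ a → 0 ≤ b → n'.Nonneg → a + b + n'.sum ≤ L →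
      -(a * b) ≤ s' → 2 * s' ≤ n'.area f.lower.eps a b → len (f.lower.pt a b s') ≤ L := by
    intro a b s' n' ha hb hn' hsum hs' ha'
    have := hn'.h₁; have := hn'.h₂; have := hn'.h₃; have := hn'.h₄
    obtain ⟨m, u, hm, hk'⟩ := exists_isOptimal (ε := f.lower.eps) f.lower.eps_cases ha hb
      (L - (a + b)).toNat
    have h2 := hm.area_mono ha hb hn' (by simp only [Quad.sum] at *; omega)
    have : 0 ≤ n'.sum := by simp only [Quad.sum]; omega
    have := hm.len_le ha hb (s := s') (by omega) hs' (by omega)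
    omega
  rw [← f.lower_pt]
  rcases hj with rfl | ⟨rfl, hc1⟩
  · have e : f.lower.pt 0 c s * (f.letter 5).val = f.lower.pt 1 c (s - c) := by
      rw [show f.letter 5 = f.lower.letter 0 from (f.lower_letter 0).symm, f.lower.val_letter,
        f.lower.pt_mul]
      simp [dU, dV, dS]
    rw [e]
    -- Sorted for the frame `f.lower`, the same letters have offsets `⟨n4, n1 + n4, n2, n3 - n4⟩`.
    -- The witnesses lower these to make room for the new end point.
    rcases hn34 with h34 | ⟨rfl, rfl⟩
    · refine final _ _ _ ⟨n4, n1 + n4, n2 - 1, n3 - n4 - 1⟩ (by omega) hc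
        ⟨p4, by simp only; omega, by simp only; omega, by simp only; omega⟩
        (by simp only [Quad.sum]; omega) (by omega) ?_
      rw [f.lower_eps]
      simp only [Quad.area, hexArea] at h1 ⊢
      linarith
    · refine final _ _ _ ⟨0, n1, n2 - 1, 0⟩ (by omega) hc
        ⟨le_rfl, p1, by simp only; omega, le_rfl⟩
        (by simp only [Quad.sum]; omega) (by omega) ?_
      rw [f.lower_eps]
      simp only [Quad.area, hexArea] at h1 ⊢
      rcases hε with hε | hε <;> rw [hε] at h1 ⊢ <;> linarith
  · have e : f.lower.pt 0 c s * (f.letter 4).val = f.lower.pt 1 (c - 1) (s + f.eps - c) := by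
      rw [show f.letter 4 = f.lower.letter 5 from (f.lower_letter 5).symm, f.lower.val_letter,
        f.lower.pt_mul, f.lower_eps]
      simp only [dU, dV, dS]
      congr 1; ring
    rw [e]
    rcases hn34 with h34 | ⟨rfl, rfl⟩
    · refine final _ _ _ ⟨n4 + 1, n1 + n4 + 1, n2 - 1, n3 - n4 - 1⟩ (by omega) (by omega)
        ⟨by simp only; omega, by simp only; omega, by simp only; omega, by simp only; omega⟩
        (by simp only [Quad.sum]; omega) (by omega) ?_
      rw [f.lower_eps]
      simp only [Quad.area, hexArea] at h1 ⊢
      rcases hε with hε | hε <;> rw [hε] at h1 ⊢ <;> linarith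
    · refine final _ _ _ ⟨0, n1, n2 - 1, 0⟩ (by omega) (by omega)
        ⟨le_rfl, p1, by simp only; omega, le_rfl⟩
        (by simp only [Quad.sum]; omega) (by omega) ?_
      rw [f.lower_eps]
      simp only [Quad.area, hexArea] at h1 ⊢
      linarith

end

section

variable {f : Frame} {c s : ℤ} {L : ℕ}

theorem len_mul_letter_bounds (g : N) (l : Letter) :
    len (g * l.val) ≤ len g + 1 ∧ len g ≤ len (g * l.val) + 1 := by
  constructor
  · obtain ⟨w, h1, h2⟩ := exists_word g
    have := len_le (w := w ++ [l]) (g := g * l.val) (by rw [eval_append, h2]; simp [eval_cons])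
    simpa [h1] using this
  · obtain ⟨w, h1, h2⟩ := exists_word (g * l.val)
    obtain ⟨v, h3, h4⟩ := exists_inv_word [l]
    have := len_le (w := w ++ v) (g := g) (by rw [eval_append, h2, h4]; simp [eval_cons])
    rw [List.length_append, h1, h3] at this
    simpa using this

theorem dist_mul_letter_le (g : N) (l l' : Letter) : dist (g * l.val) (g * l'.val) ≤ 2 := by
  obtain ⟨v, h1, h2⟩ := exists_inv_word [l]
  refine dist_le_iff.2 ⟨v ++ [l'], by simp [h1], ?_⟩
  rw [eval_append, h2]
  simp [eval_cons, mul_assoc]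

theorem dist_mul_letter_le' (g : N) (l : Letter) : dist (g * l.val) g ≤ 2 := by
  obtain ⟨v, h1, h2⟩ := exists_inv_word [l]
  refine dist_le_iff.2 ⟨v, by simp [h1], ?_⟩
  rw [h2]
  simp [eval_cons]

/-- Two neighbours of a point of the axis, on different sides of it, have a common neighbour of the
same length on the axis. -/
theorem exists_on_axis (hc : 0 ≤ c) (hs : 0 ≤ s) (hL : 50 ≤ L) {i j : Fin 6}
    (hij : (i = 1 ∧ j = 5) ∨ ((i = 1 ∨ i = 2) ∧ (j = 4 ∨ j = 5) ∧ 1 ≤ c))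
    (hi : len (f.pt c 0 s * (f.letter i).val) = L) (hj : len (f.pt c 0 s * (f.letter j).val) = L) :
    ∃ c' s' : ℤ, 0 ≤ c' ∧ len (f.pt c' 0 s') = L ∧
      dist (f.pt c 0 s * (f.letter i).val) (f.pt c' 0 s') ≤ 2 ∧
      dist (f.pt c 0 s * (f.letter j).val) (f.pt c' 0 s') ≤ 2 := by
  have hb := len_mul_letter_bounds (f.pt c 0 s) (f.letter i)
  have hU : f.pt (c + 1) 0 s = f.pt c 0 s * (f.letter 0).val := by
    rw [f.val_letter, f.pt_mul]; simp [dU, dV, dS]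
  -- A middle vertex of length `L` can be taken itself. If it is shorter, `len_mul_letter_le`
  -- excludes `s > 0`, and for `s = 0` its successor on the axis has length `L`. If it is longer,
  -- `len_pt_zero_le` gives the successor for `i = 1` and a contradiction for `i = 2`.
  rcases lt_trichotomy (len (f.pt c 0 s)) L with h | h | h
  · rcases hs.eq_or_lt with rfl | hs
    · have e1 := (len_pt_eq_iff f 0 hc (le_refl 0)).2 (by simp)
      have e2 := (len_pt_eq_iff f 0 (c₁ := c + 1) (by omega) (le_refl 0)).2 (by simp)
      exact ⟨c + 1, 0, by omega, by omega, hU ▸ dist_mul_letter_le _ _ _,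
        hU ▸ dist_mul_letter_le _ _ _⟩
    · exfalso
      have := len_mul_letter_le (f := f) (L := L - 1) hc hs (by omega) (by omega) (j := j) (by omega)
      omega
  · exact ⟨c, s, hc, h, dist_mul_letter_le' _ _, dist_mul_letter_le' _ _⟩
  · have hcase : i = 1 ∨ (i = 2 ∧ 1 ≤ c) := by omega
    rcases hcase with rfl | ⟨rfl, hc1⟩
    · have e : f.pt c 0 s * (f.letter 1).val = f.pt c 1 s := by
        rw [f.val_letter, f.pt_mul]; simp [dU, dV, dS]
      have h1 := len_pt_zero_le hc hs le_rfl hL (by rw [← e, hi])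
      have hb' := len_mul_letter_bounds (f.pt c 0 s) (f.letter 0)
      rw [← hU] at hb'
      exact ⟨c + 1, s, by omega, by omega, hU ▸ dist_mul_letter_le _ _ _,
        hU ▸ dist_mul_letter_le _ _ _⟩
    · exfalso
      have e : f.pt c 0 s * (f.letter 2).val = f.pt (c - 1) 1 (s + f.eps) := by
        rw [f.val_letter, f.pt_mul]; simp [dU, dV, dS]; rfl
      have := len_pt_zero_le (f := f) (c := c - 1) (s := s) (s' := s + f.eps) (by omega) hs
        (by have := f.eps_cases; omega) hL (by rw [← e, hi])
      rw [sub_add_cancel] at this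
      omega

theorem stdClose_of_nonneg {g g' : N} (f : Frame)
    (h : ∀ a b s, f.pt a b s = g → 0 ≤ a ∧ 0 ≤ b) (h' : ∀ a b s, f.pt a b s = g' → 0 ≤ a ∧ 0 ≤ b)
    (hg : len g = L) (hg' : len g' = L) (hL : 50 ≤ L) (hd : dist g g' ≤ 2) : StdClose g g' := by
  obtain ⟨a, b, s, rfl⟩ := exists_pt f g
  obtain ⟨a', b', s', rfl⟩ := exists_pt f g'
  obtain ⟨h1, h2⟩ := h a b s rfl
  obtain ⟨h1', h2'⟩ := h' a' b' s' rfl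
  exact stdClose_of_sector h1 h2 h1' h2' hg hg' hL hd

/-- Such a common neighbour on the axis has standard geodesics close to those of both points. -/
theorem exists_stdClose_on_axis (hc : 0 ≤ c) (hs : 0 ≤ s) (hL : 50 ≤ L) {i j : Fin 6}
    (hij : (i = 1 ∧ j = 5) ∨ ((i = 1 ∨ i = 2) ∧ (j = 4 ∨ j = 5) ∧ 1 ≤ c))
    (hi : len (f.pt c 0 s * (f.letter i).val) = L) (hj : len (f.pt c 0 s * (f.letter j).val) = L) :
    ∃ c' s' : ℤ, len (f.pt c' 0 s') = L ∧
      dist (f.pt c 0 s * (f.letter i).val) (f.pt c' 0 s') ≤ 2 ∧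
      dist (f.pt c 0 s * (f.letter j).val) (f.pt c' 0 s') ≤ 2 ∧
      StdClose (f.pt c 0 s * (f.letter i).val) (f.pt c' 0 s') ∧
      StdClose (f.pt c 0 s * (f.letter j).val) (f.pt c' 0 s') := by
  obtain ⟨c', s', hc', hl, hd, hd'⟩ := exists_on_axis hc hs hL hij hi hj
  refine ⟨c', s', hl, hd, hd', stdClose_of_nonneg f ?_ ?_ hi hl hL hd,
    stdClose_of_nonneg f.lower ?_ ?_ hj hl hL hd'⟩
  · intro a b t h
    rw [f.val_letter, f.pt_mul] at h
    obtain ⟨rfl, rfl, -⟩ := pt_injective f h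
    rcases hij with ⟨rfl, -⟩ | ⟨rfl | rfl, -, h1⟩ <;> simp only [dU, dV] <;> omega
  · intro a b t h
    obtain ⟨rfl, rfl, -⟩ := pt_injective f h
    exact ⟨hc', le_rfl⟩
  · intro a b t h
    -- The point beyond the axis is nonnegative in the frame `f.lower`, whose second direction runs
    -- along the axis.
    obtain ⟨k, rfl⟩ : ∃ k, j = k + 5 := ⟨j - 5, by simp⟩
    rw [← f.lower_letter, ← f.lower_pt, f.lower.val_letter, f.lower.pt_mul] at h
    obtain ⟨rfl, rfl, -⟩ := pt_injective _ h
    have : k = 0 ∨ (k = 5 ∧ 1 ≤ c) := by omega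
    rcases this with rfl | ⟨rfl, h1⟩ <;> simp only [dU, dV] <;> omega
  · intro a b t h
    rw [← f.lower_pt] at h
    obtain ⟨rfl, rfl, -⟩ := pt_injective _ h
    exact ⟨le_rfl, hc'⟩

end

/-! ### The position of a short path with respect to the axes -/

theorem Axis.form_mul (A : Axis) (P Q : Plane) : A.form (P * Q) = A.form P + A.form Q := by
  cases A <;> simp [Axis.form, fstCoord, sndCoord]
  ring

theorem Axis.form_zpow (A : Axis) (P : Plane) (k : ℤ) : A.form (P ^ k) = k * A.form P := by
  cases A <;> simp [Axis.form, fstCoord, sndCoord]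
  ring

theorem Axis.form_val_bounds (A : Axis) (l : Letter) :
    -1 ≤ A.form (p l.val) ∧ A.form (p l.val) ≤ 1 := by
  cases A <;> cases l <;> simp [p_val, Letter.vec, Axis.form, fstCoord, sndCoord]

theorem Axis.form_pt (A : Axis) (f : Frame) (a b s : ℤ) :
    A.form (p (f.pt a b s)) = a * A.form (p f.U) + b * A.form (p f.V) := by
  simp only [Frame.pt, map_mul, map_zpow, p_Z, one_zpow, mul_one, A.form_mul, A.form_zpow]

theorem Axis.form_val_letter (A : Axis) (f : Frame) (i : Fin 6) :
    A.form (p (f.letter i).val) = dU i * A.form (p f.U) + dV i * A.form (p f.V) := by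
  rw [f.val_letter, A.form_pt]

/-- A path of length at most two that crosses an axis has its middle vertex on the axis. -/
theorem Crosses.exists_mid {g : N} {r : Word} {A : Axis} (h : Crosses g r A) (hr : r.length ≤ 2) :
    ∃ l l' : Letter, r = [l, l'] ∧ A.form (p (g * l.val)) = 0 ∧
      ((A.form (p g) < 0 ∧ 0 < A.form (p (g * eval r))) ∨
        (0 < A.form (p g) ∧ A.form (p (g * eval r)) < 0)) := by
  obtain ⟨i, j, hi, hj⟩ := h
  match r, hr with
  | [], _ => simp at hi hj; omega
  | [l], _ =>
    have hb := A.form_val_bounds l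
    rcases i with - | i <;> rcases j with - | j <;>
      simp [eval_cons, A.form_mul] at hi hj <;> omega
  | [l, l'], _ =>
    have hb := A.form_val_bounds l
    have hb' := A.form_val_bounds l'
    refine ⟨l, l', rfl, ?_⟩
    rcases i with - | - | i <;> rcases j with - | - | j <;>
      simp [eval_cons, A.form_mul] at hi hj ⊢ <;> omega

theorem crosses_of_form_neg {g : N} {r : Word} {A : Axis}
    (h : (A.form (p g) < 0 ∧ 0 < A.form (p (g * eval r))) ∨
      (0 < A.form (p g) ∧ A.form (p (g * eval r)) < 0)) : Crosses g r A := by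
  rcases h with h | h
  · exact ⟨0, r.length, by simpa using h.1, by simpa using h.2⟩
  · exact ⟨r.length, 0, by simpa using h.2, by simpa using h.1⟩

/-- Points that are not separated by an axis lie in a common sector. -/
theorem stdClose_of_not_crosses {g g' : N} {L : ℕ} (hg : len g = L) (hg' : len g' = L) (hL : 50 ≤ L)
    (hd : dist g g' ≤ 2) (h : ∀ A : Axis, ¬ (A.form (p g) < 0 ∧ 0 < A.form (p g')) ∧
      ¬ (0 < A.form (p g) ∧ A.form (p g') < 0)) : StdClose g g' := by
  have key : ∀ (f : Frame) (g : N) (P : ℤ → ℤ → Prop),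
      (∀ a b, P (a * (f.letter 0).vec.1 + b * (f.letter 1).vec.1)
        (a * (f.letter 0).vec.2 + b * (f.letter 1).vec.2) → 0 ≤ a ∧ 0 ≤ b) →
      P (fstCoord (p g)) (sndCoord (p g)) → ∀ a b s, f.pt a b s = g → 0 ≤ a ∧ 0 ≤ b := by
    rintro f _ P h1 h2 a b s rfl
    rw [fstCoord_pt, sndCoord_pt] at h2
    exact h1 a b h2
  have hx := h .x; have hy := h .y; have ht := h .t
  simp only [Axis.form] at hx hy ht
  have hor : (0 ≤ sndCoord (p g) ∧ sndCoord (p g) ≤ fstCoord (p g) ∧ 0 ≤ sndCoord (p g') ∧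
      sndCoord (p g') ≤ fstCoord (p g')) ∨ (0 ≤ fstCoord (p g) ∧ fstCoord (p g) ≤ sndCoord (p g) ∧
      0 ≤ fstCoord (p g') ∧ fstCoord (p g') ≤ sndCoord (p g')) ∨ (fstCoord (p g) ≤ 0 ∧
      0 ≤ sndCoord (p g) ∧ fstCoord (p g') ≤ 0 ∧ 0 ≤ sndCoord (p g')) ∨ (sndCoord (p g) ≤ 0 ∧
      fstCoord (p g) ≤ sndCoord (p g) ∧ sndCoord (p g') ≤ 0 ∧ fstCoord (p g') ≤ sndCoord (p g')) ∨
      (fstCoord (p g) ≤ 0 ∧ sndCoord (p g) ≤ fstCoord (p g) ∧ fstCoord (p g') ≤ 0 ∧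
      sndCoord (p g') ≤ fstCoord (p g')) ∨ (0 ≤ fstCoord (p g) ∧ sndCoord (p g) ≤ 0 ∧
      0 ≤ fstCoord (p g') ∧ sndCoord (p g') ≤ 0) := by omega
  rcases hor with h | h | h | h | h | h
  · exact stdClose_of_nonneg ⟨.x, true⟩ (key _ g (fun u v => 0 ≤ v ∧ v ≤ u)
      (by simp [Frame.letter, Frame.turn, Letter.next, Letter.vec]; omega) (by omega))
      (key _ g' (fun u v => 0 ≤ v ∧ v ≤ u)
      (by simp [Frame.letter, Frame.turn, Letter.next, Letter.vec]; omega) (by omega)) hg hg' hL hd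
  · exact stdClose_of_nonneg ⟨.t, true⟩ (key _ g (fun u v => 0 ≤ u ∧ u ≤ v)
      (by simp [Frame.letter, Frame.turn, Letter.next, Letter.vec]) (by omega))
      (key _ g' (fun u v => 0 ≤ u ∧ u ≤ v)
      (by simp [Frame.letter, Frame.turn, Letter.next, Letter.vec]) (by omega)) hg hg' hL hd
  · exact stdClose_of_nonneg ⟨.y, true⟩ (key _ g (fun u v => u ≤ 0 ∧ 0 ≤ v)
      (by simp [Frame.letter, Frame.turn, Letter.next, Letter.vec]; omega) (by omega))
      (key _ g' (fun u v => u ≤ 0 ∧ 0 ≤ v)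
      (by simp [Frame.letter, Frame.turn, Letter.next, Letter.vec]; omega) (by omega)) hg hg' hL hd
  · exact stdClose_of_nonneg ⟨.xi, true⟩ (key _ g (fun u v => v ≤ 0 ∧ u ≤ v)
      (by simp [Frame.letter, Frame.turn, Letter.next, Letter.vec]; omega) (by omega))
      (key _ g' (fun u v => v ≤ 0 ∧ u ≤ v)
      (by simp [Frame.letter, Frame.turn, Letter.next, Letter.vec]; omega) (by omega)) hg hg' hL hd
  · exact stdClose_of_nonneg ⟨.ti, true⟩ (key _ g (fun u v => u ≤ 0 ∧ v ≤ u)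
      (by simp [Frame.letter, Frame.turn, Letter.next, Letter.vec]) (by omega))
      (key _ g' (fun u v => u ≤ 0 ∧ v ≤ u)
      (by simp [Frame.letter, Frame.turn, Letter.next, Letter.vec]) (by omega)) hg hg' hL hd
  · exact stdClose_of_nonneg ⟨.yi, true⟩ (key _ g (fun u v => 0 ≤ u ∧ v ≤ 0)
      (by simp [Frame.letter, Frame.turn, Letter.next, Letter.vec]; omega) (by omega))
      (key _ g' (fun u v => 0 ≤ u ∧ v ≤ 0)
      (by simp [Frame.letter, Frame.turn, Letter.next, Letter.vec]; omega) (by omega)) hg hg' hL hd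

/-- A frame along an axis in which a given element over the axis has nonnegative coordinates. -/
theorem exists_frame_along (A : Axis) {g : N} (h : A.form (p g) = 0) :
    ∃ (f : Frame) (c s : ℤ), A.form (p f.U) = 0 ∧ 0 ≤ c ∧ 0 ≤ s ∧ g = f.pt c 0 s := by
  have h1 : ∃ (f : Frame) (c s : ℤ), A.form (p f.U) = 0 ∧ g = f.pt c 0 s := by
    obtain ⟨f, hU, hV⟩ : ∃ f : Frame, A.form (p f.U) = 0 ∧ A.form (p f.V) ≠ 0 := by
      cases A
      · exact ⟨⟨.x, true⟩, by simp [Frame.U, Frame.V, Frame.letter, Frame.turn, Letter.next, p_val,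
          Letter.vec, Axis.form, sndCoord]⟩
      · exact ⟨⟨.y, true⟩, by simp [Frame.U, Frame.V, Frame.letter, Frame.turn, Letter.next, p_val,
          Letter.vec, Axis.form, fstCoord]⟩
      · exact ⟨⟨.t, true⟩, by simp [Frame.U, Frame.V, Frame.letter, Frame.turn, Letter.next, p_val,
          Letter.vec, Axis.form, fstCoord, sndCoord]⟩
    obtain ⟨a, b, s, rfl⟩ := exists_pt f g
    rw [A.form_pt, hU, mul_zero, zero_add] at h
    obtain rfl := (mul_eq_zero.1 h).resolve_right hV
    exact ⟨f, a, s, hU, rfl⟩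
  have h2 : ∃ (f : Frame) (c s : ℤ), A.form (p f.U) = 0 ∧ 0 ≤ c ∧ g = f.pt c 0 s := by
    obtain ⟨f, c, s, hU, rfl⟩ := h1
    rcases le_total 0 c with hc | hc
    · exact ⟨f, c, s, hU, hc, rfl⟩
    · refine ⟨f.opp, -c, s, ?_, by omega, by rw [f.opp_pt, neg_neg]⟩
      rw [Frame.U, f.opp_letter, A.form_val_letter, hU]
      simp [dV]
  obtain ⟨f, c, s, hU, hc, rfl⟩ := h2
  rcases le_total 0 s with hs | hs
  · exact ⟨f, c, s, hU, hc, hs, rfl⟩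
  · exact ⟨f.mirror, c, -s, hU, hc, by omega, by rw [f.mirror_pt, neg_neg]⟩

theorem Axis.exists_ne (A : Axis) {P : Plane} (h : A.form P ≠ 0) :
    ∃ B : Axis, B ≠ A ∧ B.form P ≠ 0 := by
  by_contra! hcon
  have hx := hcon .x; have hy := hcon .y; have ht := hcon .t
  cases A <;> simp [Axis.form] at h hx hy ht <;> omega

/-- Away from the origin `exists_stdClose_on_axis` applies to every such pair of letters. At the
origin opposite letters are excluded, and the pair `2`, `4` becomes the pair `5`, `1` after
reversing the direction of the axis. -/
theorem exists_stdClose_of_letters {A : Axis} {f : Frame} {c s : ℤ} {L : ℕ} (hU : A.form (p f.U) = 0)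
    (hc : 0 ≤ c) (hs : 0 ≤ s) (hL : 50 ≤ L) {i j : Fin 6} (hi : dV i = 1) (hj : dV j = -1)
    (hne : c = 0 → j ≠ i + 3) (hg : len (f.pt c 0 s * (f.letter i).val) = L)
    (hg' : len (f.pt c 0 s * (f.letter j).val) = L) :
    ∃ g : N, len g = L ∧ A.form (p g) = 0 ∧ dist (f.pt c 0 s * (f.letter i).val) g ≤ 2 ∧
      dist (f.pt c 0 s * (f.letter j).val) g ≤ 2 ∧ StdClose (f.pt c 0 s * (f.letter i).val) g ∧
      StdClose (f.pt c 0 s * (f.letter j).val) g := by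
  have hi' : i = 1 ∨ i = 2 := by fin_cases i <;> simp [dV] at hi ⊢
  have hj' : j = 4 ∨ j = 5 := by fin_cases j <;> simp [dV] at hj ⊢
  by_cases hdir : (i = 1 ∧ j = 5) ∨ ((i = 1 ∨ i = 2) ∧ (j = 4 ∨ j = 5) ∧ 1 ≤ c)
  · obtain ⟨c', s', h1, h2, h3, h4, h5⟩ := exists_stdClose_on_axis hc hs hL hdir hg hg'
    exact ⟨_, h1, by rw [A.form_pt, hU]; simp, h2, h3, h4, h5⟩
  · have hc0 : c = 0 := by omega
    subst hc0
    have hne := hne rfl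
    obtain ⟨rfl, rfl⟩ : i = 2 ∧ j = 4 := by
      rcases hi' with rfl | rfl <;> rcases hj' with rfl | rfl <;> simp_all
    rw [show f.pt 0 0 s = f.opp.pt 0 0 s by rw [f.opp_pt, neg_zero],
      show f.letter 2 = f.opp.letter 5 from (f.opp_letter 5).symm,
      show f.letter 4 = f.opp.letter 1 from (f.opp_letter 1).symm] at *
    obtain ⟨c', s', h1, h2, h3, h4, h5⟩ := exists_stdClose_on_axis le_rfl hs hL (i := 1) (j := 5)
      (Or.inl ⟨rfl, rfl⟩) hg' hg
    refine ⟨_, h1, ?_, h3, h2, h5, h4⟩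
    rw [f.opp_pt, A.form_pt, hU]
    simp

theorem exists_stdClose_of_crosses {g : N} {r : Word} {A : Axis} {L : ℕ} (h : Crosses g r A)
    (hA : ∀ B, Crosses g r B → B = A) (hr : r.length ≤ 2) (hg : len g = L)
    (hg' : len (g * eval r) = L) (hL : 50 ≤ L) :
    ∃ g₁ : N, len g₁ = L ∧ A.form (p g₁) = 0 ∧ dist g g₁ ≤ 2 ∧ dist (g * eval r) g₁ ≤ 2 ∧
      StdClose g g₁ ∧ StdClose (g * eval r) g₁ := by
  obtain ⟨l, l', rfl, hmid, hsign⟩ := h.exists_mid hr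
  obtain ⟨f, c, s, hU, hc, hs, hf⟩ := exists_frame_along A hmid
  obtain ⟨k, hk⟩ := l.exists_inv
  obtain ⟨i, rfl⟩ := letter_surjective f k
  obtain ⟨j, rfl⟩ := letter_surjective f l'
  have e : g = f.pt c 0 s * (f.letter i).val := by rw [← hf, hk]; group
  have e' : g * eval [l, f.letter j] = f.pt c 0 s * (f.letter j).val := by
    rw [← hf]; simp [eval_cons, mul_assoc]
  have hB : ∀ B : Axis, B.form (p g) = c * B.form (p f.U) + B.form (p (f.letter i).val) ∧
      B.form (p (g * eval [l, f.letter j])) =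
        c * B.form (p f.U) + B.form (p (f.letter j).val) := by
    intro B
    constructor
    · rw [e, map_mul, B.form_mul, B.form_pt]; ring
    · rw [e', map_mul, B.form_mul, B.form_pt]; ring
  -- Passing straight through the origin crosses a second axis, which `hA` forbids.
  have hne : c = 0 → j ≠ i + 3 := by
    rintro rfl rfl
    have h1 := hB A
    have h2 : A.form (p (f.letter i).val) ≠ 0 := by omega
    obtain ⟨B, hBA, hBi⟩ := A.exists_ne h2
    refine hBA (hA B (crosses_of_form_neg ?_))
    have h3 := hB B
    have h4 : B.form (p (f.letter (i + 3)).val) = -B.form (p (f.letter i).val) := by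
      rw [B.form_val_letter, B.form_val_letter]
      fin_cases i <;> simp [dU, dV] <;> ring
    omega
  have hA' := hB A
  rw [A.form_val_letter, A.form_val_letter, hU] at hA'
  have di : dV i = -1 ∨ dV i = 0 ∨ dV i = 1 := by have := abs_dU_dV_le i; omega
  have dj : dV j = -1 ∨ dV j = 0 ∨ dV j = 1 := by have := abs_dU_dV_le j; omega
  have hd : (dV i = 1 ∧ dV j = -1) ∨ (dV i = -1 ∧ dV j = 1) := by
    rcases di with di | di | di <;> rcases dj with dj | dj | dj <;> rw [di, dj] at hA' <;> omega
  rw [e'] at hg' ⊢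
  rw [e] at hg ⊢
  rcases hd with ⟨d1, d2⟩ | ⟨d1, d2⟩
  · exact exists_stdClose_of_letters hU hc hs hL d1 d2 hne hg hg'
  · obtain ⟨g₁, h1, h2, h3, h4, h5, h6⟩ := exists_stdClose_of_letters hU hc hs hL d2 d1
      (fun h0 h3 => hne h0 (by rw [h3]; fin_cases j <;> rfl)) hg' hg
    exact ⟨g₁, h1, h2, h4, h3, h6, h5⟩

end NilHex

/-! ### The three alternatives -/

theorem lemma12 (n : ℕ) (g g' : NilHex.N) (r : NilHex.Word)
    (hg : NilHex.len g = n) (hg' : NilHex.len g' = n)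
    (hr : r.length ≤ 2) (hgr : g' = g * NilHex.eval r) :
    (NilHex.len g < 50 ∧ NilHex.len g' < 50) ∨
    NilHex.HaveFellowTravellingGeodesics g g' ∨
    ((∃ A : NilHex.Axis, NilHex.Crosses g r A) ∧
      ∀ A : NilHex.Axis, NilHex.Crosses g r A →
        (∀ B : NilHex.Axis, NilHex.Crosses g r B → B = A) →
        ∃ g'' : NilHex.N, NilHex.len g'' = n ∧ NilHex.dist g g'' ≤ 2 ∧
          A.form (NilHex.p g'') = 0 ∧ NilHex.dist g' g'' ≤ 2 ∧
          NilHex.HaveFellowTravellingGeodesics g g'' ∧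
          NilHex.HaveFellowTravellingGeodesics g'' g') := by
  rcases lt_or_ge n 50 with hn | hn
  · exact Or.inl (by omega)
  right
  by_cases hA : ∃ A : NilHex.Axis, NilHex.Crosses g r A
  · refine Or.inr ⟨hA, fun A h hA' => ?_⟩
    subst hgr
    obtain ⟨g₁, h1, h2, h3, h4, h5, h6⟩ :=
      NilHex.exists_stdClose_of_crosses h hA' hr hg hg' hn
    exact ⟨g₁, h1, h3, h2, h4, h5.haveFellowTravellingGeodesics (by omega),
      h6.symm.haveFellowTravellingGeodesics (by omega)⟩
  · left
    refine NilHex.StdClose.haveFellowTravellingGeodesics ?_ (by omega)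
    refine NilHex.stdClose_of_not_crosses hg hg' hn (NilHex.dist_le_iff.2 ⟨r, hr, hgr⟩)
      fun A => ⟨fun h => hA ⟨A, ?_⟩, fun h => hA ⟨A, ?_⟩⟩
    · exact NilHex.crosses_of_form_neg (Or.inl (hgr ▸ h))
    · exact NilHex.crosses_of_form_neg (Or.inr (hgr ▸ h))
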